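/- **Setting.** All logarithms $\log$ are to base $2$, and information quantities are in bits. Let $X\sim P_X$ and let $P_{Y|X}$ be a channel from $\mathcal X$ to $\mathcal Y$, with output marginal $P_Y$. Assume that $P_{Y|X=x}$ has, for every $x$, a (jointly measurable) density $r(x,y)=P_{Y|X}(y|x)/P_Y(y)$ with respect to $P_Y$ and that the extended bounding condition holds: $r(x,y)\le\omega_x\le\omega$ for all $x,y$, with real constants $\omega$ and $\omega_x$ ($\omega_x$ measurable in $x$; e.g. $\omega_x=\sup_y r(x,y)$, $\omega=\sup_x\omega_x$). Let $N\ge1$ be the batch size. **Common randomness.** $W=((B_1,U_1),(B_2,U_2),\dots)$ is independent of $X$, with $B_i=((Y_{i1},S_{i1}),\dots,(Y_{iN},S_{iN}))$; all variables are independent, $U_i\sim\mathcal U(0,1)$, $Y_{ij}\sim P_Y$, $S_{ij}\sim\mathrm{Exp}(1)$. **Ensemble rejection sampling (ERS).** For $y_{1:N}\in\mathcal Y^N$ put $\hat Z_x(y_{1:N})=\sum_j r(x,y_j)$ and $\bar Z_x(y_{1:N},k)=\hat Z_x(y_{1:N})-r(x,y_k)+\omega_x$, and let $\Delta_x=\mathbb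 E_{Y_{1:N}\sim P_Y^{\otimes N}}[N/\bar Z_x(Y_{1:N},1)]$, $\Delta=N/(N-1+\omega)$. Given $X=x$, the candidate of batch $i$ is $K_i^{\mathrm{cand}}=\arg\min_k S_{ik}/r(x,Y_{ik})$, and batch $i$ is accepted if $$U_i\le\frac{\hat Z_x(Y_{i,1:N})}{\bar Z_x(Y_{i,1:N},K_i^{\mathrm{cand}})}\cdot\frac{\Delta}{\Delta_x}.$$ The batch index $K_1$ is the first accepted $i$, the local index is $K_2=K^{\mathrm{cand}}_{K_1}$, and the selected sample is $Y_K=Y_{K_1,K_2}$. **Coding scheme.** The batches are collected into consecutive groups of $\lfloor\Delta^{-1}\rfloor$ batches. The encoder sends three messages: the index $L=\lceil K_1/\lfloor\Delta^{-1}\rfloor\rceil$ of the group that contains $K_1$; the rank $\hat K_1$ of $U_{K_1}$ among the uniform variables of that group; and the rank $\hat K_2$ of $S_{K_2}$ among $S_{K_1,1},\dots,S_{K_1,N}$. Each message is encoded by a prefix-free binary code for a Zipf distribution on the positive integers, $q_s(k)=k^{-s}/\sum_{j\ge1}j^{-s}$ with $s>1$, with code word lengths $\lceil-\log q_s(k)\rceil$;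 the code words are concatenated. The codes depend neither on $x$ nor on $W$. The rate $R$ is the expected length of the resulting binary string, over $X$ and $W$. **Proposition.** For every batch size $N\ge1$: 1. $Y_K\sim P_{Y|X=x}$ for every $x$, and $D_{KL}(P_{Y|X=x}\|P_Y)$ and $I(X;Y)$ are finite. 2. For every $x$, conditionally on $X=x$, $\mathbb E[\log L]\le1$ and $$\mathbb E[\log\hat K_1]+\mathbb E[\log\hat K_2]\le D_{KL}(P_{Y|X=x}\|P_Y)+2\log e+3.$$ 3. There are three such Zipf exponents and prefix-free codes for $L,\hat K_1,\hat K_2$ for which the decoder recovers $Y_K$ from the binary string and $W$ by a map that does not depend on $x$, and $$R\le I(X;Y)+2\log\big(I(X;Y)+8\big)+12.$$ -/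

import Mathlib

open MeasureTheory ProbabilityTheory
open scoped ENNReal NNReal

noncomputable section

namespace ERS

variable {𝒴 : Type*} {N : ℕ}

/-! ### Information measures, in bits -/

/-- Kullback-Leibler divergence in bits (`InformationTheory.klDiv` is in nats, `∞`-valued). -/
def klBits {α : Type*} [MeasurableSpace α] (P Q : Measure α) : ℝ :=
  (InformationTheory.klDiv P Q).toReal / Real.log 2

/-- Mutual information `I(X;Y)` in bits, for `X ∼ PX` and `Y | X = x ∼ κ x`: the divergence of the
joint law from the product of the marginals. -/
def mutualInfoBits {𝒳 𝒴 : Type*} [MeasurableSpace 𝒳] [MeasurableSpace 𝒴]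
    (PX : Measure 𝒳) (κ : Kernel 𝒳 𝒴) : ℝ :=
  klBits (PX ⊗ₘ κ) (PX.prod (κ ∘ₘ PX))

/-! ### Common randomness -/

/-- A batch: `N` pairs `(Y_j, S_j)` of a proposal and an exponential variable. -/
abbrev Batch (𝒴 : Type*) (N : ℕ) : Type _ := Fin N → 𝒴 × ℝ

/-- A realisation `((B_0, U_0), (B_1, U_1), …)` of the common randomness. -/
abbrev Randomness (𝒴 : Type*) (N : ℕ) : Type _ := ℕ → Batch 𝒴 N × ℝ

/-- The uniform distribution on `[0,1]`. -/
def uniform01 : Measure ℝ := volume.restrict (Set.Icc 0 1)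

/-- The law of the common randomness: all variables are independent, the proposals have law `Q`,
the `S`'s are `Exp(1)` and the `U`'s are uniform on `[0,1]`. -/
def randomnessLaw [MeasurableSpace 𝒴] (Q : Measure 𝒴) (N : ℕ) : Measure (Randomness 𝒴 N) :=
  Measure.infinitePi fun _ : ℕ =>
    (Measure.pi fun _ : Fin N => Q.prod (expMeasure 1)).prod uniform01

instance : IsProbabilityMeasure uniform01 :=
  ⟨by simp [uniform01]⟩

instance : IsProbabilityMeasure (expMeasure 1) :=
  isProbabilityMeasure_expMeasure one_pos

instance [MeasurableSpace 𝒴] (Q : Measure 𝒴) [IsProbabilityMeasure Q] (N : ℕ) :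
    IsProbabilityMeasure (randomnessLaw Q N) := by
  unfold randomnessLaw; infer_instance

/-! ### Ensemble rejection sampling

Below `ρ = dP/dQ` is the ratio of the target `P` to the proposal `Q`, `ωx` bounds `ρ`, and `ω` is
the global bound, which does not depend on the target. -/

/-- `Ẑ(y_{1:N}) = ∑_j ρ(y_j)`. -/
def Zhat (ρ : 𝒴 → ℝ≥0) (y : Fin N → 𝒴) : ℝ := ∑ j, (ρ (y j) : ℝ)

/-- `Z̄(y_{1:N}, k) = Ẑ(y_{1:N}) - ρ(y_k) + ωx`. -/
def Zbar (ρ : 𝒴 → ℝ≥0) (ωx : ℝ) (y : Fin N → 𝒴) (k : Fin N) : ℝ := Zhat ρ y - ρ (y k) + ωx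

/-- `Δ_x = E[N / Z̄(Y_{1:N}, 1)]` for `Y_{1:N}` i.i.d. with law `Q`. -/
def DeltaX [MeasurableSpace 𝒴] (Q : Measure 𝒴) (N : ℕ) [NeZero N] (ρ : 𝒴 → ℝ≥0) (ωx : ℝ) : ℝ :=
  ∫ y : Fin N → 𝒴, (N : ℝ) / Zbar ρ ωx y 0 ∂(Measure.pi fun _ => Q)

/-- `Δ = N / (N - 1 + ω)`. -/
def Delta (N : ℕ) (ω : ℝ) : ℝ := N / (N - 1 + ω)

/-- `S_k / λ_k`, where `λ_k = ρ(Y_k)`; it is `∞` when `λ_k = 0 < S_k`. -/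
def score (ρ : 𝒴 → ℝ≥0) (b : Batch 𝒴 N) (k : Fin N) : ℝ≥0∞ :=
  ENNReal.ofReal (b k).2 / (ρ (b k).1 : ℝ≥0∞)

open Classical in
/-- The candidate index `argmin_k S_k / λ_k` of a batch (the least one, in case of a tie). -/
def cand [NeZero N] (ρ : 𝒴 → ℝ≥0) (b : Batch 𝒴 N) : Fin N :=
  (Finset.univ.filter fun k => ∀ j, score ρ b k ≤ score ρ b j).min' <| by
    obtain ⟨k, -, hk⟩ := Finset.exists_min_image Finset.univ (score ρ b) ⟨0, Finset.mem_univ _⟩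
    exact ⟨k, by simpa using hk⟩

variable [MeasurableSpace 𝒴] [NeZero N]

/-- A batch with its uniform variable is accepted iff
`U ≤ Ẑ(Y_{1:N}) / Z̄(Y_{1:N}, K_cand) * (Δ / Δ_x)`. -/
def Accepts (Q : Measure 𝒴) (ρ : 𝒴 → ℝ≥0) (ωx ω : ℝ) (bu : Batch 𝒴 N × ℝ) : Prop :=
  bu.2 ≤ Zhat ρ (fun j => (bu.1 j).1) / Zbar ρ ωx (fun j => (bu.1 j).1) (cand ρ bu.1)
    * (Delta N ω / DeltaX Q N ρ ωx)

/-- The batch index `K₁`: the first accepted batch, counted from `0` (and `0` on the null event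
that no batch is accepted). -/
def K1 (Q : Measure 𝒴) (ρ : 𝒴 → ℝ≥0) (ωx ω : ℝ) (w : Randomness 𝒴 N) : ℕ :=
  sInf {i | Accepts Q ρ ωx ω (w i)}

/-- The local index `K₂`: the candidate of the selected batch. -/
def K2 (Q : Measure 𝒴) (ρ : 𝒴 → ℝ≥0) (ωx ω : ℝ) (w : Randomness 𝒴 N) : Fin N :=
  cand ρ (w (K1 Q ρ ωx ω w)).1

/-- The selected sample `Y_K = Y_{K₁,K₂}`. -/
def sample (Q : Measure 𝒴) (ρ : 𝒴 → ℝ≥0) (ωx ω : ℝ) (w : Randomness 𝒴 N) : 𝒴 :=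
  ((w (K1 Q ρ ωx ω w)).1 (K2 Q ρ ωx ω w)).1

/-! ### The three messages -/

/-- The position, counted from `1`, of `v k` when the values `v i`, `i ∈ s`, are sorted in
increasing order (equal values being ordered by their index). -/
def rankIn {ι : Type*} [LinearOrder ι] (s : Finset ι) (v : ι → ℝ) (k : ι) : ℕ :=
  (s.filter fun i => v i < v k ∨ (v i = v k ∧ i < k)).card + 1

/-- The number `⌊Δ⁻¹⌋` of batches in a group. -/
def groupSize (N : ℕ) (ω : ℝ) : ℕ := ⌊(Delta N ω)⁻¹⌋₊

/-- The index `L`, counted from `1`, of the group of batches that contains the batch `K₁`. -/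
def groupIndex (Q : Measure 𝒴) (ρ : 𝒴 → ℝ≥0) (ωx ω : ℝ) (w : Randomness 𝒴 N) : ℕ :=
  K1 Q ρ ωx ω w / groupSize N ω + 1

/-- `K̂₁`: the rank of `U_{K₁}` among the uniform variables of the `L`-th group. -/
def K1hat (Q : Measure 𝒴) (ρ : 𝒴 → ℝ≥0) (ωx ω : ℝ) (w : Randomness 𝒴 N) : ℕ :=
  rankIn (Finset.Ico ((groupIndex Q ρ ωx ω w - 1) * groupSize N ω)
    (groupIndex Q ρ ωx ω w * groupSize N ω)) (fun i => (w i).2) (K1 Q ρ ωx ω w)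

/-- `K̂₂`: the rank of `S_{K₂}` among the exponential variables of the selected batch. -/
def K2hat (Q : Measure 𝒴) (ρ : 𝒴 → ℝ≥0) (ωx ω : ℝ) (w : Randomness 𝒴 N) : ℕ :=
  rankIn Finset.univ (fun j => ((w (K1 Q ρ ωx ω w)).1 j).2) (K2 Q ρ ωx ω w)

/-! ### Entropy coding -/

/-- The Zipf distribution with exponent `s > 1` on the positive integers,
`k ↦ k^(-s) / ∑_{j ≥ 1} j^(-s)`. -/
def zipf (s : ℝ) (k : ℕ) : ℝ := (k : ℝ) ^ (-s) / ∑' j : ℕ, ((j : ℝ) + 1) ^ (-s)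

/-- `c` is a prefix-free binary code for the positive integers with the code word lengths
`⌈- log₂ q(k)⌉`, where `q` is the Zipf distribution with exponent `s`. -/
structure IsZipfCode (s : ℝ) (c : ℕ → List Bool) : Prop where
  one_lt : 1 < s
  prefixFree : ∀ i j, 0 < i → 0 < j → c i <+: c j → i = j
  length_eq : ∀ k, 0 < k → (c k).length = ⌈-Real.logb 2 (zipf s k)⌉₊

/-- The encoder's message: the code words of `L`, `K̂₁` and `K̂₂`, one after the other. -/
def encode (cL c₁ c₂ : ℕ → List Bool) (Q : Measure 𝒴) (ρ : 𝒴 → ℝ≥0) (ωx ω : ℝ)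
    (w : Randomness 𝒴 N) : List Bool :=
  cL (groupIndex Q ρ ωx ω w) ++ c₁ (K1hat Q ρ ωx ω w) ++ c₂ (K2hat Q ρ ωx ω w)

end ERS

end

/-! Given proposals `y`, the exponential race makes `k` the candidate with probability `ρ(y_k) / Ẑ`,
and acceptance multiplies this by `Ẑ / Z̄_k * (Δ / Δ_x)`. The `Ẑ` cancels, and `Z̄_k` does not
involve `y_k`. Hence a batch is accepted with probability exactly `Δ` for every target, and the
selected proposal then has density `ρ` (`setLIntegral_acceptSet_proposal`, `map_sample`).

Batches are i.i.d., so the first accepted one follows the conditional law given acceptance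
(`lintegral_eval_firstIndex`). A group of `⌊1/Δ⌋` batches contains an acceptance with probability at
least `1/2`, hence `E[L - 1] ≤ 1`, and `log₂ L ≤ L - 1`.

For the ranks, put `α = Z̄ Δ_x / Ẑ`, `β = Ẑ / (N ρ)` and `d = N / (Z̄ Δ_x)`, evaluated at the
selected batch and sample, so that `α β ρ d = 1` almost surely. Given `U_{K₁} = u`, every other
batch of the group has a smaller `U` with probability at most `u`, even after conditioning on
rejection; this yields `E[α K̂₁] ≤ 2` (`lintegral_mul_K1hat_le`). A competitor beats the race winner
`k` in raw value, jointly with `k` winning, with probability at most `(ρ(y_k) / Ẑ)²`; this yields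
`E[β K̂₂] ≤ 2` (`lintegral_mul_K2hat_le`). Finally `E[d] ≤ 3` (`lintegral_density_le`). Taking
logarithms of `α β ρ d = 1`, using `log t ≤ t - 1` on `α K̂₁`, `β K̂₂` and `d / 4`, and noting that
`E[log ρ]` is the divergence, bounds the two expected logarithms together
(`lintegral_logb_K1hat_add_le`).

For the rate, a Zipf code with exponent `s` costs at most `s log k + log(1 + 1/(s - 1)) + 1` bits.
Averaging the divergence over `X` gives `I`, and the exponent `1 + 1/(I + 7)` balances the two terms
(`rate_le`). -/

namespace ERS

/-! ### Measurability of the selection rule and of the messages -/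

section Measurability

variable {𝒴 : Type*} {N : ℕ}

lemma cand_eq_iff [NeZero N] (ρ : 𝒴 → ℝ≥0) (b : Batch 𝒴 N) (k : Fin N) :
    cand ρ b = k ↔ (∀ j, score ρ b k ≤ score ρ b j) ∧
      ∀ j < k, ¬ ∀ i, score ρ b j ≤ score ρ b i := by
  classical
  unfold cand
  rw [Finset.min'_eq_iff]
  simp only [Finset.mem_filter, Finset.mem_univ, true_and]
  refine and_congr_right fun _ => ⟨fun h j hj hm => ?_, fun h j hm => ?_⟩
  · exact absurd (h j hm) (not_le.2 hj)
  · by_contra hlt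
    exact h j (not_le.1 hlt) hm

variable [MeasurableSpace 𝒴]

lemma measurable_score {ρ : 𝒴 → ℝ≥0} (hρ : Measurable ρ) (k : Fin N) :
    Measurable fun b : Batch 𝒴 N => score ρ b k := by
  unfold score
  fun_prop

lemma measurable_cand [NeZero N] {ρ : 𝒴 → ℝ≥0} (hρ : Measurable ρ) :
    Measurable (cand ρ : Batch 𝒴 N → Fin N) := by
  have hmin (k : Fin N) : MeasurableSet {b : Batch 𝒴 N | ∀ j, score ρ b k ≤ score ρ b j} := by
    rw [Set.ofPred_forall]
    exact .iInter fun j => measurableSet_le (measurable_score hρ k) (measurable_score hρ j)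
  refine measurable_to_countable' fun k => ?_
  have : cand ρ ⁻¹' {k} = {b : Batch 𝒴 N | ∀ j, score ρ b k ≤ score ρ b j} ∩
      ⋂ j, ⋂ (_ : j < k), {b : Batch 𝒴 N | ∀ i, score ρ b j ≤ score ρ b i}ᶜ := by
    ext b
    simp [cand_eq_iff]
  rw [this]
  exact (hmin k).inter (.iInter fun j => .iInter fun _ => (hmin j).compl)

lemma measurable_Zhat {ρ : 𝒴 → ℝ≥0} (hρ : Measurable ρ) :
    Measurable (Zhat ρ : (Fin N → 𝒴) → ℝ) := by
  unfold Zhat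
  fun_prop

lemma measurable_Zbar {ρ : 𝒴 → ℝ≥0} (hρ : Measurable ρ) (ωx : ℝ) (k : Fin N) :
    Measurable fun y : Fin N → 𝒴 => Zbar ρ ωx y k := by
  have := measurable_Zhat (N := N) hρ
  unfold Zbar
  fun_prop

/-- Evaluation at a measurable index with values in a countable space is measurable. -/
lemma _root_.Measurable.eval_countable {α ι β : Type*} [MeasurableSpace α] [MeasurableSpace β]
    [Countable ι] [MeasurableSpace ι] [MeasurableSingletonClass ι] {f : α → ι → β} {k : α → ι}
    (hf : ∀ i, Measurable fun a => f a i) (hk : Measurable k) :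
    Measurable fun a => f a (k a) :=
  (measurable_from_prod_countable_left (f := fun p : α × ι => f p.1 p.2) hf).comp
    (measurable_id.prodMk hk)

/-- The first index at which the sequence is in `A`, or `0` if there is none. -/
noncomputable def firstIndex {E : Type*} (A : Set E) (w : ℕ → E) : ℕ := sInf {i | w i ∈ A}

lemma measurable_firstIndex {E : Type*} [MeasurableSpace E] {A : Set E} (hA : MeasurableSet A) :
    Measurable (firstIndex A) := by
  classical
  have hcoord (i : ℕ) : MeasurableSet {w : ℕ → E | w i ∈ A} := measurable_pi_apply i hA
  refine measurable_to_countable' fun n => ?_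
  -- The second set is the event of no success, where `sInf ∅ = 0`; it only contributes to `n = 0`.
  have hset : firstIndex A ⁻¹' {n} = ({w : ℕ → E | w n ∈ A} ∩ ⋂ l, ⋂ (_ : l < n), {w | w l ∈ A}ᶜ) ∪
      {w | n = 0 ∧ w ∈ ⋂ l, {w : ℕ → E | w l ∈ A}ᶜ} := by
    ext w
    simp only [Set.mem_preimage, Set.mem_singleton_iff, firstIndex, Set.mem_union, Set.mem_inter_iff,
      Set.mem_ofPred_eq, Set.mem_iInter, Set.mem_compl_iff]
    constructor
    · rintro rfl
      by_cases h : {i | w i ∈ A}.Nonempty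
      · exact .inl ⟨Nat.sInf_mem h, fun l hl => Nat.notMem_of_lt_sInf hl⟩
      · rw [Set.not_nonempty_iff_eq_empty] at h
        refine .inr ⟨by simp [h], fun l hl => ?_⟩
        have : l ∈ {i | w i ∈ A} := hl
        simp [h] at this
    · rintro (⟨h1, h2⟩ | ⟨rfl, h⟩)
      · exact le_antisymm (Nat.sInf_le h1)
          (le_csInf ⟨n, h1⟩ fun l hl => not_lt.1 fun hlt => h2 l hlt hl)
      · have : {i | w i ∈ A} = ∅ := Set.eq_empty_of_forall_notMem h
        simp [this]
  rw [hset]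
  refine ((hcoord n).inter (.iInter fun l => .iInter fun _ => (hcoord l).compl)).union ?_
  by_cases hn : n = 0
  · simp only [hn, true_and]
    exact MeasurableSet.iInter fun l => (hcoord l).compl
  · simp [hn]

variable [NeZero N]

/-- The set of accepted batches. -/
def acceptSet (Q : Measure 𝒴) (ρ : 𝒴 → ℝ≥0) (ωx ω : ℝ) : Set (Batch 𝒴 N × ℝ) :=
  {bu | Accepts Q ρ ωx ω bu}

/-- The acceptance threshold of a batch with proposals `y` and candidate `k`. -/
noncomputable def threshold (Q : Measure 𝒴) (ρ : 𝒴 → ℝ≥0) (ωx ω : ℝ) (y : Fin N → 𝒴) (k : Fin N) :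
    ℝ :=
  Zhat ρ y / Zbar ρ ωx y k * (Delta N ω / DeltaX Q N ρ ωx)

lemma measurable_threshold (Q : Measure 𝒴) {ρ : 𝒴 → ℝ≥0} (hρ : Measurable ρ) (ωx ω : ℝ)
    (k : Fin N) : Measurable fun y : Fin N → 𝒴 => threshold Q ρ ωx ω y k := by
  have := measurable_Zhat (N := N) hρ
  have := measurable_Zbar (N := N) hρ ωx k
  unfold threshold
  fun_prop

lemma _root_.Measurable.comp_cand {β : Type*} [MeasurableSpace β] {ρ : 𝒴 → ℝ≥0} (hρ : Measurable ρ)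
    {g : (Fin N → 𝒴) → Fin N → β} (hg : ∀ k, Measurable fun y => g y k) :
    Measurable fun b : Batch 𝒴 N => g (fun j => (b j).1) (cand ρ b) :=
  Measurable.eval_countable (f := fun (b : Batch 𝒴 N) k => g (fun j => (b j).1) k)
    (fun k => (hg k).comp (by fun_prop)) (measurable_cand hρ)

lemma measurableSet_acceptSet (Q : Measure 𝒴) {ρ : 𝒴 → ℝ≥0} (hρ : Measurable ρ) (ωx ω : ℝ) :
    MeasurableSet (acceptSet Q ρ ωx ω : Set (Batch 𝒴 N × ℝ)) :=
  measurableSet_le measurable_snd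
    ((Measurable.comp_cand hρ (measurable_threshold Q hρ ωx ω)).comp measurable_fst)

variable (Q : Measure 𝒴) {ρ : 𝒴 → ℝ≥0} (hρ : Measurable ρ) (ωx ω : ℝ)
include hρ

lemma measurable_K1 : Measurable (K1 Q ρ ωx ω : Randomness 𝒴 N → ℕ) :=
  measurable_firstIndex (measurableSet_acceptSet Q hρ ωx ω)

lemma measurable_selected :
    Measurable fun w : Randomness 𝒴 N => w (K1 Q ρ ωx ω w) :=
  Measurable.eval_countable (fun i => measurable_pi_apply i) (measurable_K1 Q hρ ωx ω)

lemma measurable_K2 : Measurable (K2 Q ρ ωx ω : Randomness 𝒴 N → Fin N) :=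
  (measurable_cand hρ).comp (measurable_fst.comp (measurable_selected Q hρ ωx ω))

lemma measurable_sample : Measurable (sample Q ρ ωx ω : Randomness 𝒴 N → 𝒴) :=
  measurable_fst.comp (Measurable.eval_countable
    (f := fun (w : Randomness 𝒴 N) k => (w (K1 Q ρ ωx ω w)).1 k)
    (fun k => (measurable_pi_apply k).comp (measurable_fst.comp (measurable_selected Q hρ ωx ω)))
    (measurable_K2 Q hρ ωx ω))

lemma measurable_groupIndex : Measurable (groupIndex Q ρ ωx ω : Randomness 𝒴 N → ℕ) :=
  (measurable_of_countable fun n => n / groupSize N ω + 1).comp (measurable_K1 Q hρ ωx ω)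

omit hρ in
lemma measurable_rankIn {α ι : Type*} [MeasurableSpace α] [LinearOrder ι] (s : Finset ι)
    {v : α → ι → ℝ} (hv : ∀ i, Measurable fun a => v a i) (k : ι) :
    Measurable fun a => rankIn s (v a) k := by
  unfold rankIn
  simp_rw [Finset.card_filter]
  refine (Finset.measurable_sum _ fun i _ => ?_).add_const 1
  refine Measurable.ite ?_ measurable_const measurable_const
  exact (measurableSet_lt (hv i) (hv k)).union
    ((measurableSet_eq_fun (hv i) (hv k)).inter (.const _))

lemma measurable_K1hat : Measurable (K1hat Q ρ ωx ω : Randomness 𝒴 N → ℕ) :=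
  Measurable.eval_countable (f := fun (w : Randomness 𝒴 N) (p : ℕ) =>
      rankIn (Finset.Ico ((p / groupSize N ω + 1 - 1) * groupSize N ω)
        ((p / groupSize N ω + 1) * groupSize N ω)) (fun i => (w i).2) p)
    (fun _ => measurable_rankIn _ (fun i => measurable_snd.comp (measurable_pi_apply i)) _)
    (measurable_K1 Q hρ ωx ω)

/-- The rank of the exponential variable of the candidate in its batch. -/
noncomputable def candRank (ρ : 𝒴 → ℝ≥0) (b : Batch 𝒴 N) : ℕ :=
  rankIn Finset.univ (fun j => (b j).2) (cand ρ b)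

lemma measurable_candRank : Measurable (candRank ρ : Batch 𝒴 N → ℕ) :=
  Measurable.eval_countable (f := fun (b : Batch 𝒴 N) k => rankIn Finset.univ (fun j => (b j).2) k)
    (measurable_rankIn _ fun i => measurable_snd.comp (measurable_pi_apply i)) (measurable_cand hρ)

lemma measurable_K2hat : Measurable (K2hat Q ρ ωx ω : Randomness 𝒴 N → ℕ) :=
  (measurable_candRank hρ).comp (measurable_fst.comp (measurable_selected Q hρ ωx ω))

end Measurability

/-! ### Ranks with ties broken by index -/

section Rank

variable {ι : Type*} [LinearOrder ι]

lemma rankIn_lt_rankIn {s : Finset ι} {v : ι → ℝ} {k l : ι} (hk : k ∈ s)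
    (h : v k < v l ∨ (v k = v l ∧ k < l)) : rankIn s v k < rankIn s v l := by
  refine Nat.add_lt_add_right (Finset.card_lt_card ?_) 1
  refine Finset.ssubset_iff_of_subset (fun i hi => ?_) |>.2 ⟨k, by simp [hk, h], by simp⟩
  simp only [Finset.mem_filter] at hi ⊢
  refine ⟨hi.1, ?_⟩
  rcases hi.2 with h1 | ⟨h1, h1'⟩ <;> rcases h with h2 | ⟨h2, h2'⟩
  · exact .inl (h1.trans h2)
  · exact .inl (h2 ▸ h1)
  · exact .inl (h1 ▸ h2)
  · exact .inr ⟨h1.trans h2, h1'.trans h2'⟩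

/-- The tie-breaking makes the order total for every realisation, so decoding is exact pointwise and
not merely almost surely. -/
lemma rankIn_injOn (s : Finset ι) (v : ι → ℝ) : Set.InjOn (rankIn s v) s := by
  intro k hk l hl h
  by_contra hne
  rcases lt_trichotomy (v k) (v l) with hv | hv | hv
  · exact (rankIn_lt_rankIn hk (.inl hv)).ne h
  · rcases lt_or_gt_of_ne hne with hkl | hkl
    · exact (rankIn_lt_rankIn hk (.inr ⟨hv, hkl⟩)).ne h
    · exact (rankIn_lt_rankIn hl (.inr ⟨hv.symm, hkl⟩)).ne' h
  · exact (rankIn_lt_rankIn hl (.inl hv)).ne' h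

lemma rankIn_pos (s : Finset ι) (v : ι → ℝ) (k : ι) : 0 < rankIn s v k := Nat.succ_pos _

/-- Counting ties as well costs nothing in expectation and reduces an expected rank to a sum of
pairwise probabilities. -/
lemma rankIn_le_one_add_sum (s : Finset ι) (v : ι → ℝ) (k : ι) :
    (rankIn s v k : ℝ≥0∞) ≤ 1 + ∑ j ∈ s.erase k, if v j ≤ v k then 1 else 0 := by
  have : rankIn s v k ≤ 1 + ∑ j ∈ s.erase k, if v j ≤ v k then 1 else 0 := by
    rw [rankIn, add_comm, ← Finset.card_filter]
    refine Nat.add_le_add_left (Finset.card_le_card fun j hj => ?_) 1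
    simp only [Finset.mem_filter, Finset.mem_erase] at hj ⊢
    rcases hj with ⟨hjs, h | ⟨h, h'⟩⟩
    · exact ⟨⟨by rintro rfl; exact lt_irrefl _ h, hjs⟩, h.le⟩
    · exact ⟨⟨h'.ne, hjs⟩, h.le⟩
  exact_mod_cast this

end Rank

lemma indicator_one_congr {α β : Type*} {s : Set α} {t : Set β} {a : α} {b : β}
    (h : a ∈ s ↔ b ∈ t) : s.indicator (1 : α → ℝ≥0∞) a = t.indicator 1 b := by
  by_cases ha : a ∈ s
  · rw [Set.indicator_of_mem ha, Set.indicator_of_mem (h.1 ha)]; rfl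
  · rw [Set.indicator_of_notMem ha, Set.indicator_of_notMem (h.not.1 ha)]

/-! ### The first success in an i.i.d. sequence -/

section FirstIndex

variable {E : Type*} [MeasurableSpace E] (μ : Measure E) [IsProbabilityMeasure μ]

/-- Reduces integrals over the infinite product to one coordinate and a finite block, where Tonelli
applies. -/
lemma map_infinitePi_eval_restrict {S : Finset ℕ} {i : ℕ} (hi : i ∉ S) :
    (Measure.infinitePi fun _ : ℕ => μ).map (fun w => (w i, fun l : S => w l)) =
      μ.prod (Measure.pi fun _ : S => μ) := by
  have hind : iIndepFun (fun (i : ℕ) (w : ℕ → E) => w i) (Measure.infinitePi fun _ : ℕ => μ) :=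
    iIndepFun_infinitePi (P := fun _ : ℕ => μ) (X := fun _ e => e) fun _ => measurable_id
  have h := hind.indepFun_finset {i} S (by simpa using hi) fun l => measurable_pi_apply l
  have hφ : Measurable fun v : ({i} : Finset ℕ) → E => v ⟨i, by simp⟩ := measurable_pi_apply _
  have h' : IndepFun (fun w : ℕ → E => w i) (fun w (l : S) => w l)
      (Measure.infinitePi fun _ : ℕ => μ) := h.comp hφ measurable_id
  have h2 := (indepFun_iff_map_prod_eq_prod_map_map
    (measurable_pi_apply i).aemeasurable
    (measurable_pi_lambda _ fun l : S => measurable_pi_apply (l : ℕ)).aemeasurable).1 h'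
  rw [h2, Measure.infinitePi_map_eval (fun _ : ℕ => μ) i]
  congr 1
  exact Measure.infinitePi_map_restrict (fun _ : ℕ => μ)

/-- Given the coordinate `i`, the events concerning the other coordinates are independent. -/
lemma lintegral_infinitePi_eval_indicator {S : Finset ℕ} {i : ℕ} (hi : i ∉ S)
    {f : E → ℝ≥0∞} (hf : Measurable f) {C : ℕ → E → Set E}
    (hC : ∀ l, MeasurableSet {p : E × E | p.2 ∈ C l p.1}) :
    ∫⁻ w, f (w i) * {w : ℕ → E | ∀ l ∈ S, w l ∈ C l (w i)}.indicator 1 w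
        ∂(Measure.infinitePi fun _ : ℕ => μ) =
      ∫⁻ e, f e * ∏ l ∈ S, μ (C l e) ∂μ := by
  set D : Set (E × (S → E)) := {p | ∀ l : S, p.2 l ∈ C l p.1} with hD
  have hDm : MeasurableSet D := by
    have : D = ⋂ l : S, (fun p : E × (S → E) => (p.1, p.2 l)) ⁻¹' {p : E × E | p.2 ∈ C l p.1} := by
      ext p; simp [hD]
    rw [this]
    exact .iInter fun l => (hC l).preimage (by fun_prop)
  have hg : Measurable fun p : E × (S → E) => f p.1 * D.indicator 1 p :=
    (hf.comp measurable_fst).mul (measurable_one.indicator hDm)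
  have h1 : ∫⁻ w, f (w i) * {w : ℕ → E | ∀ l ∈ S, w l ∈ C l (w i)}.indicator 1 w
        ∂(Measure.infinitePi fun _ : ℕ => μ) =
      ∫⁻ p, f p.1 * D.indicator 1 p ∂(μ.prod (Measure.pi fun _ : S => μ)) := by
    rw [← map_infinitePi_eval_restrict μ hi, lintegral_map hg (by fun_prop)]
    refine lintegral_congr fun w => ?_
    congr 1
    refine indicator_one_congr ?_
    change _ ↔ ∀ l : S, w l ∈ C l (w i)
    exact ⟨fun h l => h l l.2, fun h l hl => h ⟨l, hl⟩⟩
  rw [h1, lintegral_prod _ hg.aemeasurable]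
  refine lintegral_congr fun e => ?_
  have hind : (fun v : S → E => D.indicator (1 : E × (S → E) → ℝ≥0∞) (e, v)) =
      (Set.univ.pi fun l : S => C l e).indicator 1 := by
    ext v
    exact indicator_one_congr ⟨fun h l _ => h l, fun h l => h l trivial⟩
  have hCe (l : ℕ) : MeasurableSet (C l e) := (hC l).preimage measurable_prodMk_left
  rw [lintegral_const_mul (f e) (f := fun v => D.indicator (1 : E × (S → E) → ℝ≥0∞) (e, v))
      ((measurable_one.indicator hDm).comp measurable_prodMk_left), hind,
    lintegral_indicator_one (.univ_pi fun l : S => hCe l), Measure.pi_pi,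
    Finset.prod_coe_sort S fun l => μ (C l e)]

/-- The event that `i` is the first index of an element of `A`. -/
def firstAt (A : Set E) (i : ℕ) : Set (ℕ → E) := {w | w i ∈ A ∧ ∀ l < i, w l ∉ A}

variable {A : Set E} (hA : MeasurableSet A)

omit [MeasurableSpace E] in
lemma firstIndex_eq_of_mem_firstAt {i : ℕ} {w : ℕ → E} (hw : w ∈ firstAt A i) :
    firstIndex A w = i :=
  le_antisymm (Nat.sInf_le hw.1)
    (le_csInf ⟨i, hw.1⟩ fun l hl => not_lt.1 fun hlt => hw.2 l hlt hl)

include hA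

lemma measurableSet_firstAt (i : ℕ) : MeasurableSet (firstAt A i) := by
  have : firstAt A i = {w : ℕ → E | w i ∈ A} ∩ ⋂ l, ⋂ (_ : l < i), {w : ℕ → E | w l ∈ A}ᶜ := by
    ext w; simp [firstAt]
  rw [this]
  exact (measurable_pi_apply i hA).inter
    (.iInter fun l => .iInter fun _ => (measurable_pi_apply l hA).compl)

lemma measure_le_firstIndex (m : ℕ) :
    (Measure.infinitePi fun _ : ℕ => μ) {w | ∀ l < m, w l ∉ A} = (1 - μ A) ^ m := by
  have : {w : ℕ → E | ∀ l < m, w l ∉ A} = (Finset.range m : Set ℕ).pi fun _ => Aᶜ := by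
    ext w; simp [Set.mem_pi]
  rw [this, Measure.infinitePi_pi _ fun _ _ => hA.compl, Finset.prod_const, Finset.card_range,
    prob_compl_eq_one_sub hA]

lemma ae_exists_mem (hpos : μ A ≠ 0) :
    ∀ᵐ w ∂(Measure.infinitePi fun _ : ℕ => μ), ∃ i, w i ∈ A := by
  rw [ae_iff]
  have hlt : 1 - μ A < 1 := ENNReal.sub_lt_self (by simp) one_ne_zero hpos
  refine le_antisymm (ge_of_tendsto' (ENNReal.tendsto_pow_atTop_nhds_zero_of_lt_one hlt)
    fun m => ?_) zero_le
  rw [← measure_le_firstIndex μ hA m]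
  exact measure_mono fun w hw l _ hl => hw ⟨l, hl⟩

/-- The events `firstAt A i` are disjoint and cover almost everything, so the default value of
`firstIndex` never matters. -/
lemma lintegral_eq_tsum_firstAt (hpos : μ A ≠ 0) (F : (ℕ → E) → ℝ≥0∞) :
    ∫⁻ w, F w ∂(Measure.infinitePi fun _ : ℕ => μ) =
      ∑' i, ∫⁻ w in firstAt A i, F w ∂(Measure.infinitePi fun _ : ℕ => μ) := by
  rw [← lintegral_iUnion (measurableSet_firstAt hA)]
  · rw [← setLIntegral_univ]
    refine setLIntegral_congr ?_
    filter_upwards [ae_exists_mem μ hA hpos] with w hw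
    classical
    have : w ∈ ⋃ i, firstAt A i :=
      Set.mem_iUnion.2 ⟨Nat.find hw, Nat.find_spec hw, fun l hl => Nat.find_min hw hl⟩
    exact propext ⟨fun _ => this, fun _ => trivial⟩
  · intro i j hij
    refine Set.disjoint_left.2 fun w hi hj => hij ?_
    rw [← firstIndex_eq_of_mem_firstAt hi, firstIndex_eq_of_mem_firstAt hj]

lemma setLIntegral_firstAt_eval (i : ℕ) {f : E → ℝ≥0∞} (hf : Measurable f) :
    ∫⁻ w in firstAt A i, f (w i) ∂(Measure.infinitePi fun _ : ℕ => μ) =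
      (1 - μ A) ^ i * ∫⁻ e in A, f e ∂μ := by
  have h := lintegral_infinitePi_eval_indicator μ (S := Finset.range i) (i := i) (by simp)
    (hf.indicator hA) (C := fun _ _ => Aᶜ) fun _ => hA.compl.preimage measurable_snd
  simp only [Finset.prod_const, Finset.card_range, prob_compl_eq_one_sub hA] at h
  rw [lintegral_mul_const _ (hf.indicator hA), lintegral_indicator hA, mul_comm] at h
  rw [← h, ← lintegral_indicator (measurableSet_firstAt hA i)]
  refine lintegral_congr fun w => ?_
  by_cases h1 : w i ∈ A
  · by_cases h2 : ∀ l < i, w l ∉ A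
    · have h3 : w ∈ {w : ℕ → E | ∀ l ∈ Finset.range i, w l ∈ Aᶜ} :=
        fun l hl => h2 l (Finset.mem_range.1 hl)
      rw [Set.indicator_of_mem h1, Set.indicator_of_mem h3,
        Set.indicator_of_mem (show w ∈ firstAt A i from ⟨h1, h2⟩)]
      simp
    · have h3 : w ∉ {w : ℕ → E | ∀ l ∈ Finset.range i, w l ∈ Aᶜ} :=
        fun h => h2 fun l hl => h l (Finset.mem_range.2 hl)
      rw [Set.indicator_of_notMem h3, Set.indicator_of_notMem fun h => h2 h.2, mul_zero]
  · rw [Set.indicator_of_notMem h1, Set.indicator_of_notMem fun h => h1 h.1, zero_mul]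

/-- The law of the first element in `A` is the conditional law given `A`. -/
lemma lintegral_eval_firstIndex (hpos : μ A ≠ 0) {f : E → ℝ≥0∞} (hf : Measurable f) :
    ∫⁻ w, f (w (firstIndex A w)) ∂(Measure.infinitePi fun _ : ℕ => μ) =
      (μ A)⁻¹ * ∫⁻ e in A, f e ∂μ := by
  rw [lintegral_eq_tsum_firstAt μ hA hpos]
  have (i : ℕ) : ∫⁻ w in firstAt A i, f (w (firstIndex A w)) ∂(Measure.infinitePi fun _ : ℕ => μ) =
      (1 - μ A) ^ i * ∫⁻ e in A, f e ∂μ := by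
    rw [← setLIntegral_firstAt_eval μ hA i hf]
    refine setLIntegral_congr_fun (measurableSet_firstAt hA i) fun w hw => ?_
    simp only [firstIndex_eq_of_mem_firstAt hw]
  simp_rw [this]
  rw [ENNReal.tsum_mul_right, ENNReal.tsum_geometric,
    ENNReal.sub_sub_cancel ENNReal.one_ne_top prob_le_one]

/-- Fix the selected element `e`. A later index `j` satisfies `V (w j) ≤ V e` with probability at
most `V e`. An earlier one must also avoid `A`, and `hVAle` says that the two requirements together
cost at most the product `(1 - μ A) * V e`. In both cases the comparison costs one factor `V e` on
top of `(1 - μ A) ^ i`. -/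
lemma setLIntegral_firstAt_le {f : E → ℝ≥0∞} (hf : Measurable f) {V : E → ℝ} (hV : Measurable V)
    (hVle : ∀ u, μ {e | V e ≤ u} ≤ ENNReal.ofReal u)
    (hVAle : ∀ u, μ (Aᶜ ∩ {e | V e ≤ u}) ≤ (1 - μ A) * ENNReal.ofReal u) {i j : ℕ} (hij : j ≠ i) :
    ∫⁻ w in firstAt A i, f (w i) * (if V (w j) ≤ V (w i) then 1 else 0)
        ∂(Measure.infinitePi fun _ : ℕ => μ) ≤
      (1 - μ A) ^ i * ∫⁻ e in A, f e * ENNReal.ofReal (V e) ∂μ := by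
  classical
  -- Rejection is required for `l < i` and the comparison for `l = j`; over `insert j (range i)`
  -- this treats `j < i` and `j > i` at once.
  set C : ℕ → E → Set E := fun l e =>
    (if l < i then Aᶜ else Set.univ) ∩ (if l = j then {e' | V e' ≤ V e} else Set.univ) with hC
  have hCm (l : ℕ) : MeasurableSet {p : E × E | p.2 ∈ C l p.1} := by
    have hle : MeasurableSet {p : E × E | V p.2 ≤ V p.1} :=
      measurableSet_le (hV.comp measurable_snd) (hV.comp measurable_fst)
    have h2 : MeasurableSet {p : E × E | p.2 ∈ Aᶜ} := hA.compl.preimage measurable_snd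
    simp only [hC]
    split_ifs
    · exact h2.inter hle
    · exact h2.inter .univ
    · exact MeasurableSet.univ.inter hle
    · exact MeasurableSet.univ.inter .univ
  have hS : i ∉ insert j (Finset.range i) := by simp [hij.symm]
  have h := lintegral_infinitePi_eval_indicator μ hS (hf.indicator hA) hCm
  have hbound (l : ℕ) (e : E) : μ (C l e) ≤
      (if l < i then 1 - μ A else 1) * (if l = j then ENNReal.ofReal (V e) else 1) := by
    simp only [hC]
    split_ifs
    · exact hVAle (V e)
    · simp [prob_compl_eq_one_sub hA]
    · simpa using hVle (V e)
    · simp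
  have hprod (e : E) : ∏ l ∈ insert j (Finset.range i), μ (C l e) ≤
      (1 - μ A) ^ i * ENNReal.ofReal (V e) := by
    refine (Finset.prod_le_prod' fun l _ => hbound l e).trans_eq ?_
    rw [Finset.prod_mul_distrib, Finset.prod_ite_eq', if_pos (Finset.mem_insert_self _ _),
      ← Finset.prod_filter]
    have : (insert j (Finset.range i)).filter (· < i) = Finset.range i := by
      ext l
      simp only [Finset.mem_filter, Finset.mem_insert, Finset.mem_range]
      exact ⟨fun h => h.2, fun h => ⟨.inr h, h⟩⟩
    rw [this, Finset.prod_const, Finset.card_range]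
  calc ∫⁻ w in firstAt A i, f (w i) * (if V (w j) ≤ V (w i) then 1 else 0)
        ∂(Measure.infinitePi fun _ : ℕ => μ)
      = ∫⁻ w, A.indicator f (w i) *
          {w : ℕ → E | ∀ l ∈ insert j (Finset.range i), w l ∈ C l (w i)}.indicator 1 w
        ∂(Measure.infinitePi fun _ : ℕ => μ) := by
        rw [← lintegral_indicator (measurableSet_firstAt hA i)]
        refine lintegral_congr fun w => ?_
        have hiff : w ∈ {w : ℕ → E | ∀ l ∈ insert j (Finset.range i), w l ∈ C l (w i)} ↔
            (∀ l < i, w l ∉ A) ∧ V (w j) ≤ V (w i) := by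
          simp only [Set.mem_ofPred_eq, Finset.mem_insert, Finset.mem_range, hC, Set.mem_inter_iff]
          constructor
          · refine fun h => ⟨fun l hl => ?_, ?_⟩
            · simpa [hl] using (h l (.inr hl)).1
            · simpa using (h j (.inl rfl)).2
          · rintro ⟨h1, h2⟩ l -
            refine ⟨?_, ?_⟩
            · split_ifs with hl
              · exact h1 l hl
              · trivial
            · split_ifs with hl
              · subst hl; exact h2
              · trivial
        by_cases h1 : w i ∈ A
        · by_cases h2 : ∀ l < i, w l ∉ A
          · rw [Set.indicator_of_mem h1, Set.indicator_of_mem (show w ∈ firstAt A i from ⟨h1, h2⟩)]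
            by_cases h3 : V (w j) ≤ V (w i)
            · rw [if_pos h3, Set.indicator_of_mem (hiff.2 ⟨h2, h3⟩)]
              simp
            · rw [if_neg h3, Set.indicator_of_notMem fun h => h3 (hiff.1 h).2]
          · rw [Set.indicator_of_notMem (fun h => h2 (hiff.1 h).1),
              Set.indicator_of_notMem fun h => h2 h.2, mul_zero]
        · rw [Set.indicator_of_notMem h1, Set.indicator_of_notMem fun h => h1 h.1, zero_mul]
    _ = ∫⁻ e, A.indicator f e * ∏ l ∈ insert j (Finset.range i), μ (C l e) ∂μ := h
    _ ≤ ∫⁻ e, (1 - μ A) ^ i * A.indicator (fun e => f e * ENNReal.ofReal (V e)) e ∂μ := by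
        refine lintegral_mono fun e => ?_
        by_cases he : e ∈ A
        · simp only [Set.indicator_of_mem he]
          refine (mul_le_mul_right (hprod e) _).trans_eq ?_
          ring
        · simp [Set.indicator_of_notMem he]
    _ = _ := by
        have hfV : Measurable fun e => f e * ENNReal.ofReal (V e) := hf.mul hV.ennreal_ofReal
        rw [lintegral_const_mul _ (hfV.indicator hA), lintegral_indicator hA]

/-- The rank of the value of `V` at the first index in its group, weighted by a function of the
first element in `A`. -/
lemma lintegral_mul_rankIn_le (hpos : μ A ≠ 0) {f : E → ℝ≥0∞} (hf : Measurable f) {V : E → ℝ}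
    (hV : Measurable V) (hVle : ∀ u, μ {e | V e ≤ u} ≤ ENNReal.ofReal u)
    (hVAle : ∀ u, μ (Aᶜ ∩ {e | V e ≤ u}) ≤ (1 - μ A) * ENNReal.ofReal u) (G : ℕ) :
    ∫⁻ w, f (w (firstIndex A w)) * (rankIn (Finset.Ico ((firstIndex A w / G + 1 - 1) * G)
        ((firstIndex A w / G + 1) * G)) (fun i => V (w i)) (firstIndex A w) : ℝ≥0∞)
        ∂(Measure.infinitePi fun _ : ℕ => μ) ≤
      (μ A)⁻¹ * ∫⁻ e in A, f e * (1 + G * ENNReal.ofReal (V e)) ∂μ := by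
  rw [lintegral_eq_tsum_firstAt μ hA hpos]
  have key (i : ℕ) : ∫⁻ w in firstAt A i, f (w (firstIndex A w)) *
      (rankIn (Finset.Ico ((firstIndex A w / G + 1 - 1) * G)
        ((firstIndex A w / G + 1) * G)) (fun i => V (w i)) (firstIndex A w) : ℝ≥0∞)
        ∂(Measure.infinitePi fun _ : ℕ => μ) ≤
      (1 - μ A) ^ i * ∫⁻ e in A, f e * (1 + G * ENNReal.ofReal (V e)) ∂μ := by
    set s := Finset.Ico ((i / G + 1 - 1) * G) ((i / G + 1) * G) with hs
    calc _ ≤ ∫⁻ w in firstAt A i, (f (w i) + ∑ j ∈ s.erase i,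
              f (w i) * (if V (w j) ≤ V (w i) then 1 else 0))
            ∂(Measure.infinitePi fun _ : ℕ => μ) := by
          refine setLIntegral_mono' (measurableSet_firstAt hA i) fun w hw => ?_
          rw [firstIndex_eq_of_mem_firstAt hw, ← Finset.mul_sum]
          refine (mul_le_mul_right (rankIn_le_one_add_sum s _ i) _).trans_eq ?_
          rw [mul_add, mul_one]
      _ = ∫⁻ w in firstAt A i, f (w i) ∂(Measure.infinitePi fun _ : ℕ => μ) +
            ∑ j ∈ s.erase i, ∫⁻ w in firstAt A i, f (w i) * (if V (w j) ≤ V (w i) then 1 else 0)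
            ∂(Measure.infinitePi fun _ : ℕ => μ) := by
          have hfi : Measurable fun w : ℕ → E => f (w i) := hf.comp (measurable_pi_apply i)
          rw [lintegral_add_left hfi, lintegral_finsetSum]
          intro j _
          refine (hf.comp (measurable_pi_apply i)).mul (Measurable.ite ?_ measurable_const
            measurable_const)
          exact measurableSet_le (hV.comp (measurable_pi_apply j)) (hV.comp (measurable_pi_apply i))
      _ ≤ (1 - μ A) ^ i * ∫⁻ e in A, f e ∂μ +
            ∑ _j ∈ s.erase i, (1 - μ A) ^ i * ∫⁻ e in A, f e * ENNReal.ofReal (V e) ∂μ := by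
          rw [setLIntegral_firstAt_eval μ hA i hf]
          refine add_le_add_right (Finset.sum_le_sum fun j hj => ?_) _
          exact setLIntegral_firstAt_le μ hA hf hV hVle hVAle (Finset.ne_of_mem_erase hj)
      _ ≤ (1 - μ A) ^ i * ∫⁻ e in A, f e ∂μ +
            G * ((1 - μ A) ^ i * ∫⁻ e in A, f e * ENNReal.ofReal (V e) ∂μ) := by
          rw [Finset.sum_const, nsmul_eq_mul]
          refine add_le_add_right (mul_le_mul_left (Nat.cast_le.2 ?_) _) _
          refine (Finset.card_le_card (Finset.erase_subset _ _)).trans_eq ?_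
          rw [hs, Nat.card_Ico, ← Nat.sub_mul]
          simp
      _ = _ := by
          simp_rw [mul_add, mul_one]
          rw [lintegral_add_left hf]
          have : ∀ e, f e * (G * ENNReal.ofReal (V e)) = G * (f e * ENNReal.ofReal (V e)) :=
            fun e => by ring
          simp_rw [this]
          have hfV : Measurable fun e => f e * ENNReal.ofReal (V e) := hf.mul hV.ennreal_ofReal
          rw [lintegral_const_mul _ hfV]
          ring
  refine (ENNReal.tsum_le_tsum key).trans_eq ?_
  rw [ENNReal.tsum_mul_right, ENNReal.tsum_geometric,
    ENNReal.sub_sub_cancel ENNReal.one_ne_top prob_le_one]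

/-- If a group of `G` elements avoids `A` with probability at most `1/2`, then the expected number
of groups before the first element of `A` is at most one. -/
lemma lintegral_firstIndex_div_le {G : ℕ} (hG : 0 < G) (hhalf : (1 - μ A) ^ G ≤ 2⁻¹) :
    ∫⁻ w, ((firstIndex A w / G : ℕ) : ℝ≥0∞) ∂(Measure.infinitePi fun _ : ℕ => μ) ≤ 1 := by
  classical
  have hset (m : ℕ) : MeasurableSet {w : ℕ → E | (m + 1) * G ≤ firstIndex A w} :=
    measurableSet_le measurable_const (measurable_firstIndex hA)
  have hnat (n : ℕ) : (n : ℝ≥0∞) = ∑' m : ℕ, if m + 1 ≤ n then 1 else 0 := by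
    rw [tsum_eq_sum (s := Finset.range n) fun m hm => by simpa using hm,
      Finset.sum_congr rfl fun m hm => if_pos (Nat.succ_le_of_lt (Finset.mem_range.1 hm))]
    simp
  -- Tail-sum formula: the quotient exceeds `m` only if the first `m + 1` groups all avoid `A`.
  calc ∫⁻ w, ((firstIndex A w / G : ℕ) : ℝ≥0∞) ∂(Measure.infinitePi fun _ : ℕ => μ)
      = ∫⁻ w, ∑' m : ℕ, {w : ℕ → E | (m + 1) * G ≤ firstIndex A w}.indicator 1 w
          ∂(Measure.infinitePi fun _ : ℕ => μ) := by
        refine lintegral_congr fun w => ?_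
        rw [hnat]
        refine tsum_congr fun m => ?_
        simp [Set.indicator, Nat.le_div_iff_mul_le hG]
    _ = ∑' m : ℕ, (Measure.infinitePi fun _ : ℕ => μ) {w | (m + 1) * G ≤ firstIndex A w} := by
        rw [lintegral_tsum fun m => (measurable_one.indicator (hset m)).aemeasurable]
        exact tsum_congr fun m => lintegral_indicator_one (hset m)
    _ ≤ ∑' m : ℕ, (2⁻¹ : ℝ≥0∞) ^ (m + 1) := by
        refine ENNReal.tsum_le_tsum fun m => ?_
        calc _ ≤ (Measure.infinitePi fun _ : ℕ => μ) {w | ∀ l < (m + 1) * G, w l ∉ A} :=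
              measure_mono fun w hw l hl => Nat.notMem_of_lt_sInf (hl.trans_le hw)
          _ = ((1 - μ A) ^ G) ^ (m + 1) := by rw [measure_le_firstIndex μ hA, ← pow_mul, mul_comm]
          _ ≤ _ := by gcongr
    _ = 1 := by
        rw [ENNReal.tsum_geometric_add_one, ENNReal.one_sub_inv_two, inv_inv,
          ENNReal.inv_mul_cancel two_ne_zero ENNReal.ofNat_ne_top]

end FirstIndex

/-! ### Integrals and probabilities for `Exp(1)` -/

section Exponential

lemma lintegral_expMeasure_one {f : ℝ → ℝ≥0∞} (hf : Measurable f) :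
    ∫⁻ x, f x ∂(expMeasure 1) = ∫⁻ x in Set.Ici 0, ENNReal.ofReal (Real.exp (-x)) * f x := by
  have h : expMeasure 1 = volume.withDensity (exponentialPDF 1) := rfl
  have hm : Measurable (exponentialPDF 1) := (measurable_exponentialPDFReal 1).ennreal_ofReal
  rw [h, lintegral_withDensity_eq_lintegral_mul _ hm hf, ← lintegral_indicator measurableSet_Ici]
  refine lintegral_congr fun x => ?_
  by_cases hx : 0 ≤ x
  · simp [exponentialPDF_of_nonneg hx, hx]
  · simp [exponentialPDF_of_neg (not_le.1 hx), hx]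

/-- This is the normalisation of the exponential density; the next integral is that of the Gamma
density with shape 2. -/
lemma lintegral_exp_neg_mul_Ici {θ : ℝ} (hθ : 0 < θ) :
    ∫⁻ x in Set.Ici 0, ENNReal.ofReal (Real.exp (-(θ * x))) = ENNReal.ofReal (1 / θ) := by
  have h := lintegral_exponentialPDF_eq_one hθ
  have h' : ∫⁻ x, exponentialPDF θ x =
      ENNReal.ofReal θ * ∫⁻ x in Set.Ici 0, ENNReal.ofReal (Real.exp (-(θ * x))) := by
    rw [← lintegral_const_mul _ (by fun_prop), ← lintegral_indicator measurableSet_Ici]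
    refine lintegral_congr fun x => ?_
    by_cases hx : 0 ≤ x
    · simp [exponentialPDF_of_nonneg hx, hx, ENNReal.ofReal_mul hθ.le]
    · simp [exponentialPDF_of_neg (not_le.1 hx), hx]
  rw [one_div, ENNReal.ofReal_inv_of_pos hθ]
  exact ENNReal.eq_inv_of_mul_eq_one_left (by rw [mul_comm, ← h', h])

lemma lintegral_mul_exp_neg_mul_Ici {θ : ℝ} (hθ : 0 < θ) :
    ∫⁻ x in Set.Ici 0, ENNReal.ofReal (x * Real.exp (-(θ * x))) =
      ENNReal.ofReal ((1 / θ) ^ 2) := by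
  have h := lintegral_gammaPDF_eq_one (a := 2) two_pos hθ
  have h' : ∫⁻ x, gammaPDF 2 θ x =
      ENNReal.ofReal (θ ^ 2) * ∫⁻ x in Set.Ici 0, ENNReal.ofReal (x * Real.exp (-(θ * x))) := by
    rw [← lintegral_const_mul _ (by fun_prop), ← lintegral_indicator measurableSet_Ici]
    refine lintegral_congr fun x => ?_
    by_cases hx : 0 ≤ x
    · rw [gammaPDF_of_nonneg hx, Set.indicator_of_mem (show x ∈ Set.Ici 0 from hx),
        ← ENNReal.ofReal_mul (by positivity)]
      congr 1
      have h1 : Real.Gamma 2 = 1 := Real.Gamma_two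
      have h2 : (2 : ℝ) - 1 = 1 := by norm_num
      rw [h1, h2, Real.rpow_one, Real.rpow_two]
      ring
    · simp [gammaPDF_of_neg (not_le.1 hx), hx]
  rw [one_div, inv_pow, ENNReal.ofReal_inv_of_pos (by positivity)]
  exact ENNReal.eq_inv_of_mul_eq_one_left (by rw [mul_comm, ← h', h])

lemma expMeasure_one_absolutelyContinuous : expMeasure 1 ≪ volume :=
  withDensity_absolutelyContinuous _ _

lemma ae_expMeasure_one_pos : ∀ᵐ x ∂(expMeasure 1), 0 < x := by
  rw [ae_iff]
  have : {x : ℝ | ¬ 0 < x} = Set.Iic 0 := by ext x; simp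
  rw [this, ← ofReal_cdf, cdf_expMeasure_eq one_pos]
  simp

/-- Compared with the tail `exp (-c)`, the upper limit `x` costs one factor `x`, which turns an
exponential integral of the race into a Gamma integral. The inequality `exp (-c) - exp (-x) ≤ x *
exp (-c)` follows from `1 - x ≤ exp (-x)` and `exp (-c) ≤ 1`. -/
lemma expMeasure_one_Icc_le {c x : ℝ} (hc : 0 ≤ c) (hx : 0 ≤ x) :
    expMeasure 1 (Set.Icc c x) ≤ ENNReal.ofReal (x * Real.exp (-c)) := by
  rcases lt_or_ge x c with h | h
  · simp [Set.Icc_eq_empty (not_le.2 h)]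
  · have hae : Set.Icc c x =ᵐ[expMeasure 1] Set.Ioc c x :=
      (expMeasure_one_absolutelyContinuous.ae_eq Ioc_ae_eq_Icc).symm
    have hdiff : Set.Ioc c x = Set.Iic x \ Set.Iic c := by ext; simp [and_comm]
    rw [measure_congr hae, hdiff, measure_sdiff (Set.Iic_subset_Iic.2 h)
      measurableSet_Iic.nullMeasurableSet (measure_ne_top _ _), ← ofReal_cdf, ← ofReal_cdf,
      ← ENNReal.ofReal_sub _ (cdf_nonneg _ _), cdf_expMeasure_eq one_pos,
      cdf_expMeasure_eq one_pos, if_pos hx, if_pos hc]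
    refine ENNReal.ofReal_le_ofReal ?_
    have h1 : Real.exp (-c) * (1 - c - x) ≤ Real.exp (-c) * (1 - x) := by gcongr; linarith
    have h2 : Real.exp (-c) * (1 - x) ≤ Real.exp (-c) * Real.exp (-x) := by
      gcongr; linarith [Real.add_one_le_exp (-x)]
    have h3 : Real.exp (-c) * Real.exp (-x) ≤ Real.exp (-x) := by
      have := Real.exp_le_one_iff.2 (neg_nonpos.2 hc)
      nlinarith [Real.exp_pos (-x)]
    simp only [one_mul]
    nlinarith

lemma expMeasure_one_Ici {c : ℝ} (hc : 0 ≤ c) :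
    expMeasure 1 (Set.Ici c) = ENNReal.ofReal (Real.exp (-c)) := by
  have hae : Set.Ici c =ᵐ[expMeasure 1] Set.Ioi c :=
    (expMeasure_one_absolutelyContinuous.ae_eq Ioi_ae_eq_Ici).symm
  rw [measure_congr hae, ← Set.compl_Iic, prob_compl_eq_one_sub measurableSet_Iic, ← ofReal_cdf,
    cdf_expMeasure_eq one_pos, if_pos hc, ← ENNReal.ofReal_one,
    ← ENNReal.ofReal_sub _ (by simpa using hc)]
  simp

end Exponential

/-! ### The exponential race -/

section Race

variable {n : ℕ} (l : Fin (n + 1) → ℝ≥0) (k : Fin (n + 1))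

/-- The product measure of `n + 1` exponential variables, one of which is singled out. -/
lemma pi_expMeasure_eq_lintegral {B : Fin n → ℝ → Set ℝ}
    (hB : ∀ j, MeasurableSet {p : ℝ × ℝ | p.2 ∈ B j p.1}) :
    (Measure.pi fun _ : Fin (n + 1) => expMeasure 1)
        {s | ∀ j, s (k.succAbove j) ∈ B j (s k)} =
      ∫⁻ x, ∏ j, expMeasure 1 (B j x) ∂(expMeasure 1) := by
  have hmp := measurePreserving_piFinSuccAbove (fun _ : Fin (n + 1) => expMeasure 1) k
  set D : Set (ℝ × (Fin n → ℝ)) := {p | ∀ j, p.2 j ∈ B j p.1}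
  have hD : MeasurableSet D := by
    have : D = ⋂ j, (fun p : ℝ × (Fin n → ℝ) => (p.1, p.2 j)) ⁻¹' {p : ℝ × ℝ | p.2 ∈ B j p.1} := by
      ext p; simp [D]
    rw [this]
    exact .iInter fun j => (hB j).preimage (by fun_prop)
  have hpre : {s : Fin (n + 1) → ℝ | ∀ j, s (k.succAbove j) ∈ B j (s k)} =
      (MeasurableEquiv.piFinSuccAbove (fun _ => ℝ) k) ⁻¹' D := rfl
  rw [hpre, hmp.measure_preimage hD.nullMeasurableSet, Measure.prod_apply hD]
  refine lintegral_congr fun x => ?_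
  have : Prod.mk x ⁻¹' D = Set.univ.pi fun j => B j x := by
    ext v; simp [D, Set.mem_pi]
  rw [this, Measure.pi_pi]

/-- If `b = 0`, the right-hand score is `∞` and the conclusion is just `0 ≤ y`. -/
lemma ofReal_div_le_ofReal_div {a b : ℝ≥0} (ha : 0 < a) {x y : ℝ} (hy : 0 < y)
    (h : ENNReal.ofReal x / a ≤ ENNReal.ofReal y / b) : b / a * x ≤ y := by
  rcases eq_or_ne b 0 with rfl | hb
  · simpa using hy.le
  have ha' : (0 : ℝ) < a := by exact_mod_cast ha
  have hb' : (0 : ℝ) < b := by exact_mod_cast pos_iff_ne_zero.2 hb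
  rw [← ENNReal.ofReal_coe_nnreal, ← ENNReal.ofReal_coe_nnreal, ← ENNReal.ofReal_div_of_pos ha',
    ← ENNReal.ofReal_div_of_pos hb', ENNReal.ofReal_le_ofReal_iff (by positivity)] at h
  rw [div_le_div_iff₀ ha' hb'] at h
  rw [div_mul_eq_mul_div, div_le_iff₀ ha']
  linarith

/-- The event that the index `k` minimises `s_j / l_j`. -/
def minimalAt (l : Fin (n + 1) → ℝ≥0) (k : Fin (n + 1)) : Set (Fin (n + 1) → ℝ) :=
  {s | ∀ j, ENNReal.ofReal (s k) / (l k : ℝ≥0∞) ≤ ENNReal.ofReal (s j) / (l j : ℝ≥0∞)}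

lemma ae_pi_expMeasure_pos : ∀ᵐ s ∂(Measure.pi fun _ : Fin (n + 1) => expMeasure 1), ∀ j, 0 < s j :=
  ae_all_iff.2 fun _ => Measure.tendsto_eval_ae_ae.eventually ae_expMeasure_one_pos

lemma sum_succAbove_div (hk : 0 < l k) :
    1 + ∑ j, (l (k.succAbove j) : ℝ) / l k = (∑ j, (l j : ℝ)) / l k := by
  have hk' : (l k : ℝ) ≠ 0 := by exact_mod_cast hk.ne'
  rw [Fin.sum_univ_succAbove _ k, add_div, div_self hk', Finset.sum_div]

lemma prod_expMeasure_Ici {x : ℝ} (hx : 0 ≤ x) (t : Finset (Fin n)) :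
    ∏ j ∈ t, expMeasure 1 (Set.Ici ((l (k.succAbove j) : ℝ) / l k * x)) =
      ENNReal.ofReal (Real.exp (-((∑ j ∈ t, (l (k.succAbove j) : ℝ) / l k) * x))) := by
  rw [Finset.prod_congr rfl fun j _ => expMeasure_one_Ici
      (c := (l (k.succAbove j) : ℝ) / l k * x) (by positivity),
    ← ENNReal.ofReal_prod_of_nonneg fun _ _ => (Real.exp_pos _).le, ← Real.exp_sum,
    Finset.sum_neg_distrib, Finset.sum_mul]

/-- Given `s k = x`, every other variable must be at least `(l j / l k) * x`. The product of these
tails and the density of `s k` is `exp (-(∑ l j / l k) * x)`. The upper bound suffices: equality is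
recovered in `measure_cand` from the total mass. -/
lemma measure_minimalAt_le (hk : 0 < l k) :
    (Measure.pi fun _ : Fin (n + 1) => expMeasure 1) (minimalAt l k) ≤
      ENNReal.ofReal (l k / ∑ j, (l j : ℝ)) := by
  have hk' : (0 : ℝ) < l k := by exact_mod_cast hk
  have hsum : 0 < ∑ j, (l j : ℝ) :=
    Finset.sum_pos' (fun _ _ => NNReal.coe_nonneg _) ⟨k, Finset.mem_univ _, hk'⟩
  calc (Measure.pi fun _ : Fin (n + 1) => expMeasure 1) (minimalAt l k)
      ≤ (Measure.pi fun _ : Fin (n + 1) => expMeasure 1)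
          {s | ∀ j, s (k.succAbove j) ∈ Set.Ici ((l (k.succAbove j) : ℝ) / l k * s k)} := by
        refine measure_mono_ae ?_
        filter_upwards [ae_pi_expMeasure_pos] with s hs hmin j
        exact ofReal_div_le_ofReal_div hk (hs _) (hmin _)
    _ = ∫⁻ x, ∏ j, expMeasure 1 (Set.Ici ((l (k.succAbove j) : ℝ) / l k * x)) ∂(expMeasure 1) :=
        pi_expMeasure_eq_lintegral k (B := fun j x => Set.Ici ((l (k.succAbove j) : ℝ) / l k * x))
          fun j => measurableSet_le (by fun_prop) measurable_snd
    _ = ∫⁻ x, ENNReal.ofReal (Real.exp (-((∑ j, (l (k.succAbove j) : ℝ) / l k) * x)))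
          ∂(expMeasure 1) := by
        refine lintegral_congr_ae ?_
        filter_upwards [ae_expMeasure_one_pos] with x hx
        exact prod_expMeasure_Ici l k hx.le _
    _ = ∫⁻ x in Set.Ici 0, ENNReal.ofReal (Real.exp (-((∑ j, (l j : ℝ)) / l k * x))) := by
        rw [lintegral_expMeasure_one (by fun_prop)]
        refine lintegral_congr fun x => ?_
        rw [← ENNReal.ofReal_mul (Real.exp_pos _).le, ← Real.exp_add, ← sum_succAbove_div l k hk,
          add_mul, one_mul, neg_add]
    _ = _ := by
        rw [lintegral_exp_neg_mul_Ici (by positivity), one_div_div]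

/-- Same computation, with the tail of `s i` replaced by an interval ending at `x`. The additional
factor `x` from `expMeasure_one_Icc_le` squares the value of the integral. -/
lemma measure_minimalAt_inter_le (hk : 0 < l k) {i : Fin (n + 1)} (hi : i ≠ k) :
    (Measure.pi fun _ : Fin (n + 1) => expMeasure 1) (minimalAt l k ∩ {s | s i ≤ s k}) ≤
      ENNReal.ofReal ((l k / ∑ j, (l j : ℝ)) ^ 2) := by
  classical
  have hk' : (0 : ℝ) < l k := by exact_mod_cast hk
  have hsum : 0 < ∑ j, (l j : ℝ) :=
    Finset.sum_pos' (fun _ _ => NNReal.coe_nonneg _) ⟨k, Finset.mem_univ _, hk'⟩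
  obtain ⟨i, rfl⟩ := Fin.exists_succAbove_eq hi
  set c : Fin n → ℝ := fun j => (l (k.succAbove j) : ℝ) / l k with hc
  have hc0 (j : Fin n) : 0 ≤ c j := by simp only [hc]; positivity
  set B : Fin n → ℝ → Set ℝ := fun j x =>
    if j = i then Set.Icc (c j * x) x else Set.Ici (c j * x) with hB
  have hBm (j : Fin n) : MeasurableSet {p : ℝ × ℝ | p.2 ∈ B j p.1} := by
    have h1 : MeasurableSet {p : ℝ × ℝ | c j * p.1 ≤ p.2} :=
      measurableSet_le (by fun_prop) measurable_snd
    simp only [hB]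
    split_ifs
    · exact h1.inter (measurableSet_le measurable_snd measurable_fst)
    · exact h1
  calc (Measure.pi fun _ : Fin (n + 1) => expMeasure 1)
        (minimalAt l k ∩ {s | s (k.succAbove i) ≤ s k})
      ≤ (Measure.pi fun _ : Fin (n + 1) => expMeasure 1)
          {s | ∀ j, s (k.succAbove j) ∈ B j (s k)} := by
        refine measure_mono_ae ?_
        filter_upwards [ae_pi_expMeasure_pos] with s hs hmin j
        have h1 := ofReal_div_le_ofReal_div hk (hs _) (hmin.1 (k.succAbove j))
        simp only [hB]
        split_ifs with hji
        · subst hji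
          exact ⟨h1, hmin.2⟩
        · exact h1
    _ = ∫⁻ x, ∏ j, expMeasure 1 (B j x) ∂(expMeasure 1) := pi_expMeasure_eq_lintegral k hBm
    _ ≤ ∫⁻ x, ENNReal.ofReal (x * Real.exp (-((∑ j, c j) * x))) ∂(expMeasure 1) := by
        refine lintegral_mono_ae ?_
        filter_upwards [ae_expMeasure_one_pos] with x hx
        have hrest : ∏ j ∈ Finset.univ.erase i, expMeasure 1 (B j x) =
            ENNReal.ofReal (Real.exp (-((∑ j ∈ Finset.univ.erase i, c j) * x))) := by
          rw [← prod_expMeasure_Ici l k hx.le]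
          refine Finset.prod_congr rfl fun j hj => ?_
          simp only [hB, if_neg (Finset.ne_of_mem_erase hj), hc]
        have hone : expMeasure 1 (B i x) ≤ ENNReal.ofReal (x * Real.exp (-(c i * x))) := by
          simp only [hB, if_true]
          exact expMeasure_one_Icc_le (mul_nonneg (hc0 i) hx.le) hx.le
        rw [← Finset.mul_prod_erase _ _ (Finset.mem_univ i), hrest]
        refine (mul_le_mul_left hone _).trans_eq ?_
        rw [← ENNReal.ofReal_mul (mul_nonneg hx.le (Real.exp_pos _).le), mul_assoc, ← Real.exp_add,
          ← Finset.add_sum_erase _ _ (Finset.mem_univ i)]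
        ring_nf
    _ = ∫⁻ x in Set.Ici 0, ENNReal.ofReal (x * Real.exp (-((∑ j, (l j : ℝ)) / l k * x))) := by
        rw [lintegral_expMeasure_one (by fun_prop)]
        refine setLIntegral_congr_fun measurableSet_Ici fun x _ => ?_
        have h2 := sum_succAbove_div l k hk
        have : Real.exp (-x) * (x * Real.exp (-((∑ j, c j) * x))) =
            x * Real.exp (-((∑ j, (l j : ℝ)) / l k * x)) := by
          rw [mul_left_comm, ← Real.exp_add, ← h2, add_mul, one_mul, neg_add]
        rw [← ENNReal.ofReal_mul (Real.exp_pos _).le, this]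
    _ = _ := by
        rw [lintegral_mul_exp_neg_mul_Ici (by positivity), one_div_div]

/-- The score of `k` is infinite almost surely, while an index of positive weight has a finite
score. -/
lemma measure_minimalAt_eq_zero (hk : l k = 0) (hsum : 0 < ∑ j, (l j : ℝ)) :
    (Measure.pi fun _ : Fin (n + 1) => expMeasure 1) (minimalAt l k) = 0 := by
  obtain ⟨j, -, hj⟩ := Finset.exists_ne_zero_of_sum_ne_zero hsum.ne'
  refine measure_eq_zero_iff_ae_notMem.2 ?_
  filter_upwards [ae_pi_expMeasure_pos] with s hs hmin
  have h := hmin j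
  rw [hk, ENNReal.coe_zero, ENNReal.div_zero (by simpa using hs k), top_le_iff] at h
  exact ENNReal.div_ne_top ENNReal.ofReal_ne_top (by simpa using hj) h

end Race

/-- `ρ` is the density of a probability measure with respect to `Q`, with the bounds
`ρ ≤ ωx ≤ ω`. -/
structure IsBoundedRatio {𝒴 : Type*} [MeasurableSpace 𝒴] (Q : Measure 𝒴) (ρ : 𝒴 → ℝ≥0)
    (ωx ω : ℝ) : Prop where
  measurable : Measurable ρ
  lintegral_eq_one : ∫⁻ y, ρ y ∂Q = 1
  le_bound : ∀ y, (ρ y : ℝ) ≤ ωx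
  bound_le : ωx ≤ ω

/-! ### Bounds on `Ẑ`, `Z̄`, `Δ` and `Δ_x` -/

section Bounds

variable {𝒴 : Type*} {N : ℕ} (ρ : 𝒴 → ℝ≥0) (y : Fin N → 𝒴) (k : Fin N)

lemma Zhat_nonneg : 0 ≤ Zhat ρ y := Finset.sum_nonneg fun _ _ => NNReal.coe_nonneg _

lemma ratio_le_Zhat : (ρ (y k) : ℝ) ≤ Zhat ρ y :=
  Finset.single_le_sum (f := fun j => (ρ (y j) : ℝ)) (fun _ _ => NNReal.coe_nonneg _)
    (Finset.mem_univ k)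

lemma ratio_eq_zero_of_Zhat_eq_zero (h : Zhat ρ y = 0) : (ρ (y k) : ℝ) = 0 :=
  le_antisymm (h ▸ ratio_le_Zhat ρ y k) (NNReal.coe_nonneg _)

lemma sum_ratio_div_Zhat_le : ∑ k, (ρ (y k) : ℝ) / Zhat ρ y ≤ 1 := by
  rw [← Finset.sum_div]
  exact div_self_le_one _

lemma bound_le_Zbar (ωx : ℝ) : ωx ≤ Zbar ρ ωx y k := by
  have := ratio_le_Zhat ρ y k
  unfold Zbar
  linarith

lemma Zbar_le_add_Zhat (ωx : ℝ) : Zbar ρ ωx y k ≤ ωx + Zhat ρ y := by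
  have := NNReal.coe_nonneg (ρ (y k))
  unfold Zbar
  linarith

end Bounds

namespace IsBoundedRatio

variable {𝒴 : Type*} [MeasurableSpace 𝒴] {N : ℕ} {Q : Measure 𝒴} [IsProbabilityMeasure Q]
  {ρ : 𝒴 → ℝ≥0} {ωx ω : ℝ} (h : IsBoundedRatio Q ρ ωx ω)
include h

lemma one_le_bound : 1 ≤ ωx := by
  have h1 : ∫⁻ y, ρ y ∂Q ≤ ∫⁻ _, ENNReal.ofReal ωx ∂Q := lintegral_mono fun y => by
    rw [← ENNReal.ofReal_coe_nnreal]
    exact ENNReal.ofReal_le_ofReal (h.le_bound y)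
  rw [h.lintegral_eq_one] at h1
  simpa using h1

lemma integrable_ratio : Integrable (fun y => (ρ y : ℝ)) Q :=
  .of_bound h.measurable.coe_nnreal_real.aestronglyMeasurable ωx
    (.of_forall fun y => by simpa using h.le_bound y)

omit [IsProbabilityMeasure Q] in
lemma integral_ratio : ∫ y, (ρ y : ℝ) ∂Q = 1 := by
  rw [integral_eq_lintegral_of_nonneg_ae (.of_forall fun y => NNReal.coe_nonneg _)
    h.measurable.coe_nnreal_real.aestronglyMeasurable]
  simp [h.lintegral_eq_one]

lemma one_le_Zbar (y : Fin N → 𝒴) (k : Fin N) : 1 ≤ Zbar ρ ωx y k :=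
  h.one_le_bound.trans (bound_le_Zbar ρ y k ωx)

lemma Zbar_pos (y : Fin N → 𝒴) (k : Fin N) : 0 < Zbar ρ ωx y k :=
  one_pos.trans_le (h.one_le_Zbar y k)

omit [IsProbabilityMeasure Q] in
lemma Zhat_le_Zbar (y : Fin N → 𝒴) (k : Fin N) : Zhat ρ y ≤ Zbar ρ ωx y k := by
  have := h.le_bound (y k)
  unfold Zbar
  linarith

omit [IsProbabilityMeasure Q] in
-- Together with `Zbar_le_add_Zhat`, this shows that the `Z̄` of two indices differ by a factor of
-- at most 2.
lemma add_Zhat_le_two_mul_Zbar (y : Fin N → 𝒴) (k : Fin N) :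
    ωx + Zhat ρ y ≤ 2 * Zbar ρ ωx y k := by
  have := h.le_bound (y k)
  have := bound_le_Zbar ρ y k ωx
  unfold Zbar at *
  linarith

variable [NeZero N]

/-- The proposal `y k` is independent of `Z̄(y, k)`, whose law does not depend on `k`. -/
lemma lintegral_mul_Zbar (k : Fin N) {f : 𝒴 → ℝ≥0∞} (hf : Measurable f) {g : ℝ → ℝ≥0∞}
    (hg : Measurable g) :
    ∫⁻ y : Fin N → 𝒴, f (y k) * g (Zbar ρ ωx y k) ∂(Measure.pi fun _ => Q) =
      (∫⁻ y, f y ∂Q) * ∫⁻ y : Fin N → 𝒴, g (Zbar ρ ωx y 0) ∂(Measure.pi fun _ => Q) := by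
  obtain ⟨n, rfl⟩ := Nat.exists_eq_succ_of_ne_zero (NeZero.ne N)
  have hρ := h.measurable
  -- In `Z̄(y, i)` the term `ρ (y i)` cancels, so only the other `n` coordinates remain, in a form
  -- free of `i`.
  have key (i : Fin (n + 1)) {f' : 𝒴 → ℝ≥0∞} (hf' : Measurable f') :
      ∫⁻ y : Fin (n + 1) → 𝒴, f' (y i) * g (Zbar ρ ωx y i) ∂(Measure.pi fun _ => Q) =
        (∫⁻ y, f' y ∂Q) *
          ∫⁻ v : Fin n → 𝒴, g (∑ j, (ρ (v j) : ℝ) + ωx) ∂(Measure.pi fun _ => Q) := by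
    have hmp := measurePreserving_piFinSuccAbove (fun _ : Fin (n + 1) => Q) i
    have hg' : Measurable fun v : Fin n → 𝒴 => g (∑ j, (ρ (v j) : ℝ) + ωx) :=
      hg.comp (by fun_prop)
    have hfg : Measurable fun p : 𝒴 × (Fin n → 𝒴) =>
        f' p.1 * g (∑ j, (ρ (p.2 j) : ℝ) + ωx) :=
      (hf'.comp measurable_fst).mul (hg'.comp measurable_snd)
    rw [← lintegral_prod_mul hf'.aemeasurable hg'.aemeasurable, ← hmp.lintegral_comp hfg]
    refine lintegral_congr fun y => ?_
    congr 2
    simp only [Zbar, Zhat, Fin.sum_univ_succAbove _ i, MeasurableEquiv.piFinSuccAbove]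
    change _ = ∑ j, (ρ (y (i.succAbove j)) : ℝ) + ωx
    ring
  -- The choice `f' = 1`, `i = 0` identifies the integral over `n` coordinates with the one over
  -- `Z̄(y, 0)`.
  have h0 := key 0 (f' := fun _ => 1) measurable_const
  simp only [one_mul, lintegral_const, measure_univ, mul_one] at h0
  rw [key k hf, ← h0]

lemma integrable_div_Zbar : Integrable (fun y : Fin N → 𝒴 => (N : ℝ) / Zbar ρ ωx y 0)
    (Measure.pi fun _ => Q) := by
  refine .of_bound (measurable_const.div
    (measurable_Zbar h.measurable ωx 0)).aestronglyMeasurable N (.of_forall fun y => ?_)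
  have := h.one_le_Zbar y 0
  rw [Real.norm_of_nonneg (by positivity)]
  exact div_le_self (by positivity) this

lemma ofReal_DeltaX : ENNReal.ofReal (DeltaX Q N ρ ωx) =
    ∫⁻ y : Fin N → 𝒴, ENNReal.ofReal (N / Zbar ρ ωx y 0) ∂(Measure.pi fun _ => Q) :=
  ofReal_integral_eq_lintegral_ofReal h.integrable_div_Zbar
    (.of_forall fun y => div_nonneg (by positivity) (h.Zbar_pos y 0).le)

lemma integral_Zbar : Integrable (fun y : Fin N → 𝒴 => Zbar ρ ωx y 0) (Measure.pi fun _ => Q) ∧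
    ∫ y : Fin N → 𝒴, Zbar ρ ωx y 0 ∂(Measure.pi fun _ => Q) = N - 1 + ωx := by
  have hmp (j : Fin N) := measurePreserving_eval (fun _ : Fin N => Q) j
  have hint (j : Fin N) : Integrable (fun y : Fin N → 𝒴 => (ρ (y j) : ℝ))
      (Measure.pi fun _ => Q) := (hmp j).integrable_comp_of_integrable h.integrable_ratio
  have hval (j : Fin N) : ∫ y : Fin N → 𝒴, (ρ (y j) : ℝ) ∂(Measure.pi fun _ => Q) = 1 := by
    have := integral_map (μ := Measure.pi fun _ : Fin N => Q) (hmp j).measurable.aemeasurable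
      (f := fun y => (ρ y : ℝ)) h.measurable.coe_nnreal_real.aestronglyMeasurable
    rw [(hmp j).map_eq, h.integral_ratio] at this
    exact this.symm
  have hsum : Integrable (fun y : Fin N → 𝒴 => ∑ j, (ρ (y j) : ℝ)) (Measure.pi fun _ => Q) :=
    integrable_finsetSum _ fun j _ => hint j
  unfold Zbar Zhat
  have hsub : Integrable (fun y : Fin N → 𝒴 => ∑ j, (ρ (y j) : ℝ) - ρ (y 0))
    (Measure.pi fun _ => Q) := hsum.sub (hint 0)
  refine ⟨hsub.add (integrable_const _), ?_⟩
  rw [integral_add hsub (integrable_const _), integral_sub hsum (hint 0),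
    integral_finsetSum _ fun j _ => hint j]
  simp [hval]

omit h [IsProbabilityMeasure Q] in
lemma _root_.ERS.natCast_one_le : (1 : ℝ) ≤ N := by
  exact_mod_cast Nat.one_le_iff_ne_zero.2 (NeZero.ne N)

/-- Jensen's inequality for `z ↦ 1 / z`. -/
lemma div_le_DeltaX : N / (N - 1 + ωx) ≤ DeltaX Q N ρ ωx := by
  have hN := natCast_one_le (N := N)
  have hω := h.one_le_bound
  set m : ℝ := N - 1 + ωx with hm
  have hm0 : 0 < m := by linarith
  obtain ⟨hint, hval⟩ := h.integral_Zbar (N := N)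
  -- The integrand is the tangent of `z ↦ 1 / z` at the mean `m` of `Z̄`; the gap is `(z - m)² / (z
  -- m²)`.
  have h1 : ∫ y : Fin N → 𝒴, (N : ℝ) * (2 / m - Zbar ρ ωx y 0 / m ^ 2) ∂(Measure.pi fun _ => Q) ≤
      DeltaX Q N ρ ωx := by
    refine integral_mono (((integrable_const _).sub (hint.div_const _)).const_mul _)
      h.integrable_div_Zbar fun y => ?_
    have hz := h.Zbar_pos y 0
    simp only
    rw [div_eq_mul_inv (N : ℝ)]
    gcongr
    rw [← sub_nonneg]
    have : (Zbar ρ ωx y 0)⁻¹ - (2 / m - Zbar ρ ωx y 0 / m ^ 2) =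
        (Zbar ρ ωx y 0 - m) ^ 2 / (Zbar ρ ωx y 0 * m ^ 2) := by
      field_simp
      ring
    rw [this]
    positivity
  rw [integral_const_mul, integral_sub (integrable_const _) (hint.div_const _),
    integral_div (m ^ 2), hval] at h1
  simp only [integral_const, probReal_univ, smul_eq_mul, one_mul] at h1
  refine le_trans (le_of_eq ?_) h1
  rw [← hm]
  field_simp
  ring

lemma Delta_pos : 0 < Delta N ω := by
  have hN := natCast_one_le (N := N)
  have := h.one_le_bound
  have := h.bound_le
  unfold Delta
  exact div_pos (by linarith) (by linarith)

lemma Delta_le_one : Delta N ω ≤ 1 := by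
  have hN := natCast_one_le (N := N)
  have := h.one_le_bound
  have := h.bound_le
  unfold Delta
  exact (div_le_one (by linarith)).2 (by linarith)

/-- This makes the factor `Δ / Δ_x` at most one, so the thresholds are genuine probabilities. -/
lemma Delta_le_DeltaX : Delta N ω ≤ DeltaX Q N ρ ωx := by
  have hN := natCast_one_le (N := N)
  have h1 := h.one_le_bound
  have h2 := h.bound_le
  refine le_trans ?_ h.div_le_DeltaX
  unfold Delta
  gcongr

lemma DeltaX_pos : 0 < DeltaX Q N ρ ωx := h.Delta_pos.trans_le h.Delta_le_DeltaX

lemma groupSize_pos : 0 < groupSize N ω :=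
  Nat.floor_pos.2 ((one_le_inv₀ h.Delta_pos).2 h.Delta_le_one)

lemma groupSize_mul_Delta_le : groupSize N ω * Delta N ω ≤ 1 := by
  have := Nat.floor_le (inv_nonneg.2 (h.Delta_pos (N := N)).le)
  calc _ ≤ (Delta N ω)⁻¹ * Delta N ω := mul_le_mul_of_nonneg_right this h.Delta_pos.le
    _ = 1 := inv_mul_cancel₀ h.Delta_pos.ne'

/-- A group contains an accepted batch with probability at least `1/2`. -/
lemma one_sub_Delta_pow_le : (1 - Delta N ω) ^ groupSize N ω ≤ 1 / 2 := by
  set D := Delta N ω with hD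
  set G := groupSize N ω with hG
  have hD0 : 0 < D := h.Delta_pos
  -- The floor gives `1 / (G + 1) < D`, hence `1 - D ≤ (1 + 1/G)⁻¹`; Bernoulli's inequality then
  -- gives `(1 + 1/G)^G ≥ 2`.
  have hlt : 1 < D * (G + 1) := by
    have := Nat.lt_floor_add_one D⁻¹
    have h2 : D * D⁻¹ < D * (G + 1) := mul_lt_mul_of_pos_left this hD0
    rwa [mul_inv_cancel₀ hD0.ne'] at h2
  have hG0 : (0 : ℝ) < G := by exact_mod_cast h.groupSize_pos
  have h1 : 1 - D ≤ (1 + 1 / (G : ℝ))⁻¹ := by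
    have h2 : (1 + 1 / (G : ℝ))⁻¹ = 1 - 1 / (G + 1) := by
      field_simp
      ring
    have h3 : 1 / ((G : ℝ) + 1) ≤ D := (div_le_iff₀ (by linarith)).2 hlt.le
    rw [h2]
    linarith
  have hb := one_add_mul_le_pow (a := 1 / (G : ℝ)) (by have := one_div_pos.2 hG0; linarith) G
  rw [mul_one_div_cancel hG0.ne'] at hb
  calc (1 - D) ^ G ≤ ((1 + 1 / (G : ℝ))⁻¹) ^ G :=
        pow_le_pow_left₀ (by linarith [h.Delta_le_one (N := N)]) h1 _
    _ = ((1 + 1 / (G : ℝ)) ^ G)⁻¹ := inv_pow _ _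
    _ ≤ (2 : ℝ)⁻¹ := by
        gcongr
        linarith
    _ = 1 / 2 := (one_div _).symm

end IsBoundedRatio

/-- The law of a batch. -/
noncomputable abbrev batchLaw {𝒴 : Type*} [MeasurableSpace 𝒴] (Q : Measure 𝒴) (N : ℕ) :
    Measure (Batch 𝒴 N) :=
  Measure.pi fun _ : Fin N => Q.prod (expMeasure 1)

/-! ### The uniform variable of a batch -/

section Uniform

lemma measurableSet_setOf_le (t : ℝ) : MeasurableSet {u : ℝ | u ≤ t} := measurableSet_Iic

lemma uniform01_Iic {t : ℝ} (h1 : t ≤ 1) :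
    uniform01 {u | u ≤ t} = ENNReal.ofReal t := by
  rw [uniform01, Measure.restrict_apply (measurableSet_setOf_le t)]
  have : {u : ℝ | u ≤ t} ∩ Set.Icc 0 1 = Set.Icc 0 t := by
    ext u
    exact ⟨fun h => ⟨h.2.1, h.1⟩, fun h => ⟨h.2, h.1, h.2.trans h1⟩⟩
  rw [this, Real.volume_Icc, sub_zero]

lemma uniform01_Iic_le (t : ℝ) : uniform01 {u | u ≤ t} ≤ ENNReal.ofReal t := by
  rw [uniform01, Measure.restrict_apply (measurableSet_setOf_le t)]
  calc volume ({u : ℝ | u ≤ t} ∩ Set.Icc 0 1) ≤ volume (Set.Icc 0 t) :=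
        measure_mono fun u h => ⟨h.2.1, h.1⟩
    _ = ENNReal.ofReal t := by rw [Real.volume_Icc, sub_zero]

/-- Conditioning a uniform variable to exceed a threshold makes small values less likely. -/
lemma uniform01_Ioc_le {t : ℝ} (h0 : 0 ≤ t) (h1 : t ≤ 1) (u : ℝ) :
    uniform01 ({v | v ≤ t}ᶜ ∩ {v | v ≤ u}) ≤ uniform01 {v | v ≤ t}ᶜ * ENNReal.ofReal u := by
  rcases le_or_gt 1 u with hu | hu
  · calc _ ≤ uniform01 {v | v ≤ t}ᶜ * 1 := by
          rw [mul_one]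
          exact measure_mono Set.inter_subset_left
      _ ≤ _ := by
          gcongr
          exact ENNReal.one_le_ofReal.2 hu
  · rw [prob_compl_eq_one_sub (measurableSet_setOf_le t), uniform01_Iic h1, ← ENNReal.ofReal_one,
      ← ENNReal.ofReal_sub _ h0, ← ENNReal.ofReal_mul (by linarith)]
    calc uniform01 ({v | v ≤ t}ᶜ ∩ {v | v ≤ u}) ≤ volume (Set.Ioc t u) := by
          refine (Measure.restrict_apply_le _ _).trans (measure_mono fun v hv => ⟨?_, hv.2⟩)
          exact not_le.1 hv.1
      _ = ENNReal.ofReal (u - t) := Real.volume_Ioc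
      _ ≤ _ := by
          -- `u - t ≤ (1 - t) * u` amounts to `t * u ≤ t`, which holds as `u < 1`.
          refine ENNReal.ofReal_le_ofReal ?_
          nlinarith

end Uniform

/-! ### Law of the candidate and of its rank within a batch -/

section Candidate

variable {𝒴 : Type*} {N : ℕ} [NeZero N] (ρ : 𝒴 → ℝ≥0) (y : Fin N → 𝒴)

/-- A candidate is in particular a minimiser, so the race bounds apply however ties are broken. -/
lemma measure_cand_le_and (hZ : 0 < Zhat ρ y) (k : Fin N) :
    (Measure.pi fun _ : Fin N => expMeasure 1) {s | cand ρ (fun j => (y j, s j)) = k} ≤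
        ENNReal.ofReal (ρ (y k) / Zhat ρ y) ∧
      ∀ i ≠ k, (Measure.pi fun _ : Fin N => expMeasure 1)
        {s | cand ρ (fun j => (y j, s j)) = k ∧ s i ≤ s k} ≤
        ENNReal.ofReal ((ρ (y k) / Zhat ρ y) ^ 2) := by
  obtain ⟨n, rfl⟩ := Nat.exists_eq_succ_of_ne_zero (NeZero.ne N)
  have hsub : {s : Fin (n + 1) → ℝ | cand ρ (fun j => (y j, s j)) = k} ⊆
      minimalAt (fun j => ρ (y j)) k := fun s hs => ((cand_eq_iff ρ _ k).1 hs).1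
  rcases eq_or_ne (ρ (y k)) 0 with hk | hk
  · have h0 := measure_mono_null hsub (measure_minimalAt_eq_zero (fun j => ρ (y j)) k hk hZ)
    refine ⟨h0.trans_le zero_le, fun i _ => ?_⟩
    exact (measure_mono_null (fun s hs => hs.1) h0).trans_le zero_le
  · have hk := pos_iff_ne_zero.2 hk
    refine ⟨(measure_mono hsub).trans (measure_minimalAt_le _ k hk), fun i hi => ?_⟩
    refine (measure_mono fun s hs => ?_).trans
      (measure_minimalAt_inter_le (fun j => ρ (y j)) k hk hi)
    exact ⟨hsub hs.1, hs.2⟩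

variable [MeasurableSpace 𝒴] {ρ} (hρ : Measurable ρ)
include hρ

lemma measurable_cand_mk :
    Measurable fun s : Fin N → ℝ => cand ρ (fun j => (y j, s j)) :=
  (measurable_cand hρ).comp (by fun_prop)

/-- The candidate of a batch with proposals `y` is `k` with probability `ρ(y_k) / Ẑ(y)`. -/
lemma measure_cand (hZ : 0 < Zhat ρ y) (k : Fin N) :
    (Measure.pi fun _ : Fin N => expMeasure 1) {s | cand ρ (fun j => (y j, s j)) = k} =
      ENNReal.ofReal (ρ (y k) / Zhat ρ y) := by
  classical
  set ν := Measure.pi fun _ : Fin N => expMeasure 1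
  set a : Fin N → ℝ≥0∞ := fun k => ν {s | cand ρ (fun j => (y j, s j)) = k} with ha
  set b : Fin N → ℝ≥0∞ := fun k => ENNReal.ofReal (ρ (y k) / Zhat ρ y) with hb
  have hle (k : Fin N) : a k ≤ b k := (measure_cand_le_and ρ y hZ k).1
  have hsa : ∑ k, a k = 1 := by
    have h := lintegral_fintype (μ := ν.map fun s : Fin N → ℝ => cand ρ (fun j => (y j, s j)))
      (fun _ => 1)
    rw [lintegral_map measurable_const (measurable_cand_mk y hρ)] at h
    simp only [lintegral_const, measure_univ, mul_one, one_mul] at h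
    rw [h]
    refine Finset.sum_congr rfl fun k _ => ?_
    rw [Measure.map_apply (measurable_cand_mk y hρ) (measurableSet_singleton k)]
    rfl
  have hsb : ∑ k, b k = 1 := by
    rw [hb, ← ENNReal.ofReal_sum_of_nonneg fun k _ =>
        div_nonneg (NNReal.coe_nonneg _) hZ.le, ← Finset.sum_div, ← ENNReal.ofReal_one]
    congr 1
    exact div_self hZ.ne'
  -- Both families sum to 1 and `a ≤ b` termwise, so no inequality can be strict.
  refine (hle k).antisymm (not_lt.1 fun hlt => ?_)
  have hfin : ∑ j ∈ Finset.univ.erase k, a j ≠ ∞ :=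
    ne_top_of_le_ne_top ENNReal.one_ne_top
      (hsa ▸ Finset.sum_le_sum_of_subset (Finset.erase_subset _ _))
  have h1 : ∑ j, a j < ∑ j, b j := by
    rw [← Finset.add_sum_erase _ a (Finset.mem_univ k),
      ← Finset.add_sum_erase _ b (Finset.mem_univ k)]
    exact ENNReal.add_lt_add_of_lt_of_le hfin hlt (Finset.sum_le_sum fun j _ => hle j)
  rw [hsa, hsb] at h1
  exact lt_irrefl _ h1

lemma lintegral_cand (g : Fin N → ℝ≥0∞) (hZ : 0 < Zhat ρ y) :
    ∫⁻ s, g (cand ρ (fun j => (y j, s j))) ∂(Measure.pi fun _ : Fin N => expMeasure 1) =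
      ∑ k, g k * ENNReal.ofReal (ρ (y k) / Zhat ρ y) := by
  have h := lintegral_fintype (μ := (Measure.pi fun _ : Fin N => expMeasure 1).map
    fun s : Fin N → ℝ => cand ρ (fun j => (y j, s j))) g
  rw [lintegral_map (measurable_of_finite g) (measurable_cand_mk y hρ)] at h
  rw [h]
  refine Finset.sum_congr rfl fun k _ => ?_
  rw [Measure.map_apply (measurable_cand_mk y hρ) (measurableSet_singleton k)]
  congr 1
  exact measure_cand y hρ hZ k

/-- With `p = ρ (y k) / Ẑ`, the winner `k` has mass `p`, and each competitor below it in raw value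
adds at most `p²`; in total `p * (1 + N p)`. -/
lemma lintegral_cand_mul_candRank_le (g : Fin N → ℝ≥0∞) (hZ : 0 < Zhat ρ y) :
    ∫⁻ s, g (cand ρ (fun j => (y j, s j))) * (candRank ρ (fun j => (y j, s j)) : ℝ≥0∞)
        ∂(Measure.pi fun _ : Fin N => expMeasure 1) ≤
      ∑ k, g k * ENNReal.ofReal (ρ (y k) / Zhat ρ y) *
        (1 + ENNReal.ofReal (N * (ρ (y k) / Zhat ρ y))) := by
  classical
  set ν := Measure.pi fun _ : Fin N => expMeasure 1
  set E : Fin N → Set (Fin N → ℝ) := fun k => {s | cand ρ (fun j => (y j, s j)) = k} with hE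
  have hEm (k : Fin N) : MeasurableSet (E k) := measurable_cand_mk y hρ (measurableSet_singleton k)
  have hE2m (k i : Fin N) : MeasurableSet (E k ∩ {s | s i ≤ s k}) :=
    (hEm k).inter (measurableSet_le (measurable_pi_apply i) (measurable_pi_apply k))
  have hp0 (k : Fin N) : 0 ≤ (ρ (y k) : ℝ) / Zhat ρ y := div_nonneg (NNReal.coe_nonneg _) hZ.le
  calc ∫⁻ s, g (cand ρ (fun j => (y j, s j))) * (candRank ρ (fun j => (y j, s j)) : ℝ≥0∞) ∂ν
      ≤ ∫⁻ s, ∑ k, g k * ((E k).indicator 1 s +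
          ∑ i ∈ Finset.univ.erase k, (E k ∩ {s | s i ≤ s k}).indicator 1 s) ∂ν := by
        refine lintegral_mono fun s => ?_
        set k := cand ρ (fun j => (y j, s j)) with hk
        have hsE : s ∈ E k := hk.symm
        refine le_trans ?_ (Finset.single_le_sum
          (f := fun k => g k * ((E k).indicator 1 s +
            ∑ i ∈ Finset.univ.erase k, (E k ∩ {s | s i ≤ s k}).indicator 1 s))
          (fun _ _ => zero_le) (Finset.mem_univ k))
        refine mul_le_mul_right ((rankIn_le_one_add_sum _ _ _).trans_eq ?_) _
        rw [Set.indicator_of_mem hsE]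
        congr 1
        refine Finset.sum_congr rfl fun i _ => ?_
        by_cases hi : s i ≤ s k
        · rw [Set.indicator_of_mem (show s ∈ E k ∩ {s | s i ≤ s k} from ⟨hsE, hi⟩)]
          exact if_pos hi
        · rw [Set.indicator_of_notMem fun h => hi h.2]
          exact if_neg hi
    _ = ∑ k, g k * (ν (E k) + ∑ i ∈ Finset.univ.erase k, ν (E k ∩ {s | s i ≤ s k})) := by
        have hm1 (k : Fin N) : Measurable ((E k).indicator (1 : (Fin N → ℝ) → ℝ≥0∞)) :=
          measurable_one.indicator (hEm k)
        have hm2 (k i : Fin N) :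
            Measurable ((E k ∩ {s | s i ≤ s k}).indicator (1 : (Fin N → ℝ) → ℝ≥0∞)) :=
          measurable_one.indicator (hE2m k i)
        have hm3 (k : Fin N) : Measurable fun s => ∑ i ∈ Finset.univ.erase k,
            (E k ∩ {s | s i ≤ s k}).indicator (1 : (Fin N → ℝ) → ℝ≥0∞) s :=
          Finset.measurable_sum _ fun i _ => hm2 k i
        have hm4 (k : Fin N) : Measurable fun s => (E k).indicator 1 s + ∑ i ∈ Finset.univ.erase k,
            (E k ∩ {s | s i ≤ s k}).indicator (1 : (Fin N → ℝ) → ℝ≥0∞) s := (hm1 k).add (hm3 k)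
        rw [lintegral_finsetSum _ fun k _ => (hm4 k).const_mul _]
        refine Finset.sum_congr rfl fun k _ => ?_
        rw [lintegral_const_mul _ (hm4 k), lintegral_add_left (hm1 k),
          lintegral_finsetSum _ fun i _ => hm2 k i, lintegral_indicator_one (hEm k)]
        congr 2
        exact Finset.sum_congr rfl fun i _ => lintegral_indicator_one (hE2m k i)
    _ ≤ _ := by
        refine Finset.sum_le_sum fun k _ => ?_
        rw [mul_assoc]
        refine mul_le_mul_right ?_ _
        obtain ⟨h1, h2⟩ := measure_cand_le_and ρ y hZ k
        rw [mul_add, mul_one]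
        refine add_le_add h1 ?_
        calc ∑ i ∈ Finset.univ.erase k, ν (E k ∩ {s | s i ≤ s k})
            ≤ ∑ i ∈ Finset.univ.erase k, ENNReal.ofReal ((ρ (y k) / Zhat ρ y) ^ 2) :=
              Finset.sum_le_sum fun i hi => h2 i (Finset.ne_of_mem_erase hi)
          _ ≤ ∑ _i : Fin N, ENNReal.ofReal ((ρ (y k) / Zhat ρ y) ^ 2) :=
              Finset.sum_le_sum_of_subset (Finset.erase_subset _ _)
          _ = _ := by
              rw [Finset.sum_const, Finset.card_univ, Fintype.card_fin, nsmul_eq_mul,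
                ← ENNReal.ofReal_natCast, ← ENNReal.ofReal_mul (by positivity),
                ← ENNReal.ofReal_mul (hp0 k)]
              ring_nf

variable (Q : Measure 𝒴) [IsProbabilityMeasure Q]

omit hρ [NeZero N] in
lemma lintegral_batchLaw {f : Batch 𝒴 N → ℝ≥0∞} (hf : Measurable f) :
    ∫⁻ b, f b ∂(batchLaw Q N) =
      ∫⁻ y, ∫⁻ s, f (fun j => (y j, s j)) ∂(Measure.pi fun _ : Fin N => expMeasure 1)
        ∂(Measure.pi fun _ : Fin N => Q) := by
  have hmp := (measurePreserving_arrowProdEquivProdArrow 𝒴 ℝ (Fin N) (fun _ => Q)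
    (fun _ => expMeasure 1)).symm
  rw [← hmp.lintegral_comp hf]
  exact lintegral_prod _ (hf.comp hmp.measurable).aemeasurable

/-- If all ratios vanish, the candidate does not have the law `ρ / Ẑ`, whose weights become `0 / 0 =
0`; `hF0` discards these proposals. -/
lemma lintegral_batchLaw_cand {F : (Fin N → 𝒴) → Fin N → ℝ≥0∞}
    (hF : ∀ k, Measurable fun y => F y k) (hF0 : ∀ y, Zhat ρ y = 0 → ∀ k, F y k = 0) :
    ∫⁻ b, F (fun j => (b j).1) (cand ρ b) ∂(batchLaw Q N) =
      ∫⁻ y, ∑ k, F y k * ENNReal.ofReal (ρ (y k) / Zhat ρ y)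
        ∂(Measure.pi fun _ : Fin N => Q) := by
  rw [lintegral_batchLaw Q (Measurable.comp_cand hρ hF)]
  refine lintegral_congr fun y => ?_
  rcases (Zhat_nonneg ρ y).eq_or_lt' with hZ | hZ
  · simp [hF0 y hZ]
  · exact lintegral_cand y hρ (F y) hZ

lemma lintegral_batchLaw_cand_mul_candRank_le {F : (Fin N → 𝒴) → Fin N → ℝ≥0∞}
    (hF : ∀ k, Measurable fun y => F y k) (hF0 : ∀ y, Zhat ρ y = 0 → ∀ k, F y k = 0) :
    ∫⁻ b, F (fun j => (b j).1) (cand ρ b) * (candRank ρ b : ℝ≥0∞) ∂(batchLaw Q N) ≤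
      ∫⁻ y, ∑ k, F y k * ENNReal.ofReal (ρ (y k) / Zhat ρ y) *
        (1 + ENNReal.ofReal (N * (ρ (y k) / Zhat ρ y))) ∂(Measure.pi fun _ : Fin N => Q) := by
  have hr : Measurable fun b : Batch 𝒴 N => (candRank ρ b : ℝ≥0∞) :=
    (measurable_of_countable fun n : ℕ => (n : ℝ≥0∞)).comp (measurable_candRank hρ)
  have hm : Measurable fun b : Batch 𝒴 N =>
    F (fun j => (b j).1) (cand ρ b) * (candRank ρ b : ℝ≥0∞) := (Measurable.comp_cand hρ hF).mul hr
  rw [lintegral_batchLaw Q hm]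
  refine lintegral_mono fun y => ?_
  rcases (Zhat_nonneg ρ y).eq_or_lt' with hZ | hZ
  · simp [hF0 y hZ]
  · exact lintegral_cand_mul_candRank_le y hρ (F y) hZ

end Candidate

/-! ### Integrals over the event that a batch is accepted -/

namespace IsBoundedRatio

variable {𝒴 : Type*} [MeasurableSpace 𝒴] {N : ℕ} [NeZero N] {Q : Measure 𝒴}
  [IsProbabilityMeasure Q] {ρ : 𝒴 → ℝ≥0} {ωx ω : ℝ} (h : IsBoundedRatio Q ρ ωx ω)
include h

lemma threshold_nonneg (y : Fin N → 𝒴) (k : Fin N) : 0 ≤ threshold Q ρ ωx ω y k :=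
  mul_nonneg (div_nonneg (Zhat_nonneg ρ y) (h.Zbar_pos y k).le)
    (div_nonneg h.Delta_pos.le h.DeltaX_pos.le)

lemma threshold_le_one (y : Fin N → 𝒴) (k : Fin N) : threshold Q ρ ωx ω y k ≤ 1 :=
  mul_le_one₀ ((div_le_one (h.Zbar_pos y k)).2 (h.Zhat_le_Zbar y k))
    (div_nonneg h.Delta_pos.le h.DeltaX_pos.le)
    ((div_le_one h.DeltaX_pos).2 h.Delta_le_DeltaX)

lemma setLIntegral_acceptSet {f : Batch 𝒴 N → ℝ≥0∞} (hf : Measurable f) :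
    ∫⁻ bu in acceptSet Q ρ ωx ω, f bu.1 ∂((batchLaw Q N).prod uniform01) =
      ∫⁻ b, f b * ENNReal.ofReal (threshold Q ρ ωx ω (fun j => (b j).1) (cand ρ b))
        ∂(batchLaw Q N) := by
  have hA := measurableSet_acceptSet (N := N) Q h.measurable ωx ω
  have hm : Measurable ((acceptSet Q ρ ωx ω).indicator fun bu : Batch 𝒴 N × ℝ => f bu.1) :=
    (hf.comp measurable_fst).indicator hA
  rw [← lintegral_indicator hA, lintegral_prod _ hm.aemeasurable]
  refine lintegral_congr fun b => ?_
  rw [← uniform01_Iic (h.threshold_le_one _ _),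
    ← lintegral_indicator_one (measurableSet_setOf_le _),
    ← lintegral_const_mul _ (measurable_one.indicator (measurableSet_setOf_le _))]
  refine lintegral_congr fun u => ?_
  by_cases hu : u ≤ threshold Q ρ ωx ω (fun j => (b j).1) (cand ρ b)
  · rw [Set.indicator_of_mem (show (b, u) ∈ acceptSet Q ρ ωx ω from hu),
      Set.indicator_of_mem (show u ∈ {u | u ≤ _} from hu)]
    simp
  · rw [Set.indicator_of_notMem (show (b, u) ∉ acceptSet Q ρ ωx ω from hu),
      Set.indicator_of_notMem (show u ∉ {u | u ≤ _} from hu), mul_zero]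

/-- Given the other proposals, the candidate `k` is accepted with probability
`ρ(y_k) / Z̄(y, k) * (Δ / Δ_x)`. -/
lemma ofReal_threshold_mul (y : Fin N → 𝒴) (k : Fin N) :
    ENNReal.ofReal (threshold Q ρ ωx ω y k) * ENNReal.ofReal (ρ (y k) / Zhat ρ y) =
      ENNReal.ofReal (ρ (y k) / Zbar ρ ωx y k * (Delta N ω / DeltaX Q N ρ ωx)) := by
  rw [← ENNReal.ofReal_mul (h.threshold_nonneg y k)]
  congr 1
  rcases eq_or_ne (Zhat ρ y) 0 with hZ | hZ
  · simp [hZ, ratio_eq_zero_of_Zhat_eq_zero ρ y k hZ]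
  · unfold threshold
    field_simp

/-- The cancellation of `Ẑ` between the candidate's law and the threshold leaves a weight whose
denominator `Z̄(y, k)` is independent of `y k`. -/
lemma setLIntegral_acceptSet_cand {g : (Fin N → 𝒴) → Fin N → ℝ≥0∞}
    (hg : ∀ k, Measurable fun y => g y k) :
    ∫⁻ bu in acceptSet Q ρ ωx ω, g (fun j => (bu.1 j).1) (cand ρ bu.1)
        ∂((batchLaw Q N).prod uniform01) =
      ∫⁻ y, ∑ k, g y k *
        ENNReal.ofReal (ρ (y k) / Zbar ρ ωx y k * (Delta N ω / DeltaX Q N ρ ωx))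
        ∂(Measure.pi fun _ : Fin N => Q) := by
  rw [h.setLIntegral_acceptSet (Measurable.comp_cand h.measurable hg),
    lintegral_batchLaw_cand (F := fun y k => g y k * ENNReal.ofReal (threshold Q ρ ωx ω y k))
      h.measurable Q
      (fun k => (hg k).mul (measurable_threshold Q h.measurable ωx ω k).ennreal_ofReal)
      fun y hy k => by simp [threshold, hy]]
  simp_rw [mul_assoc, h.ofReal_threshold_mul]

lemma setLIntegral_acceptSet_cand_mul_candRank_le {g : (Fin N → 𝒴) → Fin N → ℝ≥0∞}
    (hg : ∀ k, Measurable fun y => g y k) :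
    ∫⁻ bu in acceptSet Q ρ ωx ω, g (fun j => (bu.1 j).1) (cand ρ bu.1) * (candRank ρ bu.1 : ℝ≥0∞)
        ∂((batchLaw Q N).prod uniform01) ≤
      ∫⁻ y, ∑ k, g y k *
        ENNReal.ofReal (ρ (y k) / Zbar ρ ωx y k * (Delta N ω / DeltaX Q N ρ ωx)) *
        (1 + ENNReal.ofReal (N * (ρ (y k) / Zhat ρ y))) ∂(Measure.pi fun _ : Fin N => Q) := by
  have hr : Measurable fun b : Batch 𝒴 N => (candRank ρ b : ℝ≥0∞) :=
    (measurable_of_countable fun n : ℕ => (n : ℝ≥0∞)).comp (measurable_candRank h.measurable)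
  have h1 := lintegral_batchLaw_cand_mul_candRank_le
    (F := fun y k => g y k * ENNReal.ofReal (threshold Q ρ ωx ω y k)) h.measurable Q
      (fun k => (hg k).mul (measurable_threshold Q h.measurable ωx ω k).ennreal_ofReal)
      fun y hy k => by simp [threshold, hy]
  rw [h.setLIntegral_acceptSet
    (f := fun b => g (fun j => (b j).1) (cand ρ b) * (candRank ρ b : ℝ≥0∞))
    ((Measurable.comp_cand h.measurable hg).mul hr)]
  simp_rw [mul_assoc (g _ _) (ENNReal.ofReal (threshold Q ρ ωx ω _ _)) (ENNReal.ofReal _),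
    h.ofReal_threshold_mul] at h1
  simp_rw [mul_right_comm (g _ _) _ (ENNReal.ofReal (threshold Q ρ ωx ω _ _))]
  exact h1

lemma lintegral_ofReal_inv_Zbar (c : ℝ) :
    ∫⁻ y : Fin N → 𝒴, ENNReal.ofReal (1 / Zbar ρ ωx y 0 * c) ∂(Measure.pi fun _ => Q) =
      ENNReal.ofReal (DeltaX Q N ρ ωx / N * c) := by
  have hN := natCast_one_le (N := N)
  have hm : Measurable fun y : Fin N → 𝒴 => ENNReal.ofReal (N / Zbar ρ ωx y 0) :=
    (measurable_const.div (measurable_Zbar h.measurable ωx 0)).ennreal_ofReal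
  have hsplit (y : Fin N → 𝒴) : ENNReal.ofReal (1 / Zbar ρ ωx y 0 * c) =
      ENNReal.ofReal (N / Zbar ρ ωx y 0) * ENNReal.ofReal (c / N) := by
    rw [← ENNReal.ofReal_mul (div_nonneg (by linarith) (h.Zbar_pos y 0).le)]
    congr 1
    field_simp
  simp_rw [hsplit]
  rw [lintegral_mul_const _ hm, ← h.ofReal_DeltaX, ← ENNReal.ofReal_mul h.DeltaX_pos.le]
  congr 1
  ring

/-- The joint law of acceptance and of the selected proposal. -/
lemma setLIntegral_acceptSet_proposal {f : 𝒴 → ℝ≥0∞} (hf : Measurable f) :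
    ∫⁻ bu in acceptSet Q ρ ωx ω, f (bu.1 (cand ρ bu.1)).1
        ∂((batchLaw Q N).prod uniform01) =
      ENNReal.ofReal (Delta N ω) * ∫⁻ y, f y * ρ y ∂Q := by
  have hN := natCast_one_le (N := N)
  have hρ := h.measurable
  have hm (k : Fin N) : Measurable fun y : Fin N → 𝒴 => f (y k) *
      ENNReal.ofReal (ρ (y k) / Zbar ρ ωx y k * (Delta N ω / DeltaX Q N ρ ωx)) := by
    have := measurable_Zbar (N := N) hρ ωx k
    fun_prop
  rw [h.setLIntegral_acceptSet_cand (g := fun y k => f (y k))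
    fun k => hf.comp (measurable_pi_apply k), lintegral_finsetSum _ fun k _ => hm k]
  -- By independence `ρ (y k)` integrates against `f` alone, and the remaining mean of `1 / Z̄` is
  -- `Δ_x / N`, which cancels the `Δ_x` of the threshold.
  have hterm (k : Fin N) : ∫⁻ y : Fin N → 𝒴, f (y k) *
      ENNReal.ofReal (ρ (y k) / Zbar ρ ωx y k * (Delta N ω / DeltaX Q N ρ ωx))
        ∂(Measure.pi fun _ => Q) =
      (∫⁻ y, f y * ρ y ∂Q) * ENNReal.ofReal (Delta N ω / N) := by
    have hsplit (y : Fin N → 𝒴) : f (y k) *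
        ENNReal.ofReal (ρ (y k) / Zbar ρ ωx y k * (Delta N ω / DeltaX Q N ρ ωx)) =
        (f (y k) * ρ (y k)) *
          ENNReal.ofReal (1 / Zbar ρ ωx y k * (Delta N ω / DeltaX Q N ρ ωx)) := by
      rw [mul_assoc, ← ENNReal.ofReal_coe_nnreal (p := ρ (y k)),
        ← ENNReal.ofReal_mul (NNReal.coe_nonneg _)]
      congr 2
      ring
    simp_rw [hsplit]
    rw [h.lintegral_mul_Zbar k (f := fun y => f y * ρ y)
      (g := fun z => ENNReal.ofReal (1 / z * (Delta N ω / DeltaX Q N ρ ωx)))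
      (hf.mul hρ.coe_nnreal_ennreal) (by fun_prop), h.lintegral_ofReal_inv_Zbar]
    congr 2
    have := h.DeltaX_pos (N := N)
    field_simp
  simp_rw [hterm]
  rw [Finset.sum_const, Finset.card_univ, Fintype.card_fin, nsmul_eq_mul,
    mul_comm (∫⁻ y, f y * ρ y ∂Q), ← mul_assoc, ← ENNReal.ofReal_natCast,
    ← ENNReal.ofReal_mul (by positivity)]
  congr 2
  field_simp

lemma measure_acceptSet :
    ((batchLaw Q N).prod uniform01) (acceptSet Q ρ ωx ω) = ENNReal.ofReal (Delta N ω) := by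
  have := h.setLIntegral_acceptSet_proposal (N := N) (f := fun _ => 1) measurable_const
  simpa [h.lintegral_eq_one] using this

lemma measure_acceptSet_ne_zero :
    ((batchLaw Q N).prod uniform01) (acceptSet Q ρ ωx ω) ≠ 0 := by
  rw [h.measure_acceptSet]
  simpa using h.Delta_pos

/-- The reciprocal of the bound `1 / Δ` times the acceptance threshold. -/
lemma setLIntegral_acceptSet_inv_threshold_le :
    ∫⁻ bu in acceptSet Q ρ ωx ω, ENNReal.ofReal (Zbar ρ ωx (fun j => (bu.1 j).1) (cand ρ bu.1) *
        DeltaX Q N ρ ωx / Zhat ρ fun j => (bu.1 j).1) ∂((batchLaw Q N).prod uniform01) ≤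
      ENNReal.ofReal (Delta N ω) := by
  have hρ := h.measurable
  have hZ := measurable_Zhat (N := N) hρ
  have hZb := measurable_Zbar (N := N) hρ ωx
  rw [h.setLIntegral_acceptSet_cand
    (g := fun y k => ENNReal.ofReal (Zbar ρ ωx y k * DeltaX Q N ρ ωx / Zhat ρ y))
    fun k => by have := hZb k; fun_prop]
  calc _ ≤ ∫⁻ _, ENNReal.ofReal (Delta N ω) ∂(Measure.pi fun _ : Fin N => Q) := by
        refine lintegral_mono fun y => ?_
        -- The integrand is the reciprocal of `Ẑ / (Z̄ Δ_x)`, so only the candidate's law times `Δ`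
        -- survives.
        calc _ ≤ ∑ k, ENNReal.ofReal (Delta N ω * (ρ (y k) / Zhat ρ y)) := by
              refine Finset.sum_le_sum fun k _ => ?_
              have h1 := h.Zbar_pos y k
              have h2 := h.DeltaX_pos (N := N)
              have h3 := Zhat_nonneg ρ y
              rw [← ENNReal.ofReal_mul (by positivity)]
              refine ENNReal.ofReal_le_ofReal (le_of_eq ?_)
              field_simp
          _ = ENNReal.ofReal (Delta N ω * ∑ k, ρ (y k) / Zhat ρ y) := by
              rw [Finset.mul_sum, ENNReal.ofReal_sum_of_nonneg]
              have := h.Delta_pos (N := N)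
              have := Zhat_nonneg ρ y
              intro k _
              positivity
          _ ≤ ENNReal.ofReal (Delta N ω) := by
              refine ENNReal.ofReal_le_ofReal ?_
              exact mul_le_of_le_one_right h.Delta_pos.le (sum_ratio_div_Zhat_le ρ y)
    _ = _ := by simp

/-- Writing `Ẑ = Z̄ + ρ (y k) - ωx` and using independence and `E[ρ] = 1`, the integral equals `1 -
(ωx - 1) Δ_x / N`. That this is at most `Δ_x` is exactly Jensen's bound `Δ_x (N - 1 + ωx) ≥ N`. -/
lemma lintegral_Zhat_div_Zbar_le (k : Fin N) :
    ∫⁻ y : Fin N → 𝒴, ENNReal.ofReal (Zhat ρ y / Zbar ρ ωx y k) ∂(Measure.pi fun _ => Q) ≤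
      ENNReal.ofReal (DeltaX Q N ρ ωx) := by
  have hN := natCast_one_le (N := N)
  have hω := h.one_le_bound
  have hρ := h.measurable
  have hZb := measurable_Zbar (N := N) hρ ωx k
  have hsplit (y : Fin N → 𝒴) : ENNReal.ofReal (Zhat ρ y / Zbar ρ ωx y k) =
      ρ (y k) * ENNReal.ofReal (1 / Zbar ρ ωx y k * 1) +
        1 * ENNReal.ofReal (1 - ωx / Zbar ρ ωx y k) := by
    have h1 := h.Zbar_pos y k
    have h2 : ωx / Zbar ρ ωx y k ≤ 1 := (div_le_one h1).2 (bound_le_Zbar ρ y k ωx)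
    rw [one_mul, ← ENNReal.ofReal_coe_nnreal (p := ρ (y k)),
      ← ENNReal.ofReal_mul (NNReal.coe_nonneg _), ← ENNReal.ofReal_add (by positivity)
      (by linarith)]
    congr 1
    field_simp
    unfold Zbar
    ring
  have hm : Measurable fun y : Fin N → 𝒴 => ρ (y k) * ENNReal.ofReal (1 / Zbar ρ ωx y k * 1) := by
    fun_prop
  have hint := h.integrable_div_Zbar (N := N)
  have hint' : Integrable (fun y : Fin N → 𝒴 => 1 - ωx / Zbar ρ ωx y 0)
      (Measure.pi fun _ => Q) := by
    refine (integrable_const _).sub ((hint.const_mul (ωx / N)).congr (.of_forall fun y => ?_))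
    have := h.Zbar_pos y 0
    simp only
    field_simp
  have hval : ∫ y : Fin N → 𝒴, (1 - ωx / Zbar ρ ωx y 0) ∂(Measure.pi fun _ => Q) =
      1 - ωx / N * DeltaX Q N ρ ωx := by
    have heq (y : Fin N → 𝒴) : 1 - ωx / Zbar ρ ωx y 0 = 1 - ωx / N * (N / Zbar ρ ωx y 0) := by
      have := h.Zbar_pos y 0
      field_simp
    simp_rw [heq]
    rw [integral_sub (integrable_const _) (hint.const_mul _), integral_const_mul]
    simp [DeltaX]
  have hnn : 0 ≤ 1 - ωx / N * DeltaX Q N ρ ωx := by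
    rw [← hval]
    refine integral_nonneg fun y => ?_
    have := (div_le_one (h.Zbar_pos y 0)).2 (bound_le_Zbar ρ y 0 ωx)
    simp only [Pi.zero_apply]
    linarith
  have hval' : ∫⁻ y : Fin N → 𝒴, ENNReal.ofReal (1 - ωx / Zbar ρ ωx y 0)
      ∂(Measure.pi fun _ => Q) = ENNReal.ofReal (1 - ωx / N * DeltaX Q N ρ ωx) := by
    rw [← hval, ofReal_integral_eq_lintegral_ofReal hint' (.of_forall fun y => ?_)]
    have := (div_le_one (h.Zbar_pos y 0)).2 (bound_le_Zbar ρ y 0 ωx)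
    simp only [Pi.zero_apply]
    linarith
  simp_rw [hsplit]
  rw [lintegral_add_left hm,
    h.lintegral_mul_Zbar k (f := fun y => ρ y) (g := fun z => ENNReal.ofReal (1 / z * 1))
      hρ.coe_nnreal_ennreal (by fun_prop),
    h.lintegral_mul_Zbar k (f := fun _ => 1) (g := fun z => ENNReal.ofReal (1 - ωx / z))
      measurable_const (by fun_prop), h.lintegral_eq_one, h.lintegral_ofReal_inv_Zbar,
    hval', lintegral_const, measure_univ, one_mul, one_mul, one_mul,
    ← ENNReal.ofReal_add (by have := h.DeltaX_pos (N := N); positivity) hnn]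
  refine ENNReal.ofReal_le_ofReal ?_
  have hJ := h.div_le_DeltaX (N := N)
  rw [div_le_iff₀ (by linarith)] at hJ
  have : DeltaX Q N ρ ωx / N * 1 + (1 - ωx / N * DeltaX Q N ρ ωx) - DeltaX Q N ρ ωx =
      (N - DeltaX Q N ρ ωx * (N - 1 + ωx)) / N := by
    field_simp
    ring
  have h2 : (N - DeltaX Q N ρ ωx * (N - 1 + ωx)) / N ≤ 0 :=
    div_nonpos_of_nonpos_of_nonneg (by linarith) (by linarith)
  linarith

/-- This is the bound `E[β] ≤ 1`, before division by the acceptance probability `Δ`. -/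
lemma lintegral_sum_Zhat_div_le :
    ∫⁻ y, ∑ k, ENNReal.ofReal (Zhat ρ y / (N * ρ (y k))) *
        ENNReal.ofReal (ρ (y k) / Zbar ρ ωx y k * (Delta N ω / DeltaX Q N ρ ωx))
        ∂(Measure.pi fun _ : Fin N => Q) ≤ ENNReal.ofReal (Delta N ω) := by
  have hN := natCast_one_le (N := N)
  have hρ := h.measurable
  have hZ := measurable_Zhat (N := N) hρ
  have hX := h.DeltaX_pos (N := N)
  have hD := h.Delta_pos (N := N)
  set c := Delta N ω / DeltaX Q N ρ ωx with hc
  calc _ ≤ ∫⁻ y, ∑ k, ENNReal.ofReal (c / N) * ENNReal.ofReal (Zhat ρ y / Zbar ρ ωx y k)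
        ∂(Measure.pi fun _ : Fin N => Q) := by
        refine lintegral_mono fun y => Finset.sum_le_sum fun k _ => ?_
        have h1 := h.Zbar_pos y k
        have h3 := Zhat_nonneg ρ y
        rw [← ENNReal.ofReal_mul (by positivity), ← ENNReal.ofReal_mul (by positivity)]
        refine ENNReal.ofReal_le_ofReal ?_
        -- For `ρ (y k) = 0` the left side is 0 by division by zero, which is why only an inequality
        -- holds.
        rcases eq_or_ne (ρ (y k) : ℝ) 0 with h0 | h0
        · rw [h0]
          simp only [mul_zero, div_zero, zero_mul]
          positivity
        · refine le_of_eq ?_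
          field_simp
    _ = ∑ k, ENNReal.ofReal (c / N) * ∫⁻ y, ENNReal.ofReal (Zhat ρ y / Zbar ρ ωx y k)
        ∂(Measure.pi fun _ : Fin N => Q) := by
        have hm (k : Fin N) : Measurable fun y : Fin N → 𝒴 =>
            ENNReal.ofReal (Zhat ρ y / Zbar ρ ωx y k) := by
          have := measurable_Zbar (N := N) hρ ωx k
          fun_prop
        rw [lintegral_finsetSum _ fun k _ => (hm k).const_mul _]
        exact Finset.sum_congr rfl fun k _ => lintegral_const_mul _ (hm k)
    _ ≤ ∑ _k : Fin N, ENNReal.ofReal (c / N) * ENNReal.ofReal (DeltaX Q N ρ ωx) :=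
        Finset.sum_le_sum fun k _ => mul_le_mul_right (h.lintegral_Zhat_div_Zbar_le k) _
    _ = _ := by
        rw [Finset.sum_const, Finset.card_univ, Fintype.card_fin, nsmul_eq_mul,
          ← ENNReal.ofReal_natCast, ← ENNReal.ofReal_mul (by positivity),
          ← ENNReal.ofReal_mul (by positivity)]
        congr 1
        rw [hc]
        field_simp

/-- The weight is the reciprocal of the `N p` in the rank bound `1 + N p`. The 1 contributes
`lintegral_sum_Zhat_div_le` and the `N p` at most the acceptance probability, so each is at most
`Δ`. -/
lemma setLIntegral_acceptSet_mul_candRank_le :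
    ∫⁻ bu in acceptSet Q ρ ωx ω, ENNReal.ofReal (Zhat ρ (fun j => (bu.1 j).1) /
        (N * ρ (bu.1 (cand ρ bu.1)).1)) * (candRank ρ bu.1 : ℝ≥0∞)
        ∂((batchLaw Q N).prod uniform01) ≤
      2 * ENNReal.ofReal (Delta N ω) := by
  have hρ := h.measurable
  have hZ := measurable_Zhat (N := N) hρ
  refine (h.setLIntegral_acceptSet_cand_mul_candRank_le
    (g := fun y k => ENNReal.ofReal (Zhat ρ y / (N * ρ (y k)))) fun k => by fun_prop).trans ?_
  have hmass := h.setLIntegral_acceptSet_cand (N := N) (g := fun _ _ => 1)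
    fun _ => measurable_const
  simp only [lintegral_const, one_mul, Measure.restrict_apply MeasurableSet.univ, Set.univ_inter,
    h.measure_acceptSet] at hmass
  have hm : Measurable fun y : Fin N → 𝒴 => ∑ k,
      ENNReal.ofReal (ρ (y k) / Zbar ρ ωx y k * (Delta N ω / DeltaX Q N ρ ωx)) :=
    Finset.measurable_sum _ fun k _ => by
      have := measurable_Zbar (N := N) hρ ωx k
      fun_prop
  calc _ ≤ ∫⁻ y, (∑ k, ENNReal.ofReal (Zhat ρ y / (N * ρ (y k))) *
          ENNReal.ofReal (ρ (y k) / Zbar ρ ωx y k * (Delta N ω / DeltaX Q N ρ ωx)) +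
          ∑ k, ENNReal.ofReal (ρ (y k) / Zbar ρ ωx y k * (Delta N ω / DeltaX Q N ρ ωx)))
          ∂(Measure.pi fun _ : Fin N => Q) := by
        refine lintegral_mono fun y => ?_
        rw [← Finset.sum_add_distrib]
        refine Finset.sum_le_sum fun k _ => ?_
        rw [mul_add, mul_one]
        refine add_le_add_right ?_ _
        rw [mul_right_comm]
        refine mul_le_of_le_one_left zero_le ?_
        have h3 := Zhat_nonneg ρ y
        rw [← ENNReal.ofReal_mul (by positivity), ← ENNReal.ofReal_one]
        refine ENNReal.ofReal_le_ofReal ?_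
        rw [← mul_div_assoc, div_mul_div_comm, mul_comm]
        exact div_self_le_one _
    _ = _ := lintegral_add_right _ hm
    _ ≤ ENNReal.ofReal (Delta N ω) + ENNReal.ofReal (Delta N ω) :=
        add_le_add h.lintegral_sum_Zhat_div_le hmass.ge
    _ = _ := (two_mul _).symm

/-- The density of the unselected proposals of the selected batch has expectation at most `3`. -/
lemma setLIntegral_acceptSet_density_le :
    ∫⁻ bu in acceptSet Q ρ ωx ω, ENNReal.ofReal (N /
        (Zbar ρ ωx (fun j => (bu.1 j).1) (cand ρ bu.1) * DeltaX Q N ρ ωx))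
        ∂((batchLaw Q N).prod uniform01) ≤
      3 * ENNReal.ofReal (Delta N ω) := by
  have hN := natCast_one_le (N := N)
  have hω := h.one_le_bound
  have hρ := h.measurable
  have hX := h.DeltaX_pos (N := N)
  have hD := h.Delta_pos (N := N)
  have hJ := h.div_le_DeltaX (N := N)
  rw [div_le_iff₀ (by linarith)] at hJ
  have hm (k : Fin N) : Measurable fun y : Fin N → 𝒴 => ENNReal.ofReal (N / Zbar ρ ωx y k) :=
    (measurable_const.div (measurable_Zbar hρ ωx k)).ennreal_ofReal
  -- Jensen gives `N / Δ_x ≤ N - 1 + ωx`, and `ωx / Z̄ ≤ 1` absorbs the second part.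
  calc _ ≤ ∫⁻ bu in acceptSet Q ρ ωx ω,
          (ENNReal.ofReal (N / Zbar ρ ωx (fun j => (bu.1 j).1) (cand ρ bu.1)) + 1)
          ∂((batchLaw Q N).prod uniform01) := by
        refine lintegral_mono fun bu => ?_
        have h1 := h.Zbar_pos (fun j => (bu.1 j).1) (cand ρ bu.1)
        have h2 := bound_le_Zbar ρ (fun j => (bu.1 j).1) (cand ρ bu.1) ωx
        simp only
        rw [← ENNReal.ofReal_one, ← ENNReal.ofReal_add (by positivity) zero_le_one]
        refine ENNReal.ofReal_le_ofReal ?_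
        rw [div_add_one h1.ne', div_le_div_iff₀ (by positivity) h1]
        nlinarith [mul_le_mul_of_nonneg_left hJ h1.le, mul_pos h1 hX]
    _ = ∫⁻ bu in acceptSet Q ρ ωx ω,
          ENNReal.ofReal (N / Zbar ρ ωx (fun j => (bu.1 j).1) (cand ρ bu.1))
          ∂((batchLaw Q N).prod uniform01) + ENNReal.ofReal (Delta N ω) := by
        rw [lintegral_add_right _ measurable_const, lintegral_const, one_mul,
          Measure.restrict_apply MeasurableSet.univ, Set.univ_inter, h.measure_acceptSet]
    _ ≤ ENNReal.ofReal (2 * Delta N ω) + ENNReal.ofReal (Delta N ω) := by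
        refine add_le_add_left ?_ _
        rw [h.setLIntegral_acceptSet_cand
          (g := fun y k => ENNReal.ofReal (N / Zbar ρ ωx y k)) hm]
        set c := Delta N ω / DeltaX Q N ρ ωx with hc
        have hc0 : 0 < c := div_pos hD hX
        calc _ ≤ ∫⁻ y : Fin N → 𝒴, ENNReal.ofReal (1 / Zbar ρ ωx y 0 * (2 * c * N))
              ∂(Measure.pi fun _ => Q) := by
              refine lintegral_mono fun y => ?_
              have h0 := h.Zbar_pos y 0
              have hZ := Zhat_nonneg ρ y
              calc _ ≤ ∑ k, ENNReal.ofReal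
                      (1 / Zbar ρ ωx y 0 * (2 * c * N) * (ρ (y k) / Zhat ρ y)) := by
                    refine Finset.sum_le_sum fun k _ => ?_
                    have h1 := h.Zbar_pos y k
                    rw [← ENNReal.ofReal_mul (by positivity)]
                    refine ENNReal.ofReal_le_ofReal ?_
                    rcases hZ.eq_or_lt' with hZ0 | hZ0
                    · simp [ratio_eq_zero_of_Zhat_eq_zero ρ y k hZ0]
                    -- Trades the square of `Z̄(y, k)` for `Ẑ * Z̄(y, 0)` at the cost of a factor 2:
                    -- the sum over `k` of `ρ / Ẑ` is then at most 1, and the mean of `1 / Z̄(y, 0)`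
                    -- is known.
                    have hkey : Zhat ρ y * Zbar ρ ωx y 0 ≤ 2 * Zbar ρ ωx y k ^ 2 := by
                      calc _ ≤ Zbar ρ ωx y k * (2 * Zbar ρ ωx y k) := by
                            gcongr
                            · exact h.Zhat_le_Zbar y k
                            · exact (Zbar_le_add_Zhat ρ y 0 ωx).trans
                                (h.add_Zhat_le_two_mul_Zbar y k)
                        _ = _ := by ring
                    have e1 : N / Zbar ρ ωx y k * (ρ (y k) / Zbar ρ ωx y k * c) =
                        (N * ρ (y k) * c) / Zbar ρ ωx y k ^ 2 := by
                      field_simp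
                    have e2 : 1 / Zbar ρ ωx y 0 * (2 * c * N) * (ρ (y k) / Zhat ρ y) =
                        (N * ρ (y k) * c) * 2 / (Zhat ρ y * Zbar ρ ωx y 0) := by
                      field_simp
                    rw [e1, e2, div_le_div_iff₀ (by positivity) (by positivity), mul_assoc _ 2]
                    gcongr
                _ = ENNReal.ofReal (1 / Zbar ρ ωx y 0 * (2 * c * N) *
                      ∑ k, ρ (y k) / Zhat ρ y) := by
                    rw [Finset.mul_sum, ENNReal.ofReal_sum_of_nonneg]
                    intro k _
                    positivity
                _ ≤ _ := by
                    refine ENNReal.ofReal_le_ofReal ?_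
                    exact mul_le_of_le_one_right (by positivity) (sum_ratio_div_Zhat_le ρ y)
          _ = ENNReal.ofReal (DeltaX Q N ρ ωx / N * (2 * c * N)) :=
              h.lintegral_ofReal_inv_Zbar _
          _ = ENNReal.ofReal (2 * Delta N ω) := by
              congr 1
              rw [hc]
              field_simp
          _ ≤ _ := le_rfl
    _ = 3 * ENNReal.ofReal (Delta N ω) := by
        rw [ENNReal.ofReal_mul two_pos.le, ENNReal.ofReal_ofNat]
        ring

end IsBoundedRatio

/-- A nonnegative function whose lower integral is bounded is integrable. -/
lemma integrable_and_integral_le {α : Type*} [MeasurableSpace α] {μ : Measure α} {f : α → ℝ}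
    (hf : Measurable f) (hf0 : ∀ a, 0 ≤ f a) {c : ℝ} (hc : 0 ≤ c)
    (h : ∫⁻ a, ENNReal.ofReal (f a) ∂μ ≤ ENNReal.ofReal c) :
    Integrable f μ ∧ ∫ a, f a ∂μ ≤ c := by
  have hne : ∫⁻ a, ENNReal.ofReal (f a) ∂μ ≠ ∞ := ne_top_of_le_ne_top ENNReal.ofReal_ne_top h
  refine ⟨(lintegral_ofReal_ne_top_iff_integrable hf.aestronglyMeasurable
    (.of_forall hf0)).1 hne, ?_⟩
  rw [integral_eq_lintegral_of_nonneg_ae (.of_forall hf0) hf.aestronglyMeasurable]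
  exact ENNReal.toReal_le_of_le_ofReal hc h

lemma _root_.ENNReal.inv_mul_le_of_le_mul {a b c : ℝ≥0∞} (h : a ≤ c * b) : b⁻¹ * a ≤ c := by
  rw [mul_comm]
  exact ENNReal.mul_le_of_le_div (by rwa [div_eq_mul_inv, inv_inv])

namespace IsBoundedRatio

variable {𝒴 : Type*} [MeasurableSpace 𝒴] {Q : Measure 𝒴} [IsProbabilityMeasure Q] {ρ : 𝒴 → ℝ≥0}
  {ωx ω : ℝ} (h : IsBoundedRatio Q ρ ωx ω)
include h

/-! ### The divergence as an expectation of `log ρ` -/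

section Divergence

omit [IsProbabilityMeasure Q] in
lemma isProbabilityMeasure_withDensity :
    IsProbabilityMeasure (Q.withDensity fun y => (ρ y : ℝ≥0∞)) :=
  ⟨by rw [withDensity_apply _ MeasurableSet.univ, setLIntegral_univ, h.lintegral_eq_one]⟩

omit [IsProbabilityMeasure Q] in
lemma rnDeriv_ae_eq [SigmaFinite Q] :
    (Q.withDensity fun y => (ρ y : ℝ≥0∞)).rnDeriv Q =ᵐ[Q] fun y => (ρ y : ℝ≥0∞) :=
  Measure.rnDeriv_withDensity Q h.measurable.coe_nnreal_ennreal

lemma llr_ae_eq :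
    llr (Q.withDensity fun y => (ρ y : ℝ≥0∞)) Q =ᵐ[Q.withDensity fun y => (ρ y : ℝ≥0∞)]
      fun y => Real.log (ρ y) := by
  refine (withDensity_absolutelyContinuous Q _).ae_eq ?_
  filter_upwards [h.rnDeriv_ae_eq] with y hy
  simp [llr, hy]

/-- Against `Q` the integrand is `ρ log ρ`, bounded because `t log t` is continuous on the compact
`[0, ωx]`. -/
lemma integrable_log_ratio :
    Integrable (fun y => Real.log (ρ y)) (Q.withDensity fun y => (ρ y : ℝ≥0∞)) := by
  rw [integrable_withDensity_iff_integrable_smul h.measurable]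
  obtain ⟨C, hC⟩ := (isCompact_Icc (a := (0 : ℝ)) (b := ωx)).exists_bound_of_continuousOn
    Real.continuous_mul_log.continuousOn
  refine .of_bound (C := C) ?_ (.of_forall fun y => ?_)
  · have := h.measurable
    exact Measurable.aestronglyMeasurable (by simp only [NNReal.smul_def]; fun_prop)
  · exact hC _ ⟨NNReal.coe_nonneg _, h.le_bound y⟩

lemma klDiv_ne_top : InformationTheory.klDiv (Q.withDensity fun y => (ρ y : ℝ≥0∞)) Q ≠ ∞ :=
  InformationTheory.klDiv_ne_top (withDensity_absolutelyContinuous Q _)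
    ((integrable_congr h.llr_ae_eq).2 h.integrable_log_ratio)

lemma integral_log_ratio :
    ∫ y, Real.log (ρ y) ∂(Q.withDensity fun y => (ρ y : ℝ≥0∞)) =
      (InformationTheory.klDiv (Q.withDensity fun y => (ρ y : ℝ≥0∞)) Q).toReal := by
  have := h.isProbabilityMeasure_withDensity
  rw [InformationTheory.toReal_klDiv_of_measure_eq (withDensity_absolutelyContinuous Q _)
    (by simp), integral_congr_ae h.llr_ae_eq]

lemma klDiv_eq_lintegral :
    InformationTheory.klDiv (Q.withDensity fun y => (ρ y : ℝ≥0∞)) Q =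
      ∫⁻ y, ENNReal.ofReal (InformationTheory.klFun (ρ y)) ∂Q := by
  have := h.isProbabilityMeasure_withDensity
  rw [InformationTheory.klDiv_eq_lintegral_klFun_of_ac (withDensity_absolutelyContinuous Q _)]
  refine lintegral_congr_ae ?_
  filter_upwards [h.rnDeriv_ae_eq] with y hy
  simp [hy]

end Divergence

/-! ### Law of the selected sample and expected logarithms of the messages -/

variable {N : ℕ} [NeZero N]

lemma lintegral_selected {f : Batch 𝒴 N × ℝ → ℝ≥0∞} (hf : Measurable f) :
    ∫⁻ w, f (w (K1 Q ρ ωx ω w)) ∂(randomnessLaw Q N) =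
      (ENNReal.ofReal (Delta N ω))⁻¹ *
        ∫⁻ bu in acceptSet Q ρ ωx ω, f bu ∂((batchLaw Q N).prod uniform01) := by
  rw [← h.measure_acceptSet]
  exact lintegral_eval_firstIndex _ (measurableSet_acceptSet Q h.measurable ωx ω)
    h.measure_acceptSet_ne_zero hf

/-- The selected sample has the target law. -/
lemma map_sample : (randomnessLaw Q N).map (sample Q ρ ωx ω) =
    Q.withDensity fun y => (ρ y : ℝ≥0∞) := by
  have hρ := h.measurable
  ext s hs
  have hm : Measurable fun b : Batch 𝒴 N => (b (cand ρ b)).1 :=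
    Measurable.comp_cand (g := fun y k => y k) hρ fun k => measurable_pi_apply k
  rw [Measure.map_apply (measurable_sample Q hρ ωx ω) hs,
    ← lintegral_indicator_one (measurable_sample Q hρ ωx ω hs)]
  change ∫⁻ w, s.indicator 1 (((w (K1 Q ρ ωx ω w)).1 (cand ρ (w (K1 Q ρ ωx ω w)).1)).1)
    ∂(randomnessLaw Q N) = _
  rw [h.lintegral_selected (f := fun bu => s.indicator 1 (bu.1 (cand ρ bu.1)).1)
      ((measurable_one.indicator hs).comp (hm.comp measurable_fst)),
    h.setLIntegral_acceptSet_proposal (measurable_one.indicator hs), ← mul_assoc,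
    ENNReal.inv_mul_cancel (by simpa using h.Delta_pos) ENNReal.ofReal_ne_top, one_mul,
    withDensity_apply _ hs, ← lintegral_indicator hs]
  refine lintegral_congr fun y => ?_
  by_cases hy : y ∈ s <;> simp [hy]

/-- Ensures that `α` and `β` are positive and that `α β ρ d = 1` almost surely. -/
lemma ae_ratio_sample_pos : ∀ᵐ w ∂(randomnessLaw Q N), 0 < ρ (sample Q ρ ωx ω w) := by
  have hρ := h.measurable
  have h1 : ∀ᵐ y ∂((randomnessLaw Q N).map (sample Q ρ ωx ω)), 0 < ρ y := by
    rw [h.map_sample, ae_withDensity_iff hρ.coe_nnreal_ennreal]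
    exact .of_forall fun y hy => pos_iff_ne_zero.2 (by simpa using hy)
  exact ae_of_ae_map (measurable_sample Q hρ ωx ω).aemeasurable h1

/-- The expected logarithm of the group index is at most one bit. -/
lemma lintegral_logb_groupIndex_le :
    ∫⁻ w, ENNReal.ofReal (Real.logb 2 (groupIndex Q ρ ωx ω w)) ∂(randomnessLaw Q N) ≤ 1 := by
  have hA := measurableSet_acceptSet (N := N) Q h.measurable ωx ω
  have hhalf : (1 - ((batchLaw Q N).prod uniform01) (acceptSet Q ρ ωx ω)) ^ groupSize N ω ≤
      2⁻¹ := by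
    rw [h.measure_acceptSet, ← ENNReal.ofReal_one, ← ENNReal.ofReal_sub _ h.Delta_pos.le,
      ← ENNReal.ofReal_pow (by linarith [h.Delta_le_one (N := N)])]
    refine (ENNReal.ofReal_le_ofReal h.one_sub_Delta_pow_le).trans_eq ?_
    rw [one_div, ENNReal.ofReal_inv_of_pos two_pos, ENNReal.ofReal_ofNat]
  refine le_trans (lintegral_mono fun w => ?_)
    (lintegral_firstIndex_div_le _ hA h.groupSize_pos hhalf)
  rw [← ENNReal.ofReal_natCast]
  refine ENNReal.ofReal_le_ofReal ?_
  change Real.logb 2 ((K1 Q ρ ωx ω w / groupSize N ω + 1 : ℕ) : ℝ) ≤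
    ((K1 Q ρ ωx ω w / groupSize N ω : ℕ) : ℝ)
  -- With `n = L - 1`, the bound `log₂ (n + 1) ≤ n` is `n + 1 ≤ 2 ^ n`.
  rw [Real.logb_le_iff_le_rpow one_lt_two (by positivity), Real.rpow_natCast]
  exact_mod_cast Nat.lt_two_pow_self

/-- Given the batch, rejection means that `U` exceeds a threshold in `[0, 1]`, so `uniform01_Ioc_le`
applies fibrewise. This is the hypothesis `hVAle` for the rank of `U`. -/
lemma measure_acceptSet_compl_inter_le (u : ℝ) :
    ((batchLaw Q N).prod uniform01) ((acceptSet Q ρ ωx ω)ᶜ ∩ {bu | bu.2 ≤ u}) ≤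
      (1 - ((batchLaw Q N).prod uniform01) (acceptSet Q ρ ωx ω)) * ENNReal.ofReal u := by
  have hA := measurableSet_acceptSet (N := N) Q h.measurable ωx ω
  have hu : MeasurableSet {bu : Batch 𝒴 N × ℝ | bu.2 ≤ u} :=
    measurableSet_le measurable_snd measurable_const
  rw [← prob_compl_eq_one_sub hA, Measure.prod_apply (hA.compl.inter hu),
    Measure.prod_apply hA.compl, ← lintegral_mul_const _ (measurable_measure_prodMk_left hA.compl)]
  exact lintegral_mono fun b =>
    uniform01_Ioc_le (h.threshold_nonneg _ _) (h.threshold_le_one (fun j => (b j).1) (cand ρ b)) u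

/-- The weight `α` is `Δ` over the threshold. On acceptance `U` is at most the threshold, so `α * G
* U ≤ G * Δ ≤ 1` and `α * (1 + G * U) ≤ α + 1`, where `α` has mean at most 1. -/
lemma lintegral_mul_K1hat_le :
    ∫⁻ w, ENNReal.ofReal (Zbar ρ ωx (fun j => ((w (K1 Q ρ ωx ω w)).1 j).1) (K2 Q ρ ωx ω w) *
        DeltaX Q N ρ ωx / Zhat ρ fun j => ((w (K1 Q ρ ωx ω w)).1 j).1) *
        (K1hat Q ρ ωx ω w : ℝ≥0∞) ∂(randomnessLaw Q N) ≤ 2 := by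
  have hρ := h.measurable
  have hA := measurableSet_acceptSet (N := N) Q hρ ωx ω
  set f : Batch 𝒴 N × ℝ → ℝ≥0∞ := fun bu => ENNReal.ofReal
    (Zbar ρ ωx (fun j => (bu.1 j).1) (cand ρ bu.1) * DeltaX Q N ρ ωx /
      Zhat ρ fun j => (bu.1 j).1) with hf
  have hfm : Measurable f := by
    have h1 := measurable_Zhat (N := N) hρ
    have h2 := measurable_Zbar (N := N) hρ ωx
    exact (Measurable.comp_cand
      (g := fun y k => ENNReal.ofReal (Zbar ρ ωx y k * DeltaX Q N ρ ωx / Zhat ρ y)) hρ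
      fun k => by have := h2 k; fun_prop).comp measurable_fst
  have hV (u : ℝ) : ((batchLaw Q N).prod uniform01) {bu | bu.2 ≤ u} ≤ ENNReal.ofReal u := by
    refine le_trans (le_of_eq ?_) (uniform01_Iic_le u)
    exact measurePreserving_snd.measure_preimage (measurableSet_setOf_le u).nullMeasurableSet
  have hmain := lintegral_mul_rankIn_le _ hA h.measure_acceptSet_ne_zero hfm measurable_snd hV
    h.measure_acceptSet_compl_inter_le (groupSize N ω)
  rw [h.measure_acceptSet] at hmain
  refine le_trans hmain (ENNReal.inv_mul_le_of_le_mul ?_)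
  calc _ ≤ ∫⁻ bu in acceptSet Q ρ ωx ω, (f bu + 1) ∂((batchLaw Q N).prod uniform01) := by
        refine setLIntegral_mono' hA fun bu hbu => ?_
        have hbu' : bu.2 ≤ threshold Q ρ ωx ω (fun j => (bu.1 j).1) (cand ρ bu.1) := hbu
        rw [mul_add, mul_one]
        refine add_le_add_right ?_ _
        have h1 := h.Zbar_pos (fun j => (bu.1 j).1) (cand ρ bu.1)
        have h2 := Zhat_nonneg ρ (fun j => (bu.1 j).1)
        have hX := h.DeltaX_pos (N := N)
        have hG := h.groupSize_mul_Delta_le (N := N)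
        have hD := h.Delta_pos (N := N)
        calc f bu * (groupSize N ω * ENNReal.ofReal bu.2)
            ≤ f bu * (groupSize N ω * ENNReal.ofReal
              (threshold Q ρ ωx ω (fun j => (bu.1 j).1) (cand ρ bu.1))) := by gcongr
          _ ≤ 1 := by
              simp only [hf]
              rw [← ENNReal.ofReal_natCast, ← ENNReal.ofReal_mul (by positivity),
                ← ENNReal.ofReal_mul (by positivity), ← ENNReal.ofReal_one]
              refine ENNReal.ofReal_le_ofReal (le_trans ?_ hG)
              unfold threshold
              rcases h2.eq_or_lt' with hZ | hZ
              · rw [hZ]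
                simp only [div_zero, zero_mul]
                positivity
              · refine le_of_eq ?_
                field_simp
    _ = ∫⁻ bu in acceptSet Q ρ ωx ω, f bu ∂((batchLaw Q N).prod uniform01) +
          ENNReal.ofReal (Delta N ω) := by
        rw [lintegral_add_left hfm, lintegral_const, one_mul,
          Measure.restrict_apply MeasurableSet.univ, Set.univ_inter, h.measure_acceptSet]
    _ ≤ 2 * ENNReal.ofReal (Delta N ω) := by
        rw [two_mul]
        exact add_le_add_left h.setLIntegral_acceptSet_inv_threshold_le _

lemma lintegral_mul_K2hat_le :
    ∫⁻ w, ENNReal.ofReal (Zhat ρ (fun j => ((w (K1 Q ρ ωx ω w)).1 j).1) /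
        (N * ρ (sample Q ρ ωx ω w))) * (K2hat Q ρ ωx ω w : ℝ≥0∞) ∂(randomnessLaw Q N) ≤ 2 := by
  have hρ := h.measurable
  have hr : Measurable fun b : Batch 𝒴 N => (candRank ρ b : ℝ≥0∞) :=
    (measurable_of_countable fun n : ℕ => (n : ℝ≥0∞)).comp (measurable_candRank hρ)
  have hm := (Measurable.comp_cand (N := N)
    (g := fun y k => ENNReal.ofReal (Zhat ρ y / (N * ρ (y k)))) hρ
    fun k => by have := measurable_Zhat (N := N) hρ; fun_prop)
  have := h.lintegral_selected (f := fun bu : Batch 𝒴 N × ℝ =>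
    ENNReal.ofReal (Zhat ρ (fun j => (bu.1 j).1) / (N * ρ (bu.1 (cand ρ bu.1)).1)) *
      (candRank ρ bu.1 : ℝ≥0∞)) ((hm.mul hr).comp measurable_fst)
  exact this.trans_le (ENNReal.inv_mul_le_of_le_mul h.setLIntegral_acceptSet_mul_candRank_le)

lemma lintegral_density_le :
    ∫⁻ w, ENNReal.ofReal (N / (Zbar ρ ωx (fun j => ((w (K1 Q ρ ωx ω w)).1 j).1) (K2 Q ρ ωx ω w) *
        DeltaX Q N ρ ωx)) ∂(randomnessLaw Q N) ≤ 3 := by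
  have hρ := h.measurable
  have hm := (Measurable.comp_cand (N := N)
    (g := fun y k => ENNReal.ofReal (N / (Zbar ρ ωx y k * DeltaX Q N ρ ωx))) hρ
    fun k => by have := measurable_Zbar (N := N) hρ ωx k; fun_prop)
  have := h.lintegral_selected (f := fun bu : Batch 𝒴 N × ℝ => ENNReal.ofReal (N /
        (Zbar ρ ωx (fun j => (bu.1 j).1) (cand ρ bu.1) * DeltaX Q N ρ ωx)))
    (hm.comp measurable_fst)
  exact this.trans_le (ENNReal.inv_mul_le_of_le_mul h.setLIntegral_acceptSet_density_le)

omit h in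
-- Split `log x + log y` as `log r + log (α x) + log (β y) + log d`. The inequality `log t ≤ t - 1`
-- is used at `d / 4` because `d` only has mean at most 3; the factor 4 gives the `2 * log 2`.
lemma _root_.ERS.log_add_log_le {x y α β d r : ℝ} (hx : 0 < x) (hy : 0 < y) (hα : 0 < α)
    (hβ : 0 < β) (hd : 0 < d) (hr : 0 < r) (hprod : α * β * (r * d) = 1) :
    Real.log x + Real.log y ≤ Real.log r + (α * x + β * y + d / 4 - 3) + 2 * Real.log 2 := by
  have h1 := Real.log_le_sub_one_of_pos (mul_pos hα hx)
  have h2 := Real.log_le_sub_one_of_pos (mul_pos hβ hy)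
  have h3 := Real.log_le_sub_one_of_pos (show 0 < d / 4 by positivity)
  rw [Real.log_mul hα.ne' hx.ne'] at h1
  rw [Real.log_mul hβ.ne' hy.ne'] at h2
  rw [Real.log_div hd.ne' (by norm_num), show (4 : ℝ) = 2 ^ 2 by norm_num, Real.log_pow] at h3
  have h4 : Real.log α + Real.log β + (Real.log r + Real.log d) = 0 := by
    rw [← Real.log_mul hα.ne' hβ.ne', ← Real.log_mul hr.ne' hd.ne',
      ← Real.log_mul (by positivity) (by positivity), hprod, Real.log_one]
  push_cast at h3
  linarith

/-- The expected logarithms of the two ranks are bounded by the divergence and a constant. -/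
lemma lintegral_logb_K1hat_add_le :
    ∫⁻ w, ENNReal.ofReal (Real.logb 2 (K1hat Q ρ ωx ω w)) ∂(randomnessLaw Q N) +
        ∫⁻ w, ENNReal.ofReal (Real.logb 2 (K2hat Q ρ ωx ω w)) ∂(randomnessLaw Q N) ≤
      ENNReal.ofReal (klBits (Q.withDensity fun y => (ρ y : ℝ≥0∞)) Q +
        2 * Real.logb 2 (Real.exp 1) + 2) := by
  have hρ := h.measurable
  have hK1 : Measurable fun w : Randomness 𝒴 N => (K1hat Q ρ ωx ω w : ℝ) :=
    (measurable_of_countable fun n : ℕ => (n : ℝ)).comp (measurable_K1hat Q hρ ωx ω)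
  have hK2 : Measurable fun w : Randomness 𝒴 N => (K2hat Q ρ ωx ω w : ℝ) :=
    (measurable_of_countable fun n : ℕ => (n : ℝ)).comp (measurable_K2hat Q hρ ωx ω)
  have hK1pos (w : Randomness 𝒴 N) : (1 : ℝ) ≤ K1hat Q ρ ωx ω w := by
    exact_mod_cast rankIn_pos _ _ _
  have hK2pos (w : Randomness 𝒴 N) : (1 : ℝ) ≤ K2hat Q ρ ωx ω w := by
    exact_mod_cast rankIn_pos _ _ _
  have hlog2 : 0 < Real.log 2 := Real.log_pos one_lt_two
  have hN := natCast_one_le (N := N)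
  have hX := h.DeltaX_pos (N := N)
  set y : Randomness 𝒴 N → Fin N → 𝒴 := fun w j => ((w (K1 Q ρ ωx ω w)).1 j).1 with hy
  have hym : Measurable y :=
    (show Measurable fun b : Batch 𝒴 N => fun j => (b j).1 by fun_prop).comp
      (measurable_fst.comp (measurable_selected Q hρ ωx ω))
  have hsm := measurable_sample (N := N) Q hρ ωx ω
  set α : Randomness 𝒴 N → ℝ := fun w =>
    Zbar ρ ωx (y w) (K2 Q ρ ωx ω w) * DeltaX Q N ρ ωx / Zhat ρ (y w) with hα
  set β : Randomness 𝒴 N → ℝ := fun w => Zhat ρ (y w) / (N * ρ (sample Q ρ ωx ω w)) with hβ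
  set d : Randomness 𝒴 N → ℝ := fun w =>
    N / (Zbar ρ ωx (y w) (K2 Q ρ ωx ω w) * DeltaX Q N ρ ωx) with hd
  have hZm : Measurable fun w => Zhat ρ (y w) := (measurable_Zhat hρ).comp hym
  have hZbm : Measurable fun w => Zbar ρ ωx (y w) (K2 Q ρ ωx ω w) :=
    Measurable.eval_countable (f := fun w k => Zbar ρ ωx (y w) k)
      (fun k => (measurable_Zbar hρ ωx k).comp hym) (measurable_K2 Q hρ ωx ω)
  have hαm : Measurable α := (hZbm.mul_const _).div hZm
  have hβm : Measurable β := hZm.div ((hρ.comp hsm).coe_nnreal_real.const_mul _)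
  have hdm : Measurable d := measurable_const.div (hZbm.mul_const _)
  have hZ0 (w) : 0 ≤ Zhat ρ (y w) := Zhat_nonneg ρ (y w)
  have hZb0 (w) : 0 < Zbar ρ ωx (y w) (K2 Q ρ ωx ω w) := h.Zbar_pos _ _
  have hα0 (w) : 0 ≤ α w := div_nonneg (mul_nonneg (hZb0 w).le hX.le) (hZ0 w)
  have hβ0 (w) : 0 ≤ β w := div_nonneg (hZ0 w) (mul_nonneg (by linarith) (NNReal.coe_nonneg _))
  have hd0 (w) : 0 ≤ d w := div_nonneg (by linarith) (mul_nonneg (hZb0 w).le hX.le)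
  set u₁ : Randomness 𝒴 N → ℝ := fun w => α w * K1hat Q ρ ωx ω w with hu₁
  set u₂ : Randomness 𝒴 N → ℝ := fun w => β w * K2hat Q ρ ωx ω w with hu₂
  obtain ⟨hi1, hb1⟩ := integrable_and_integral_le (f := u₁) (μ := randomnessLaw Q N) (hαm.mul hK1)
    (fun w => mul_nonneg (hα0 w) (by linarith [hK1pos w])) zero_le_two (by
      refine le_trans (le_of_eq (lintegral_congr fun w => ?_))
        (h.lintegral_mul_K1hat_le.trans_eq (ENNReal.ofReal_ofNat 2).symm)
      rw [hu₁, ENNReal.ofReal_mul (hα0 w), ENNReal.ofReal_natCast])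
  obtain ⟨hi2, hb2⟩ := integrable_and_integral_le (f := u₂) (μ := randomnessLaw Q N) (hβm.mul hK2)
    (fun w => mul_nonneg (hβ0 w) (by linarith [hK2pos w])) zero_le_two (by
      refine le_trans (le_of_eq (lintegral_congr fun w => ?_))
        (h.lintegral_mul_K2hat_le.trans_eq (ENNReal.ofReal_ofNat 2).symm)
      rw [hu₂, ENNReal.ofReal_mul (hβ0 w), ENNReal.ofReal_natCast])
  obtain ⟨hi3, hb3⟩ := integrable_and_integral_le (μ := randomnessLaw Q N) hdm hd0 zero_le_three
    (h.lintegral_density_le.trans_eq (ENNReal.ofReal_ofNat 3).symm)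
  have hi4 : Integrable (fun w => Real.log (ρ (sample Q ρ ωx ω w))) (randomnessLaw Q N) := by
    have := h.integrable_log_ratio
    rw [← h.map_sample (N := N)] at this
    exact this.comp_measurable hsm
  have hb4 : ∫ w, Real.log (ρ (sample Q ρ ωx ω w)) ∂(randomnessLaw Q N) =
      (InformationTheory.klDiv (Q.withDensity fun y => (ρ y : ℝ≥0∞)) Q).toReal := by
    rw [← h.integral_log_ratio, ← h.map_sample (N := N), integral_map hsm.aemeasurable
      (Measurable.aestronglyMeasurable (by fun_prop))]
  have hi12 : Integrable (fun w => u₁ w + u₂ w) (randomnessLaw Q N) := hi1.add hi2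
  have hi123 : Integrable (fun w => u₁ w + u₂ w + d w / 4) (randomnessLaw Q N) :=
    hi12.add (hi3.div_const 4)
  have hi1233 : Integrable (fun w => u₁ w + u₂ w + d w / 4 - 3) (randomnessLaw Q N) :=
    hi123.sub (integrable_const 3)
  have hi41233 : Integrable (fun w => Real.log (ρ (sample Q ρ ωx ω w)) +
      (u₁ w + u₂ w + d w / 4 - 3)) (randomnessLaw Q N) := hi4.add hi1233
  have hi5 : Integrable (fun w => Real.log (ρ (sample Q ρ ωx ω w)) +
      (u₁ w + u₂ w + d w / 4 - 3) + 2 * Real.log 2) (randomnessLaw Q N) :=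
    hi41233.add (integrable_const _)
  have hpt : ∀ᵐ w ∂(randomnessLaw Q N),
      Real.logb 2 (K1hat Q ρ ωx ω w) + Real.logb 2 (K2hat Q ρ ωx ω w) ≤
      (Real.log (ρ (sample Q ρ ωx ω w)) +
      (u₁ w + u₂ w + d w / 4 - 3) + 2 * Real.log 2) / Real.log 2 := by
    filter_upwards [h.ae_ratio_sample_pos (N := N)] with w hw
    have hw' : (0 : ℝ) < ρ (sample Q ρ ωx ω w) := by exact_mod_cast hw
    have hZ : 0 < Zhat ρ (y w) := hw'.trans_le (ratio_le_Zhat ρ (y w) (K2 Q ρ ωx ω w))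
    have hZb := hZb0 w
    unfold Real.logb
    rw [← add_div]
    refine div_le_div_of_nonneg_right ?_ hlog2.le
    refine log_add_log_le (α := α w) (β := β w) (d := d w) (one_pos.trans_le (hK1pos w))
      (one_pos.trans_le (hK2pos w)) ?_ ?_ ?_ hw' ?_
    · simp only [hα]; positivity
    · simp only [hβ]; positivity
    · simp only [hd]; positivity
    · simp only [hα, hβ, hd]
      field_simp
  have hlm1 : Measurable fun w : Randomness 𝒴 N =>
      ENNReal.ofReal (Real.logb 2 (K1hat Q ρ ωx ω w)) := by
    unfold Real.logb
    fun_prop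
  have hl1 (w) : 0 ≤ Real.logb 2 (K1hat Q ρ ωx ω w) := Real.logb_nonneg one_lt_two (hK1pos w)
  have hl2 (w) : 0 ≤ Real.logb 2 (K2hat Q ρ ωx ω w) := Real.logb_nonneg one_lt_two (hK2pos w)
  rw [← lintegral_add_left hlm1]
  simp_rw [← ENNReal.ofReal_add (hl1 _) (hl2 _)]
  have hnn := hpt.mono fun w hw => (add_nonneg (hl1 w) (hl2 w)).trans hw
  refine (lintegral_mono_ae (hpt.mono fun w hw => ENNReal.ofReal_le_ofReal hw)).trans ?_
  rw [← ofReal_integral_eq_lintegral_ofReal (hi5.div_const _) hnn]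
  refine ENNReal.ofReal_le_ofReal ?_
  rw [integral_div, integral_add hi41233 (integrable_const _), integral_add hi4 hi1233,
    integral_sub hi123 (integrable_const _), integral_add hi12 (hi3.div_const 4),
    integral_add hi1 hi2, integral_div, hb4]
  simp only [integral_const, probReal_univ, smul_eq_mul, one_mul]
  unfold klBits Real.logb
  rw [Real.log_exp, div_le_iff₀ hlog2]
  have e : ((InformationTheory.klDiv (Q.withDensity fun y => (ρ y : ℝ≥0∞)) Q).toReal / Real.log 2 +
      2 * (1 / Real.log 2) + 2) * Real.log 2 =
      (InformationTheory.klDiv (Q.withDensity fun y => (ρ y : ℝ≥0∞)) Q).toReal + 2 +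
        2 * Real.log 2 := by
    field_simp
  rw [e]
  -- The means contribute `2 + 2 + 3/4 - 3 ≤ 2`.
  linarith

end IsBoundedRatio

/-! ### Prefix codes with prescribed lengths -/

section PrefixCode

/-- The first `m` binary digits of the fractional part of `x`. -/
noncomputable def binaryDigits (x : ℝ) (m : ℕ) : List Bool :=
  (List.range m).map fun t => decide (⌊x * 2 ^ (t + 1)⌋₊ % 2 = 1)

lemma length_binaryDigits (x : ℝ) (m : ℕ) : (binaryDigits x m).length = m := by
  simp [binaryDigits]

lemma floor_mul_two_pow_succ_div_two (x : ℝ) (t : ℕ) :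
    ⌊x * 2 ^ (t + 1)⌋₊ / 2 = ⌊x * 2 ^ t⌋₊ := by
  rw [← Nat.floor_div_ofNat]
  congr 1
  rw [pow_succ]
  ring

/-- The floor at level `t + 1` is determined by its half, the floor at level `t`, and its parity,
the digit; level 0 is 0 because `x, y < 1`. -/
lemma floor_eq_of_binaryDigits_prefix {x y : ℝ} (hx1 : x < 1) (hy1 : y < 1) {m n : ℕ}
    (h : binaryDigits x m <+: binaryDigits y n) {t : ℕ} (ht : t ≤ m) :
    ⌊x * 2 ^ t⌋₊ = ⌊y * 2 ^ t⌋₊ := by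
  induction t with
  | zero => simp [Nat.floor_eq_zero.2 hx1, Nat.floor_eq_zero.2 hy1]
  | succ t ih =>
    have hlt : t < (binaryDigits x m).length := by rw [length_binaryDigits]; omega
    have hget := h.getElem hlt
    simp only [binaryDigits, List.getElem_map, List.getElem_range, decide_eq_decide] at hget
    have hx2 := floor_mul_two_pow_succ_div_two x t
    have hy2 := floor_mul_two_pow_succ_div_two y t
    have := ih (by omega)
    omega

/-- **Converse of Kraft's inequality**, for monotone code word lengths. -/
lemma exists_prefix_code (l : ℕ → ℕ) (hl : Monotone l)
    (hK : ∀ K, ∑ j ∈ Finset.range K, ((2 : ℝ) ^ l j)⁻¹ ≤ 1) :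
    ∃ c : ℕ → List Bool, (∀ i j, c i <+: c j → i = j) ∧ ∀ k, (c k).length = l k := by
  set F : ℕ → ℝ := fun K => ∑ j ∈ Finset.range K, ((2 : ℝ) ^ l j)⁻¹ with hF
  have hF0 (K : ℕ) : 0 ≤ F K := Finset.sum_nonneg fun j _ => by positivity
  have hFsucc (K : ℕ) : F (K + 1) = F K + ((2 : ℝ) ^ l K)⁻¹ := Finset.sum_range_succ _ _
  have hF1 (K : ℕ) : F K < 1 := by
    have h1 := hK (K + 1)
    have h2 := hFsucc K
    have : (0 : ℝ) < ((2 : ℝ) ^ l K)⁻¹ := by positivity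
    simp only [hF] at h1 h2 ⊢
    linarith
  have hFmono : Monotone F := monotone_nat_of_le_succ fun K => by
    rw [hFsucc]
    have : (0 : ℝ) < ((2 : ℝ) ^ l K)⁻¹ := by positivity
    linarith
  -- The word of `k` is the binary expansion of the cumulative sum `F k` to `l k` digits. Later sums
  -- exceed `F i` by at least `2 ^ (-l i)`, hence differ within `l i` digits.
  have hsep {i j : ℕ} (hij : i < j) : ⌊F i * 2 ^ l i⌋₊ ≠ ⌊F j * 2 ^ l i⌋₊ := by
    have h1 : F i + ((2 : ℝ) ^ l i)⁻¹ ≤ F j := hFsucc i ▸ hFmono hij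
    have h2 : F i * 2 ^ l i + 1 ≤ F j * 2 ^ l i := by
      have := mul_le_mul_of_nonneg_right h1 (show (0 : ℝ) ≤ 2 ^ l i by positivity)
      rwa [add_mul, inv_mul_cancel₀ (by positivity)] at this
    have h3 := Nat.floor_mono h2
    rw [Nat.floor_add_one (mul_nonneg (hF0 i) (by positivity))] at h3
    omega
  refine ⟨fun k => binaryDigits (F k) (l k), fun i j h => ?_, fun k => length_binaryDigits _ _⟩
  have hlen : l i ≤ l j := by simpa [length_binaryDigits] using h.length_le
  rcases lt_trichotomy i j with hij | hij | hij
  · exact absurd (floor_eq_of_binaryDigits_prefix (hF1 i) (hF1 j) h le_rfl) (hsep hij)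
  · exact hij
  -- If `j < i`, monotonicity and the prefix relation force equal lengths, so `hsep` applies with
  -- the roles exchanged.
  · have hl' : l i = l j := le_antisymm hlen (hl hij.le)
    have := floor_eq_of_binaryDigits_prefix (hF1 i) (hF1 j) h hl'.ge
    exact absurd this.symm (hsep hij)

end PrefixCode

/-! ### Zipf codes -/

section Zipf

variable {s : ℝ}

lemma summable_add_one_rpow_neg (hs : 1 < s) : Summable fun j : ℕ => ((j : ℝ) + 1) ^ (-s) := by
  have := (summable_nat_add_iff 1).2 (Real.summable_nat_rpow.2 (neg_lt_neg hs))
  simpa using this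

/-- The terms after the first are compared with `∫ x ^ (-s)` over `[1, ∞)`. -/
lemma tsum_add_one_rpow_neg_le (hs : 1 < s) :
    ∑' j : ℕ, ((j : ℝ) + 1) ^ (-s) ≤ 1 + 1 / (s - 1) := by
  have hs' : 0 < s - 1 := by linarith
  refine Real.tsum_le_of_sum_range_le (fun j => by positivity) fun n => ?_
  have hstep : ∑ j ∈ Finset.range (n + 1), ((j : ℝ) + 1) ^ (-s) ≤ 1 + 1 / (s - 1) := by
    rw [Finset.sum_range_succ']
    have hanti : AntitoneOn (fun x : ℝ => x ^ (-s)) (Set.Icc 1 (1 + n)) := by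
      intro x hx y hy hxy
      exact Real.rpow_le_rpow_of_nonpos (by linarith [hx.1]) hxy (by linarith)
    have h := hanti.sum_le_integral
    rw [integral_rpow (.inr ⟨by linarith, by
      rw [Set.uIcc_of_le (by linarith [(Nat.cast_nonneg n : (0 : ℝ) ≤ n)])]
      exact fun h0 => by linarith [h0.1]⟩)] at h
    have hb : (((1 : ℝ) + n) ^ (-s + 1) - 1 ^ (-s + 1)) / (-s + 1) ≤ 1 / (s - 1) := by
      have : (0 : ℝ) ≤ (1 + n : ℝ) ^ (-s + 1) := by positivity
      rw [Real.one_rpow, show -s + 1 = -(s - 1) by ring, div_neg, ← neg_div, neg_sub]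
      rw [show -s + 1 = -(s - 1) by ring] at this
      gcongr
      linarith
    have heq : ∑ j ∈ Finset.range n, (((j + 1 : ℕ) : ℝ) + 1) ^ (-s) =
        ∑ j ∈ Finset.range n, (1 + ((j + 1 : ℕ) : ℝ)) ^ (-s) :=
      Finset.sum_congr rfl fun j _ => by rw [add_comm]
    rw [heq]
    rw [Nat.cast_zero, zero_add, Real.one_rpow, add_comm]
    gcongr
    exact h.trans hb
  refine le_trans ?_ hstep
  rw [Finset.sum_range_succ]
  have : (0 : ℝ) ≤ ((n : ℝ) + 1) ^ (-s) := by positivity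
  linarith

lemma one_le_tsum_add_one_rpow_neg (hs : 1 < s) : 1 ≤ ∑' j : ℕ, ((j : ℝ) + 1) ^ (-s) := by
  have := (summable_add_one_rpow_neg hs).le_tsum 0 fun j _ => by positivity
  simpa using this

lemma zipf_pos (hs : 1 < s) {k : ℕ} (hk : 0 < k) : 0 < zipf s k := by
  have := one_le_tsum_add_one_rpow_neg hs
  have : (0 : ℝ) < k := by exact_mod_cast hk
  unfold zipf
  positivity

lemma neg_logb_zipf (hs : 1 < s) {k : ℕ} (hk : 0 < k) :
    -Real.logb 2 (zipf s k) =
      s * Real.logb 2 k + Real.logb 2 (∑' j : ℕ, ((j : ℝ) + 1) ^ (-s)) := by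
  have h1 := one_le_tsum_add_one_rpow_neg hs
  have hk' : (0 : ℝ) < k := by exact_mod_cast hk
  unfold zipf
  rw [Real.logb_div (by positivity) (by positivity), Real.logb_rpow_eq_mul_logb_of_pos hk']
  ring

/-- The length of the code word of `k` for the Zipf distribution with exponent `s`. -/
lemma IsZipfCode.length_le {c : ℕ → List Bool} (hc : IsZipfCode s c) {k : ℕ} (hk : 0 < k) :
    ((c k).length : ℝ) ≤ s * Real.logb 2 k + Real.logb 2 (1 + 1 / (s - 1)) + 1 := by
  have hs := hc.one_lt
  have h1 := one_le_tsum_add_one_rpow_neg hs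
  have hlog0 : 0 ≤ Real.logb 2 (k : ℝ) := Real.logb_nonneg one_lt_two (by exact_mod_cast hk)
  have hlog1 := Real.logb_nonneg one_lt_two h1
  rw [hc.length_eq k hk, neg_logb_zipf hs hk]
  refine (Nat.ceil_lt_add_one (by positivity)).le.trans ?_
  gcongr
  · norm_num
  · exact tsum_add_one_rpow_neg_le hs

/-- The Zipf weights decrease, so the lengths are monotone, and the Kraft sum is at most the total
Zipf mass. The code is built on indices from 0 and shifted by one. -/
lemma exists_isZipfCode (hs : 1 < s) : ∃ c, IsZipfCode s c := by
  have hT := one_le_tsum_add_one_rpow_neg hs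
  have hanti : Antitone fun k : ℕ => zipf s (k + 1) := fun i j hij => by
    unfold zipf
    refine div_le_div_of_nonneg_right ?_ (by linarith)
    exact Real.rpow_le_rpow_of_nonpos (by positivity) (by exact_mod_cast Nat.succ_le_succ hij)
      (by linarith)
  have hpos (k : ℕ) : 0 < zipf s (k + 1) := zipf_pos hs k.succ_pos
  obtain ⟨c, hc, hlen⟩ := exists_prefix_code (fun k => ⌈-Real.logb 2 (zipf s (k + 1))⌉₊)
    (fun i j hij => Nat.ceil_mono (neg_le_neg
      (Real.logb_le_logb_of_le one_lt_two (hpos j) (hanti hij)))) fun K => by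
    calc ∑ k ∈ Finset.range K, ((2 : ℝ) ^ ⌈-Real.logb 2 (zipf s (k + 1))⌉₊)⁻¹
        ≤ ∑ k ∈ Finset.range K, zipf s (k + 1) := by
          refine Finset.sum_le_sum fun k _ => ?_
          rw [← Real.rpow_natCast, ← Real.rpow_neg two_pos.le]
          calc (2 : ℝ) ^ (-((⌈-Real.logb 2 (zipf s (k + 1))⌉₊ : ℕ) : ℝ))
              ≤ 2 ^ Real.logb 2 (zipf s (k + 1)) :=
                Real.rpow_le_rpow_of_exponent_le one_le_two (by
                  linarith [Nat.le_ceil (-Real.logb 2 (zipf s (k + 1)))])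
            _ = _ := Real.rpow_logb two_pos (by norm_num) (hpos k)
      _ = (∑ k ∈ Finset.range K, ((k : ℝ) + 1) ^ (-s)) / ∑' j : ℕ, ((j : ℝ) + 1) ^ (-s) := by
          rw [Finset.sum_div]
          simp [zipf]
      _ ≤ 1 := by
          rw [div_le_one (by linarith)]
          exact (summable_add_one_rpow_neg hs).sum_le_tsum _ fun j _ => by positivity
  refine ⟨fun k => c (k - 1), hs, fun i j hi hj h => ?_, fun k hk => ?_⟩
  · have := hc _ _ h
    omega
  · rw [hlen]
    simp only [Nat.sub_add_cancel hk]

/-- Code words of a prefix code can be recovered from a concatenation. -/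
lemma IsZipfCode.append_inj {c : ℕ → List Bool} (hc : IsZipfCode s c) {i j : ℕ} (hi : 0 < i)
    (hj : 0 < j) {u v : List Bool} (h : c i ++ u = c j ++ v) : i = j ∧ u = v := by
  have hij : i = j := by
    have h1 : c i <+: c j ++ v := ⟨u, h⟩
    have h2 : c j <+: c j ++ v := ⟨v, rfl⟩
    rcases List.prefix_or_prefix_of_prefix h1 h2 with h3 | h3
    · exact hc.prefixFree i j hi hj h3
    · exact (hc.prefixFree j i hj hi h3).symm
  subst hij
  exact ⟨rfl, List.append_cancel_left h⟩

end Zipf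

/-! ### Decoding -/

section Decoder

variable {ι : Type*} [LinearOrder ι]

/-- Recovers `f k` from the rank of `v k` in `s`. -/
noncomputable def invRank (s : Finset ι) (v : ι → ℝ) (f : ι → ℕ) (a : ℕ) : ℕ :=
  ∑ i ∈ s, if rankIn s v i = a then f i else 0

lemma invRank_rankIn {s : Finset ι} (v : ι → ℝ) (f : ι → ℕ) {k : ι} (hk : k ∈ s) :
    invRank s v f (rankIn s v k) = f k := by
  unfold invRank
  rw [Finset.sum_eq_single k (fun i hi hik => if_neg fun h => hik (rankIn_injOn s v hi hk h))
    fun h => absurd hk h, if_pos rfl]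

lemma measurable_invRank {α : Type*} [MeasurableSpace α] (s : Finset ι) {v : α → ι → ℝ}
    (hv : ∀ i, Measurable fun x => v x i) (f : ι → ℕ) (a : ℕ) :
    Measurable fun x => invRank s (v x) f a :=
  Finset.measurable_sum _ fun i _ => Measurable.ite
    (measurable_rankIn s hv i (measurableSet_singleton a)) measurable_const measurable_const

variable {𝒴 : Type*} {N : ℕ} [NeZero N]

/-- The batch index with group index `m.1` and rank `m.2.1`, for groups of size `G`. -/
noncomputable def decodeBatch (G : ℕ) (m : ℕ × ℕ × ℕ) (w : Randomness 𝒴 N) : ℕ :=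
  invRank (Finset.Ico ((m.1 - 1) * G) (m.1 * G)) (fun i => (w i).2) id m.2.1

/-- The sample described by the messages `m = (L, K̂₁, K̂₂)`, for groups of size `G`. -/
noncomputable def decodeSample (G : ℕ) (m : ℕ × ℕ × ℕ) (w : Randomness 𝒴 N) : 𝒴 :=
  ((w (decodeBatch G m w)).1 (Fin.ofNat N (invRank Finset.univ
    (fun j => ((w (decodeBatch G m w)).1 j).2) Fin.val m.2.2))).1

lemma measurable_decodeSample [MeasurableSpace 𝒴] (G : ℕ) (m : ℕ × ℕ × ℕ) :
    Measurable (decodeSample G m : Randomness 𝒴 N → 𝒴) := by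
  have h1 : Measurable (decodeBatch G m : Randomness 𝒴 N → ℕ) :=
    measurable_invRank _ (fun i => measurable_snd.comp (measurable_pi_apply i)) _ _
  have h2 : Measurable fun w : Randomness 𝒴 N => w (decodeBatch G m w) :=
    Measurable.eval_countable (f := fun (w : Randomness 𝒴 N) i => w i)
      (fun i => measurable_pi_apply i) h1
  have h3 (j : Fin N) : Measurable fun w : Randomness 𝒴 N => (w (decodeBatch G m w)).1 j :=
    (measurable_pi_apply j).comp (measurable_fst.comp h2)
  have h4 : Measurable fun w : Randomness 𝒴 N => invRank Finset.univ
      (fun j => ((w (decodeBatch G m w)).1 j).2) Fin.val m.2.2 :=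
    measurable_invRank _ (fun j => measurable_snd.comp (h3 j)) _ _
  have h5 : Measurable fun w : Randomness 𝒴 N => (w (decodeBatch G m w)).1 (Fin.ofNat N
      (invRank Finset.univ (fun j => ((w (decodeBatch G m w)).1 j).2) Fin.val m.2.2)) :=
    Measurable.eval_countable
      (f := fun (w : Randomness 𝒴 N) (n : ℕ) => (w (decodeBatch G m w)).1 (Fin.ofNat N n))
      (fun n => h3 _) h4
  exact measurable_fst.comp h5

lemma decodeSample_messages [MeasurableSpace 𝒴] (Q : Measure 𝒴) (ρ : 𝒴 → ℝ≥0) (ωx ω : ℝ)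
    (hG : 0 < groupSize N ω) (w : Randomness 𝒴 N) :
    decodeSample (groupSize N ω) (groupIndex Q ρ ωx ω w, K1hat Q ρ ωx ω w, K2hat Q ρ ωx ω w) w =
      sample Q ρ ωx ω w := by
  have h1 : decodeBatch (groupSize N ω)
      (groupIndex Q ρ ωx ω w, K1hat Q ρ ωx ω w, K2hat Q ρ ωx ω w) w = K1 Q ρ ωx ω w := by
    refine invRank_rankIn _ id (Finset.mem_Ico.2 ⟨?_, ?_⟩)
    · exact Nat.div_mul_le_self _ _
    · exact Nat.lt_mul_of_div_lt (Nat.lt_succ_self _) hG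
  unfold decodeSample
  rw [h1]
  have h2 : invRank Finset.univ (fun j => ((w (K1 Q ρ ωx ω w)).1 j).2) Fin.val
      (K2hat Q ρ ωx ω w) = K2 Q ρ ωx ω w := invRank_rankIn _ _ (Finset.mem_univ _)
  simp only [h2, Fin.ofNat_val_eq_self]
  rfl

/-- A triple of positive integers is determined by the concatenation of its code words. -/
lemma exists_decodeMessages {sL s₁ s₂ : ℝ} {cL c₁ c₂ : ℕ → List Bool} (hL : IsZipfCode sL cL)
    (h₁ : IsZipfCode s₁ c₁) (h₂ : IsZipfCode s₂ c₂) :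
    ∃ d : List Bool → ℕ × ℕ × ℕ, ∀ i j k, 0 < i → 0 < j → 0 < k →
      d (cL i ++ c₁ j ++ c₂ k) = (i, j, k) := by
  classical
  refine ⟨fun b => if h : ∃ m : ℕ × ℕ × ℕ, (0 < m.1 ∧ 0 < m.2.1 ∧ 0 < m.2.2) ∧
    cL m.1 ++ c₁ m.2.1 ++ c₂ m.2.2 = b then h.choose else (0, 0, 0), fun i j k hi hj hk => ?_⟩
  have h : ∃ m : ℕ × ℕ × ℕ, (0 < m.1 ∧ 0 < m.2.1 ∧ 0 < m.2.2) ∧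
      cL m.1 ++ c₁ m.2.1 ++ c₂ m.2.2 = cL i ++ c₁ j ++ c₂ k := ⟨(i, j, k), ⟨hi, hj, hk⟩, rfl⟩
  refine (dif_pos h).trans ?_
  obtain ⟨⟨hi', hj', hk'⟩, heq⟩ := h.choose_spec
  generalize h.choose = m at *
  obtain ⟨i', j', k'⟩ := m
  simp only [List.append_assoc] at hi' hj' hk' heq
  obtain ⟨rfl, heq₁⟩ := hL.append_inj hi' hi heq
  obtain ⟨rfl, heq₂⟩ := h₁.append_inj hj' hj heq₁
  rw [h₂.prefixFree k' k hk' hk (heq₂ ▸ List.prefix_rfl)]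

/-- The encoded string and the common randomness determine the selected sample. -/
lemma exists_decoder [MeasurableSpace 𝒴] {ω : ℝ} (hG : 0 < groupSize N ω) {sL s₁ s₂ : ℝ}
    {cL c₁ c₂ : ℕ → List Bool} (hL : IsZipfCode sL cL) (h₁ : IsZipfCode s₁ c₁)
    (h₂ : IsZipfCode s₂ c₂) :
    ∃ g : List Bool → Randomness 𝒴 N → 𝒴, (∀ m, Measurable (g m)) ∧
      ∀ (Q : Measure 𝒴) (ρ : 𝒴 → ℝ≥0) (ωx : ℝ) (w : Randomness 𝒴 N),
        g (encode cL c₁ c₂ Q ρ ωx ω w) w = sample Q ρ ωx ω w := by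
  obtain ⟨d, hd⟩ := exists_decodeMessages hL h₁ h₂
  -- The group size depends on `N` and `ω` only, so a single map serves all targets.
  refine ⟨fun b => decodeSample (groupSize N ω) (d b), fun m => measurable_decodeSample _ _,
    fun Q ρ ωx w => ?_⟩
  have hL0 : 0 < groupIndex Q ρ ωx ω w := Nat.succ_pos _
  have h₁0 : 0 < K1hat Q ρ ωx ω w := rankIn_pos _ _ _
  have h₂0 : 0 < K2hat Q ρ ωx ω w := rankIn_pos _ _ _
  dsimp only [encode]
  rw [hd _ _ _ hL0 h₁0 h₂0, decodeSample_messages Q ρ ωx ω hG w]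

end Decoder

/-! ### The rate -/

section Rate

/-- The conditional divergence averages to the mutual information. -/
lemma lintegral_klDiv_eq {𝒳 𝒴 : Type*} [MeasurableSpace 𝒳] [MeasurableSpace 𝒴]
    {PX : Measure 𝒳} [IsProbabilityMeasure PX] {Q : Measure 𝒴} [IsProbabilityMeasure Q]
    {r : 𝒳 → 𝒴 → ℝ≥0} {ω : ℝ} {ωx : 𝒳 → ℝ}
    (hr : IsBoundedRatio (PX.prod Q) (Function.uncurry r) ω ω)
    (hx : ∀ x, IsBoundedRatio Q (r x) (ωx x) ω) :
    ∫⁻ x, InformationTheory.klDiv (Q.withDensity fun y => (r x y : ℝ≥0∞)) Q ∂PX =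
      InformationTheory.klDiv
        ((PX.prod Q).withDensity fun p => ((Function.uncurry r p : ℝ≥0) : ℝ≥0∞)) (PX.prod Q) := by
  have hm : Measurable fun p : 𝒳 × 𝒴 =>
      ENNReal.ofReal (InformationTheory.klFun ((Function.uncurry r p : ℝ≥0) : ℝ)) :=
    (InformationTheory.measurable_klFun.comp hr.measurable.coe_nnreal_real).ennreal_ofReal
  -- Both sides integrate the nonnegative `klFun (r x y)`, so Tonelli suffices.
  rw [hr.klDiv_eq_lintegral, lintegral_prod _ hm.aemeasurable]
  exact lintegral_congr fun x => (hx x).klDiv_eq_lintegral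

/-- Makes the joint law a bounded-ratio target with respect to the product of the marginals, so that
the divergence lemmas also cover the mutual information. -/
lemma compProd_eq_withDensity {𝒳 𝒴 : Type*} [MeasurableSpace 𝒳] [MeasurableSpace 𝒴]
    {PX : Measure 𝒳} [IsProbabilityMeasure PX] {κ : Kernel 𝒳 𝒴} [IsMarkovKernel κ]
    {Q : Measure 𝒴} [IsProbabilityMeasure Q] {r : 𝒳 → 𝒴 → ℝ≥0}
    (hr_meas : Measurable (Function.uncurry r))
    (hr : ∀ x, κ x = Q.withDensity fun y => (r x y : ℝ≥0∞)) :
    PX ⊗ₘ κ = (PX.prod Q).withDensity fun p => ((Function.uncurry r p : ℝ≥0) : ℝ≥0∞) := by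
  ext s hs
  rw [Measure.compProd_apply hs, withDensity_apply _ hs, ← lintegral_indicator hs,
    lintegral_prod _ (hr_meas.coe_nnreal_ennreal.indicator hs).aemeasurable]
  refine lintegral_congr fun x => ?_
  have hsx : MeasurableSet (Prod.mk x ⁻¹' s) := measurable_prodMk_left hs
  rw [hr x, withDensity_apply _ hsx, ← lintegral_indicator hsx]
  rfl

variable {𝒴 : Type*} [MeasurableSpace 𝒴] {Q : Measure 𝒴} [IsProbabilityMeasure Q] {ρ : 𝒴 → ℝ≥0}
  {ωx ω : ℝ} {N : ℕ} [NeZero N]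

/-- The expected length of the encoded string, for a fixed target. -/
lemma IsBoundedRatio.lintegral_length_encode_le (h : IsBoundedRatio Q ρ ωx ω) {s : ℝ}
    {cL c₁ c₂ : ℕ → List Bool} (hL : IsZipfCode 2 cL) (h₁ : IsZipfCode s c₁)
    (h₂ : IsZipfCode s c₂) :
    ∫⁻ w, ((encode cL c₁ c₂ Q ρ ωx ω w).length : ℝ≥0∞) ∂(randomnessLaw Q N) ≤
      ENNReal.ofReal s * ENNReal.ofReal (klBits (Q.withDensity fun y => (ρ y : ℝ≥0∞)) Q +
        2 * Real.logb 2 (Real.exp 1) + 2) +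
      ENNReal.ofReal (6 + 2 * Real.logb 2 (1 + 1 / (s - 1))) := by
  have hρ := h.measurable
  have hs := h₁.one_lt
  have hlog (k : ℕ) : 0 ≤ Real.logb 2 (k : ℝ) := by
    unfold Real.logb
    exact div_nonneg (Real.log_natCast_nonneg k) (Real.log_pos one_lt_two).le
  have hζ : 0 ≤ Real.logb 2 (1 + 1 / (s - 1)) :=
    Real.logb_nonneg one_lt_two (by have := one_div_pos.2 (sub_pos.2 hs); linarith)
  have hlogm {f : Randomness 𝒴 N → ℕ} (hf : Measurable f) :
      Measurable fun w => ENNReal.ofReal (Real.logb 2 (f w)) :=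
    (measurable_of_countable fun n : ℕ => ENNReal.ofReal (Real.logb 2 n)).comp hf
  have hm1 := hlogm (measurable_K1hat Q hρ ωx ω)
  have hm2 := hlogm (measurable_K2hat Q hρ ωx ω)
  have hmL := hlogm (measurable_groupIndex Q hρ ωx ω)
  have hm12 : Measurable fun w : Randomness 𝒴 N => ENNReal.ofReal (Real.logb 2 (K1hat Q ρ ωx ω w)) +
      ENNReal.ofReal (Real.logb 2 (K2hat Q ρ ωx ω w)) := hm1.add hm2
  have hms : Measurable fun w : Randomness 𝒴 N => ENNReal.ofReal s *
      (ENNReal.ofReal (Real.logb 2 (K1hat Q ρ ωx ω w)) +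
        ENNReal.ofReal (Real.logb 2 (K2hat Q ρ ωx ω w))) := hm12.const_mul _
  have hmL2 : Measurable fun w : Randomness 𝒴 N =>
      2 * ENNReal.ofReal (Real.logb 2 (groupIndex Q ρ ωx ω w)) := hmL.const_mul _
  calc ∫⁻ w, ((encode cL c₁ c₂ Q ρ ωx ω w).length : ℝ≥0∞) ∂(randomnessLaw Q N)
      ≤ ∫⁻ w, (ENNReal.ofReal s * (ENNReal.ofReal (Real.logb 2 (K1hat Q ρ ωx ω w)) +
          ENNReal.ofReal (Real.logb 2 (K2hat Q ρ ωx ω w))) +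
          (2 * ENNReal.ofReal (Real.logb 2 (groupIndex Q ρ ωx ω w)) +
          ENNReal.ofReal (4 + 2 * Real.logb 2 (1 + 1 / (s - 1))))) ∂(randomnessLaw Q N) := by
        refine lintegral_mono fun w => ?_
        have e1 : ((cL (groupIndex Q ρ ωx ω w)).length : ℝ) ≤
            2 * Real.logb 2 (groupIndex Q ρ ωx ω w) + Real.logb 2 (1 + 1 / (2 - 1)) + 1 :=
          hL.length_le (Nat.succ_pos _)
        have e2 : ((c₁ (K1hat Q ρ ωx ω w)).length : ℝ) ≤
            s * Real.logb 2 (K1hat Q ρ ωx ω w) + Real.logb 2 (1 + 1 / (s - 1)) + 1 :=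
          h₁.length_le (rankIn_pos _ _ _)
        have e3 : ((c₂ (K2hat Q ρ ωx ω w)).length : ℝ) ≤
            s * Real.logb 2 (K2hat Q ρ ωx ω w) + Real.logb 2 (1 + 1 / (s - 1)) + 1 :=
          h₂.length_le (rankIn_pos _ _ _)
        -- With exponent 2 for `L`, the normalisation costs one bit. With three roundings this makes
        -- the 4; `2 * E[log L] ≤ 2` raises it to 6.
        have e4 : Real.logb 2 (1 + 1 / (2 - 1)) = 1 := by norm_num
        simp only
        rw [← ENNReal.ofReal_add (hlog _) (hlog _), ← ENNReal.ofReal_mul (by linarith),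
          ← ENNReal.ofReal_ofNat 2, ← ENNReal.ofReal_mul two_pos.le,
          ← ENNReal.ofReal_add (mul_nonneg two_pos.le (hlog _)) (by linarith),
          ← ENNReal.ofReal_add (mul_nonneg (by linarith) (add_nonneg (hlog _) (hlog _)))
            (add_nonneg (mul_nonneg two_pos.le (hlog _)) (by linarith)),
          ← ENNReal.ofReal_natCast]
        refine ENNReal.ofReal_le_ofReal ?_
        simp only [encode, List.length_append]
        push_cast
        rw [e4] at e1
        linarith
    _ = ENNReal.ofReal s * (∫⁻ w, ENNReal.ofReal (Real.logb 2 (K1hat Q ρ ωx ω w))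
            ∂(randomnessLaw Q N) + ∫⁻ w, ENNReal.ofReal (Real.logb 2 (K2hat Q ρ ωx ω w))
            ∂(randomnessLaw Q N)) +
          (2 * ∫⁻ w, ENNReal.ofReal (Real.logb 2 (groupIndex Q ρ ωx ω w)) ∂(randomnessLaw Q N) +
          ENNReal.ofReal (4 + 2 * Real.logb 2 (1 + 1 / (s - 1)))) := by
        rw [lintegral_add_left hms, lintegral_add_left hmL2, lintegral_const_mul _ hm12,
          lintegral_add_left hm1, lintegral_const_mul _ hmL]
        simp
    _ ≤ ENNReal.ofReal s * ENNReal.ofReal (klBits (Q.withDensity fun y => (ρ y : ℝ≥0∞)) Q +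
          2 * Real.logb 2 (Real.exp 1) + 2) +
          (2 * 1 + ENNReal.ofReal (4 + 2 * Real.logb 2 (1 + 1 / (s - 1)))) := by
        gcongr
        · exact h.lintegral_logb_K1hat_add_le
        · exact h.lintegral_logb_groupIndex_le
    _ = _ := by
        rw [mul_one, ← ENNReal.ofReal_ofNat 2, ← ENNReal.ofReal_add two_pos.le (by linarith)]
        congr 2
        ring

lemma klBits_nonneg {α : Type*} [MeasurableSpace α] (P Q : Measure α) : 0 ≤ klBits P Q :=
  div_nonneg ENNReal.toReal_nonneg (Real.log_pos one_lt_two).le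

lemma ofReal_klBits {α : Type*} [MeasurableSpace α] {P Q : Measure α}
    (h : InformationTheory.klDiv P Q ≠ ∞) :
    ENNReal.ofReal (klBits P Q) =
      (ENNReal.ofReal (Real.log 2))⁻¹ * InformationTheory.klDiv P Q := by
  rw [klBits, div_eq_inv_mul, ENNReal.ofReal_mul (inv_nonneg.2 (Real.log_pos one_lt_two).le),
    ENNReal.ofReal_inv_of_pos (Real.log_pos one_lt_two), ENNReal.ofReal_toReal h]

/-- Since `log₂ e ≤ 3/2`, the constant `2 log₂ e + 2` is at most 5. With `s - 1 = 1/(I + 7)` the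
excess `(s - 1) * (I + 5)` is at most 1, and the normalisation argument is `I + 8`. The constants
add up to `5 + 1 + 6 = 12`. -/
lemma rate_le {I : ℝ} (hI : 0 ≤ I) :
    (1 + 1 / (I + 7)) * (I + (2 * Real.logb 2 (Real.exp 1) + 2)) +
        (6 + 2 * Real.logb 2 (1 + 1 / (1 + 1 / (I + 7) - 1))) ≤
      I + 2 * Real.logb 2 (I + 8) + 12 := by
  have hlog := Real.log_two_gt_d9
  have he : Real.logb 2 (Real.exp 1) ≤ 3 / 2 := by
    unfold Real.logb
    rw [Real.log_exp, div_le_iff₀ (by linarith)]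
    linarith
  have harg : 1 + 1 / (1 + 1 / (I + 7) - 1) = I + 8 := by
    rw [add_sub_cancel_left, one_div_one_div]
    ring
  have hfrac : (1 + 1 / (I + 7)) * (I + (2 * Real.logb 2 (Real.exp 1) + 2)) ≤ I + 6 := by
    calc _ ≤ (1 + 1 / (I + 7)) * (I + 5) := by gcongr; linarith
      _ = I + 5 + (I + 5) / (I + 7) := by ring
      _ ≤ I + 5 + 1 := by
          gcongr
          exact (div_le_one (by linarith)).2 (by linarith)
      _ = I + 6 := by ring
  rw [harg]
  linarith

end Rate

end ERS

theorem proposition2 {𝒳 𝒴 : Type*} [MeasurableSpace 𝒳] [MeasurableSpace 𝒴]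
    -- the law of `X` and the channel `P_{Y|X}`; `PY` is the marginal law of `Y`
    (PX : Measure 𝒳) [IsProbabilityMeasure PX]
    (κ : Kernel 𝒳 𝒴) [IsMarkovKernel κ]
    (PY : Measure 𝒴) (hPY : PY = κ ∘ₘ PX)
    -- `r x y` is the ratio `P_{Y|X}(y|x) / P_Y(y)`
    (r : 𝒳 → 𝒴 → ℝ≥0) (hr_meas : Measurable (Function.uncurry r))
    (hr : ∀ x, κ x = PY.withDensity fun y => (r x y : ℝ≥0∞))
    -- the bounding conditions: `ωx x` for the target `P_{Y|X=x}`, and `ω` for all targets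
    (ω : ℝ) (ωx : 𝒳 → ℝ) (hωx_meas : Measurable ωx)
    (hωx : ∀ x y, (r x y : ℝ) ≤ ωx x) (hω : ∀ x, ωx x ≤ ω)
    -- the batch size
    (N : ℕ) [NeZero N] :
    -- the information quantities are finite
    (∀ x, InformationTheory.klDiv (κ x) PY ≠ ∞) ∧
    InformationTheory.klDiv (PX ⊗ₘ κ) (PX.prod PY) ≠ ∞ ∧
    -- the selected sample has the target law
    (∀ x, (ERS.randomnessLaw PY N).map (ERS.sample PY (r x) (ωx x) ω) = κ x) ∧
    -- `E[log L] ≤ 1`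
    (∀ x, ∫⁻ w, ENNReal.ofReal (Real.logb 2 (ERS.groupIndex PY (r x) (ωx x) ω w))
        ∂(ERS.randomnessLaw PY N) ≤ 1) ∧
    -- `E[log K̂₁] + E[log K̂₂] ≤ D_KL(P_{Y|X=x} ‖ P_Y) + 2 log e + 3`
    (∀ x,
      ∫⁻ w, ENNReal.ofReal (Real.logb 2 (ERS.K1hat PY (r x) (ωx x) ω w))
          ∂(ERS.randomnessLaw PY N) +
        ∫⁻ w, ENNReal.ofReal (Real.logb 2 (ERS.K2hat PY (r x) (ωx x) ω w))
          ∂(ERS.randomnessLaw PY N) ≤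
      ENNReal.ofReal (ERS.klBits (κ x) PY + 2 * Real.logb 2 (Real.exp 1) + 3)) ∧
    -- the three messages can be entropy coded, decodably and at the claimed rate
    ∃ (sL s₁ s₂ : ℝ) (cL c₁ c₂ : ℕ → List Bool),
      ERS.IsZipfCode sL cL ∧ ERS.IsZipfCode s₁ c₁ ∧ ERS.IsZipfCode s₂ c₂ ∧
      (∃ g : List Bool → ERS.Randomness 𝒴 N → 𝒴, (∀ m, Measurable (g m)) ∧
        ∀ x w, g (ERS.encode cL c₁ c₂ PY (r x) (ωx x) ω w) w =
          ERS.sample PY (r x) (ωx x) ω w) ∧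
      ∫⁻ p : 𝒳 × ERS.Randomness 𝒴 N,
          ((ERS.encode cL c₁ c₂ PY (r p.1) (ωx p.1) ω p.2).length : ℝ≥0∞)
          ∂(PX.prod (ERS.randomnessLaw PY N)) ≤
        ENNReal.ofReal (ERS.mutualInfoBits PX κ +
          2 * Real.logb 2 (ERS.mutualInfoBits PX κ + 8) + 12) := by
  have hQ : IsProbabilityMeasure PY := hPY ▸ inferInstance
  have hx (x : 𝒳) : ERS.IsBoundedRatio PY (r x) (ωx x) ω := by
    refine ⟨hr_meas.comp measurable_prodMk_left, ?_, hωx x, hω x⟩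
    have : (PY.withDensity fun y => (r x y : ℝ≥0∞)) Set.univ = 1 := by
      rw [← hr x, measure_univ]
    rwa [withDensity_apply _ MeasurableSet.univ, setLIntegral_univ] at this
  have hprod : PX ⊗ₘ κ =
      (PX.prod PY).withDensity fun p => ((Function.uncurry r p : ℝ≥0) : ℝ≥0∞) :=
    ERS.compProd_eq_withDensity hr_meas hr
  -- The joint density is bounded by the global `ω`, so the mutual information is finite as an
  -- instance of the single-target result.
  have hxy : ERS.IsBoundedRatio (PX.prod PY) (Function.uncurry r) ω ω := by
    refine ⟨hr_meas, ?_, fun p => (hωx p.1 p.2).trans (hω p.1), le_rfl⟩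
    rw [← setLIntegral_univ, ← withDensity_apply _ MeasurableSet.univ, ← hprod, measure_univ]
  have hmi : InformationTheory.klDiv (PX ⊗ₘ κ) (PX.prod PY) ≠ ∞ := hprod ▸ hxy.klDiv_ne_top
  have hlog2e : 0 ≤ Real.logb 2 (Real.exp 1) := Real.logb_nonneg one_lt_two (by simp)
  refine ⟨fun x => hr x ▸ (hx x).klDiv_ne_top, hmi, fun x => hr x ▸ (hx x).map_sample,
    fun x => (hx x).lintegral_logb_groupIndex_le, fun x => ?_, ?_⟩
  · refine (hx x).lintegral_logb_K1hat_add_le.trans (ENNReal.ofReal_le_ofReal ?_)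
    rw [← hr x]
    linarith
  set I := ERS.mutualInfoBits PX κ with hIdef
  have hI : I = ERS.klBits (PX ⊗ₘ κ) (PX.prod PY) := by rw [hIdef, ERS.mutualInfoBits, hPY]
  have hI0 : 0 ≤ I := hI ▸ ERS.klBits_nonneg _ _
  set s : ℝ := 1 + 1 / (I + 7) with hs
  have hs1 : 1 < s := by
    have : 0 < 1 / (I + 7) := by positivity
    linarith
  obtain ⟨cL, hL⟩ := ERS.exists_isZipfCode one_lt_two
  obtain ⟨c, hc⟩ := ERS.exists_isZipfCode hs1
  -- Any one target forces `ω ≥ 1`, hence a positive group size.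
  obtain ⟨x₀⟩ : Nonempty 𝒳 := nonempty_of_isProbabilityMeasure PX
  obtain ⟨g, hg, hgdec⟩ := ERS.exists_decoder (𝒴 := 𝒴) (N := N) (hx x₀).groupSize_pos hL hc hc
  refine ⟨2, s, s, cL, c, c, hL, hc, hc, ⟨g, hg, fun x w => hgdec PY (r x) (ωx x) w⟩, ?_⟩
  have havg : ∫⁻ x, ENNReal.ofReal (ERS.klBits (κ x) PY) ∂PX = ENNReal.ofReal I := by
    have hne := ENNReal.inv_ne_top.2
      (ENNReal.ofReal_pos.2 (Real.log_pos one_lt_two)).ne'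
    rw [hI, ERS.ofReal_klBits hmi, hprod, ← ERS.lintegral_klDiv_eq hxy hx,
      ← lintegral_const_mul' _ _ hne]
    refine lintegral_congr fun x => ?_
    rw [ERS.ofReal_klBits (hr x ▸ (hx x).klDiv_ne_top), hr x]
  have hζ : 0 ≤ Real.logb 2 (1 + 1 / (s - 1)) :=
    Real.logb_nonneg one_lt_two (by have := one_div_pos.2 (sub_pos.2 hs1); linarith)
  -- Only the inequality half of Tonelli is needed, so joint measurability of the length in `(x, w)`
  -- is not required.
  calc _ ≤ ∫⁻ x, ∫⁻ w, ((ERS.encode cL c c PY (r x) (ωx x) ω w).length : ℝ≥0∞)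
        ∂(ERS.randomnessLaw PY N) ∂PX := lintegral_prod_le _
    _ ≤ ∫⁻ x, (ENNReal.ofReal s * (ENNReal.ofReal (ERS.klBits (κ x) PY) +
          ENNReal.ofReal (2 * Real.logb 2 (Real.exp 1) + 2)) +
          ENNReal.ofReal (6 + 2 * Real.logb 2 (1 + 1 / (s - 1)))) ∂PX := by
        refine lintegral_mono fun x => ((hx x).lintegral_length_encode_le hL hc hc).trans_eq ?_
        rw [← hr x, ← ENNReal.ofReal_add (ERS.klBits_nonneg _ _) (by linarith), add_assoc]
    _ = ENNReal.ofReal s * (ENNReal.ofReal I +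
          ENNReal.ofReal (2 * Real.logb 2 (Real.exp 1) + 2)) +
          ENNReal.ofReal (6 + 2 * Real.logb 2 (1 + 1 / (s - 1))) := by
        rw [lintegral_add_right _ measurable_const, lintegral_const_mul' _ _ ENNReal.ofReal_ne_top,
          lintegral_add_right _ measurable_const, havg]
        simp
    _ ≤ ENNReal.ofReal (I + 2 * Real.logb 2 (I + 8) + 12) := by
        rw [← ENNReal.ofReal_add hI0 (by linarith), ← ENNReal.ofReal_mul (by linarith),
          ← ENNReal.ofReal_add (mul_nonneg (by linarith) (by linarith)) (by linarith)]
        exact ENNReal.ofReal_le_ofReal (ERS.rate_le hI0)
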